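/- Let $N^{n+1}\subset S^{n+2}\subset\mathbb R^{n+3}$ be a minimal isoparametric hypersurface of the unit sphere: $N=f^{-1}(c)$ for a regular value $c$ of a nonconstant smooth function $f$ on $S^{n+2}$ with $|\nabla f|^2=b(f)$ and $\Delta f=\alpha(f)$ for smooth functions $\alpha,b$, and $N$ has zero mean curvature in $S^{n+2}$. Assume that, with respect to a unit normal field of $N$ in $S^{n+2}$, $N$ has exactly $g=4$ distinct principal curvatures $\lambda_1>\lambda_2>\lambda_3>\lambda_4$, and let $m_1,m_2$ be the multiplicities of $\lambda_1,\lambda_2$. Let $R^N$ and $\operatorname{Ric}_N$ be the curvature tensor (with $R^N(u,v,u,v)$ the sectional curvature for orthonormal $u,v$) and the Ricci curvature of the induced metric on $N$, and let $\Pi$ be the second fundamental form of $N\subset\mathbb R^{n+3}$. For $p\in N$, a unit vector $\nu\in T_pN$, a vector $X\in T_pN$ orthogonal to $\nu$, and an orthonormal basis $e_1,\dots,e_n$ of $\nu^\perp\subset T_pN$ put $$\Delta(X,\nu)=\sum_{k=1}^n R^N(e_k,X,e_k,X)+\operatorname{Ric}_N(\nu,\nu)|X|^2-\sum_{k=1}^n|\Pi(e_k,X)|^2-\sum_{k=1}^n|\Pi(e_k,\nu)|^2|X|^2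 ,$$ which does not depend on the choice of the basis. **Proposition.** Suppose $\min\{m_1,m_2\}=4$ and $s:=m_1+m_2\ge 15$, and set $$a^2=\frac{1+\sqrt{1-4/s}}{1-\sqrt{1-4/s}} .$$ 1. For every $p\in N$ and all orthogonal unit vectors $X,\nu\in T_pN$, $$\Delta(X,\nu)\ \ge\ 4s-4-4a^2\ >\ 0 .$$ 2. The bound is attained at every $p\in N$: the principal curvature of largest absolute value at $p$ has absolute value $|a|$, its eigenspace contains orthogonal unit vectors $X,\nu$, and every such pair in this eigenspace satisfies $\Delta(X,\nu)=4s-4-4a^2$. 3. In particular $N$ satisfies the Ambrozio–Carlotto–Sharp condition: for every closed embedded minimal hypersurface $M^n\subset N$ and every smooth tangent vector field $X$ on $M$ that is not identically zero, $$\int_M\Big[\sum_{k=1}^n R^N(e_k,X,e_k,X)+\operatorname{Ric}_N(\nu,\nu)|X|^2\Big]dM\ >\ \int_M\Big[\sum_{k=1}^n|\Pi(e_k,X)|^2+\sum_{k=1}^n|\Pi(e_k,\nu)|^2|X|^2\Big]dM ,$$ where $\nu$ is a local unit normal field of $M$ in $N$ and $e_1,\dots,e_n$ is a local orthonormal frame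 of $M$. -/

import Mathlib

open MeasureTheory Module
open scoped ContDiff RealInnerProductSpace

noncomputable section

namespace Submfd

/-! Extrinsic Riemannian geometry of a smooth submanifold `S` of a finite-dimensional Euclidean
space `E`, with the metric induced by `E`.  The directional derivative along `S` of a map `V`
given on `S` is `fderivWithin ℝ V S p u`: for `u` tangent to `S` at `p` and `V` differentiable
along `S` this depends only on the values of `V` on `S`. -/

section General

variable {E : Type*} [NormedAddCommGroup E] [InnerProductSpace ℝ E] [FiniteDimensional ℝ E]

/-- `S` is a smooth embedded submanifold of `E` of codimension `k`: locally it is the zero set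
of a smooth submersion to `ℝᵏ`. -/
def IsEmbedded (k : ℕ) (S : Set E) : Prop :=
  ∀ p ∈ S, ∃ (U : Set E) (h : E → EuclideanSpace ℝ (Fin k)),
    IsOpen U ∧ p ∈ U ∧ ContDiffOn ℝ ∞ h U ∧ (∀ x ∈ U, x ∈ S ↔ h x = 0) ∧
      Function.Surjective (fderiv ℝ h p)

/-- The tangent space `T_p S`. -/
def tang (S : Set E) (p : E) : Submodule ℝ E :=
  Submodule.span ℝ (tangentConeAt ℝ S p)

/-- The orthogonal projection of `E` onto `T_p S`. -/
def proj (S : Set E) (p : E) : E →L[ℝ] E :=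
  (tang S p).starProjection

/-- The tangent field `x ↦ (projection of v to T_x S)`; it extends `v ∈ T_p S` to a smooth
tangent vector field on `S`. -/
def ext (S : Set E) (v : E) : E → E := fun x => proj S x v

/-- The Levi-Civita connection of the induced metric: `(∇_U V)(x)` is the tangential part of the
derivative of `V` in the direction `U x`. -/
def cov (S : Set E) (U V : E → E) : E → E :=
  fun x => proj S x (fderivWithin ℝ V S x (U x))

/-- The curvature `R(u, v) w = ∇_U ∇_V W - ∇_V ∇_U W - ∇_[U,V] W` at `p`, for tangent vectors
`u, v, w` at `p` with tangent extensions `U, V, W` (the value does not depend on these). -/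
def curv (S : Set E) (p u v w : E) : E :=
  let U := ext S u
  let V := ext S v
  let W := ext S w
  cov S U (cov S V W) p - cov S V (cov S U W) p
    - cov S (VectorField.lieBracketWithin ℝ U V S) W p

/-- The `(0,4)` curvature tensor, with the sign for which `R(u, v, u, v)` is the sectional
curvature of the plane of an orthonormal pair `u, v`. -/
def curv4 (S : Set E) (p u v w z : E) : ℝ := ⟪curv S p u v z, w⟫

/-- The Ricci curvature `Ric(v, v)`. -/
def ric (S : Set E) (p v : E) : ℝ :=
  ∑ i, curv4 S p (stdOrthonormalBasis ℝ (tang S p) i) v (stdOrthonormalBasis ℝ (tang S p) i) v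

/-- The vector-valued second fundamental form `Π(u, v)` of `S ⊆ E`: the normal part of the
derivative in the direction `u` of a tangent field extending `v`. -/
def sff (S : Set E) (p u v : E) : E :=
  fderivWithin ℝ (ext S v) S p u - proj S p (fderivWithin ℝ (ext S v) S p u)

/-- The mean curvature vector of `S ⊆ E` (trace of the second fundamental form). -/
def meanCurv (S : Set E) (p : E) : E :=
  ∑ i, sff S p (stdOrthonormalBasis ℝ (tang S p) i) (stdOrthonormalBasis ℝ (tang S p) i)

/-- `S` is minimal in the submanifold `T ⊇ S`: the mean curvature vector of `S` in `T`, which is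
the part tangent to `T` of the mean curvature vector of `S` in `E`, vanishes. -/
def IsMinimalIn (S T : Set E) : Prop :=
  S ⊆ T ∧ ∀ p ∈ S, proj T p (meanCurv S p) = 0

/-- The Riemannian gradient on `S` of a function `f`. -/
def grad (S : Set E) (f : E → ℝ) : E → E :=
  fun x => proj S x ((InnerProductSpace.toDual ℝ E).symm (fderivWithin ℝ f S x))

/-- The Laplace–Beltrami operator on `S`, as the divergence of the gradient. -/
def laplacian (S : Set E) (f : E → ℝ) (p : E) : ℝ :=
  ∑ i, ⟪fderivWithin ℝ (grad S f) S p (stdOrthonormalBasis ℝ (tang S p) i),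
    (stdOrthonormalBasis ℝ (tang S p) i : E)⟫

/-- `ν` is a unit vector tangent to `T` and normal to `S` at `p`. -/
def IsUnitNormalAt (S T : Set E) (p ν : E) : Prop :=
  ν ∈ tang T p ∧ ‖ν‖ = 1 ∧ ∀ u ∈ tang S p, ⟪ν, u⟫ = 0

/-- The eigenspace for `κ` of the shape operator `A` of `S` at `p` with respect to the normal
vector `η`, where `⟪A u, v⟫ = ⟪Π(u, v), η⟫` on `T_p S`. -/
def curvSpace (S : Set E) (p η : E) (κ : ℝ) : Submodule ℝ E where
  carrier := {u | u ∈ tang S p ∧ ∀ v ∈ tang S p, ⟪sff S p u v, η⟫ = κ * ⟪u, v⟫}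
  add_mem' := by
    rintro u w ⟨hu, hu'⟩ ⟨hw, hw'⟩
    refine ⟨add_mem hu hw, fun v hv => ?_⟩
    have h1 := hu' v hv
    have h2 := hw' v hv
    simp only [sff, map_add, inner_sub_left, inner_add_left] at h1 h2 ⊢
    linarith
  zero_mem' := ⟨zero_mem _, fun v _ => by simp [sff]⟩
  smul_mem' := by
    rintro c u ⟨hu, hu'⟩
    refine ⟨Submodule.smul_mem _ c hu, fun v hv => ?_⟩
    have h1 := hu' v hv
    simp only [sff, map_smul, inner_sub_left, real_inner_smul_left] at h1 ⊢
    linear_combination c * h1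

/-- The set of principal curvatures of `S` at `p` with respect to the unit normal `η`. -/
def principalCurvatures (S : Set E) (p η : E) : Set ℝ :=
  {κ | curvSpace S p η κ ≠ ⊥}

/-- `∑ₖ R^N(eₖ, X, eₖ, X) + Ric_N(ν, ν) |X|²` at the point `p`. -/
def acsCurv {n : ℕ} (N : Set E) (p : E) (e : Fin n → E) (X ν : E) : ℝ :=
  ∑ k, curv4 N p (e k) X (e k) X + ric N p ν * ‖X‖ ^ 2

/-- `∑ₖ |Π(eₖ, X)|² + ∑ₖ |Π(eₖ, ν)|² |X|²` at the point `p`, where `Π` is the second fundamental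
form of `N` in the Euclidean space. -/
def acsSff {n : ℕ} (N : Set E) (p : E) (e : Fin n → E) (X ν : E) : ℝ :=
  ∑ k, ‖sff N p (e k) X‖ ^ 2 + (∑ k, ‖sff N p (e k) ν‖ ^ 2) * ‖X‖ ^ 2

/-- The quantity `Δ(X, ν)` at `p`, computed in the frame `e`. -/
def Delta {n : ℕ} (N : Set E) (p : E) (e : Fin n → E) (X ν : E) : ℝ :=
  acsCurv N p e X ν - acsSff N p e X ν

/-- `e` is an orthonormal basis of `ν^⊥ ⊆ T_p N` (when `dim N = n + 1` and `ν ∈ T_p N` is a unit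
vector). -/
def IsFrame {n : ℕ} (N : Set E) (p ν : E) (e : Fin n → E) : Prop :=
  Orthonormal ℝ e ∧ ∀ k, e k ∈ tang N p ∧ ⟪e k, ν⟫ = 0

end General

/-- The unit sphere `S^{n+2}` of `ℝ^{n+3}`. -/
abbrev unitSphere (n : ℕ) : Set (EuclideanSpace ℝ (Fin (n + 3))) := Metric.sphere 0 1

/-- `N` is an isoparametric hypersurface of `S^{n+2}`: a regular level set of a nonconstant smooth
function `f` on the sphere with `|∇f|² = b(f)` and `Δf = a(f)`, for smooth functions `a, b`.
(The smooth functions on the sphere are the restrictions of smooth functions on `ℝ^{n+3}`; only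
the values of `f` on the sphere enter.) -/
def IsIsoparametric {n : ℕ} (N : Set (EuclideanSpace ℝ (Fin (n + 3)))) : Prop :=
  ∃ (f : EuclideanSpace ℝ (Fin (n + 3)) → ℝ) (a b : ℝ → ℝ) (c : ℝ),
    ContDiff ℝ ∞ f ∧ ContDiff ℝ ∞ a ∧ ContDiff ℝ ∞ b ∧
    (∃ x ∈ unitSphere n, ∃ y ∈ unitSphere n, f x ≠ f y) ∧
    (∀ x ∈ unitSphere n, ‖grad (unitSphere n) f x‖ ^ 2 = b (f x)) ∧
    (∀ x ∈ unitSphere n, laplacian (unitSphere n) f x = a (f x)) ∧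
    N = {x ∈ unitSphere n | f x = c} ∧
    ∀ x ∈ N, grad (unitSphere n) f x ≠ 0

/-- The Ambrozio–Carlotto–Sharp condition for `N^{n+1} ⊆ ℝ^{n+3}`: for every closed (compact
without boundary) embedded minimal hypersurface `M^n` of `N` and every smooth tangent vector field
`X` on `M` that is not identically zero, the integral over `M` of `acsCurv` is larger than that of
`acsSff`.  The frame `e` and the unit normal `ν` are chosen point by point: the integrands do not
depend on the choices, nor on the sign of `ν`.  The measure is the Riemannian volume of `M`
(`n`-dimensional Hausdorff measure). -/
def SatisfiesACS {n : ℕ} (N : Set (EuclideanSpace ℝ (Fin (n + 3)))) : Prop :=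
  ∀ M : Set (EuclideanSpace ℝ (Fin (n + 3))),
    IsCompact M → IsEmbedded 3 M → IsMinimalIn M N →
    ∀ (X ν : EuclideanSpace ℝ (Fin (n + 3)) → EuclideanSpace ℝ (Fin (n + 3)))
      (e : EuclideanSpace ℝ (Fin (n + 3)) → Fin n → EuclideanSpace ℝ (Fin (n + 3))),
      ContDiff ℝ ∞ X → (∀ p ∈ M, X p ∈ tang M p) → (∃ p ∈ M, X p ≠ 0) →
      (∀ p ∈ M, IsUnitNormalAt M N p (ν p)) →
      (∀ p ∈ M, Orthonormal ℝ (e p) ∧ ∀ k, e p k ∈ tang M p) →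
      IntegrableOn (fun p => acsCurv N p (e p) (X p) (ν p)) M μHE[n] ∧
      IntegrableOn (fun p => acsSff N p (e p) (X p) (ν p)) M μHE[n] ∧
      ∫ p in M, acsSff N p (e p) (X p) (ν p) ∂μHE[n] <
        ∫ p in M, acsCurv N p (e p) (X p) (ν p) ∂μHE[n]

end Submfd

end

open Submfd

/-! Around a point of $N$ the isoparametric function is replaced by its arclength reparametrisation
$r$, a function with unit gradient on the sphere, and by the homogeneous functions $u=|y|\sin r$ and
$w=|y|\cos r$. Their gradients $q$ and $p$ are orthonormal and $y=wp+uq$: $p(y)$ is the foot point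
on $N$ and $q(y)$ the unit normal there. Everything about $N$ is encoded in the symmetric operator
$S=dq$. On $N$ the shape operator is $A=-S$, and off $N$ the operator $A=-wS(1-uS)^{-1}$ is the
shape operator at the foot point.

Constant principal curvatures: $\operatorname{tr}S=\Delta u$ is constant along the parallel
hypersurfaces. The Riccati equation $D_qS=-S^2$ passes this from $\operatorname{tr}S^m$ to
$\operatorname{tr}S^{m+1}$, so all $\operatorname{tr}A^m$ are locally constant
(`fderiv_trace_pow_eq_zero`, `fderiv_trace_shape_pow`).

Symmetry of the focal spectra (Münzner): write $\kappa_j=\cot\theta_j$. The focal map $\kappa_ip+q$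
is the gradient of $\kappa_iw+u$, and its derivative has constant rank. Hence it is constant on
straight segments tangent to the kernel, along which the pseudo-inverse of its derivative is affine.
Along a segment $y+tv$ with $v$ a principal direction for $\kappa_i$, the operator with eigenvalues
$\cot(\theta_j-\theta_i)$ times $k(t)$ is therefore affine in $t$, where $k(t)^2=1+\mu t^2$ with
$\mu>0$. The trace of its $l$-th power is a polynomial in $t$ and equals
$k(t)^l\sum_jm_j\cot^l(\theta_j-\theta_i)$. For odd $l$ the sum must vanish, because an odd power of
$\sqrt{1+\mu t^2}$ is not a polynomial (`trace_fcalc_cotSub_pow`).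

For $g=4$ these identities force $\theta_j$ to be spaced by $\pi/4$ with alternating multiplicities.
Minimality then determines the curvatures: if the smaller multiplicity is $4$, the extreme one
satisfies $(x^2-1)^2=(s-4)x^2$, so $x^2=a^2$. Up to orientation the spectrum lies in
$[-\beta,\alpha]$ with $\alpha=|a|$ and $\beta=(\alpha+1)/(\alpha-1)$, and $s\ge15$ gives
$2\beta\le\alpha$.

By the Gauss equation $\Delta$ is a quadratic expression in $A$ (`deltaForm`). The inequality
$(\alpha-A)(A+\beta)\ge0$ removes $|AX|^2$ and $|A\nu|^2$, and an elementary inequality in two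
Rayleigh quotients remains, with equality when $X$ and $\nu$ are eigenvectors for $\alpha$. The
integral condition follows from the pointwise bound, since the integrands are continuous and open
pieces of $M$ have positive measure. -/

open Filter Topology
set_option linter.unusedSectionVars false
set_option linter.unnecessarySimpa false
set_option linter.unusedSimpArgs false

/-! ### Tangent spaces of level sets -/

section TangentSpace

variable {E F G : Type*} [NormedAddCommGroup E] [InnerProductSpace ℝ E] [FiniteDimensional ℝ E]
  [NormedAddCommGroup F] [NormedSpace ℝ F] [FiniteDimensional ℝ F]
  [NormedAddCommGroup G] [NormedSpace ℝ G]

/-- Near a point where `S` is the zero set of a submersion, `S` is parametrised by its tangent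
space, and the orthogonal projection to the tangent space inverts the parametrisation. -/
theorem exists_local_param {S : Set E} {p : E} {h : E → F} {L : E →L[ℝ] F} (hp : p ∈ S)
    (hh : HasStrictFDerivAt h L p) (hL : Function.Surjective L)
    (hS : ∀ᶠ x in 𝓝 p, x ∈ S ↔ h x = 0) :
    ∃ ψ : L.ker → E, ψ 0 = p ∧ HasStrictFDerivAt ψ L.ker.subtypeL 0 ∧
      (∀ᶠ v in 𝓝 0, ψ v ∈ S) ∧
      (∀ᶠ v in 𝓝 0, L.ker.orthogonalProjectionOnto (ψ v - p) = v) ∧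
      (∀ᶠ x in 𝓝 p, x ∈ S → ψ (L.ker.orthogonalProjectionOnto (x - p)) = x) := by
  have hp0 : h p = 0 := (hS.self_of_nhds).1 hp
  let φ : ImplicitFunctionData ℝ E F L.ker :=
    { leftFun := h
      leftDeriv := L
      rightFun := fun x => L.ker.orthogonalProjectionOnto (x - p)
      rightDeriv := L.ker.orthogonalProjectionOnto
      pt := p
      hasStrictFDerivAt_leftFun := hh
      hasStrictFDerivAt_rightFun :=
        L.ker.orthogonalProjectionOnto.hasStrictFDerivAt.comp p
          ((hasStrictFDerivAt_id p).sub_const p)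
      range_leftDeriv := LinearMap.range_eq_top.2 hL
      range_rightDeriv := LinearMap.range_eq_top.2 fun v => ⟨v, by simp⟩
      isCompl_ker := by
        have := L.ker.isCompl_orthogonal
        convert this using 1
        ext x
        simp }
  have hr0 : φ.rightFun p = 0 := by simp [φ]
  have hl0 : φ.leftFun φ.pt = 0 := hp0
  have hr0' : φ.rightFun φ.pt = 0 := hr0
  have hstrict : HasStrictFDerivAt (φ.implicitFunction 0) L.ker.subtypeL 0 := by
    have := φ.hasStrictFDerivAt_implicitFunction L.ker.subtypeL
      (by ext v; simp [φ]) (by ext v; simpa [φ] using v.2)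
    rwa [hl0, hr0'] at this
  have hψ0 : φ.implicitFunction 0 0 = p := by
    have := φ.implicitFunction_apply_image.self_of_nhds
    rwa [hl0, hr0'] at this
  have hcont : Tendsto (φ.implicitFunction 0) (𝓝 0) (𝓝 p) := by
    have := hstrict.hasFDerivAt.continuousAt.tendsto
    rwa [hψ0] at this
  have hpair : Tendsto (fun v : L.ker => ((0 : F), v)) (𝓝 0) (𝓝 (φ.prodFun φ.pt)) := by
    have : φ.prodFun φ.pt = ((0 : F), (0 : L.ker)) := by
      simp [ImplicitFunctionData.prodFun, hl0, hr0']
    rw [this]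
    exact (continuous_const.prodMk continuous_id).tendsto 0
  refine ⟨φ.implicitFunction 0, hψ0, hstrict, ?_, ?_, ?_⟩
  · filter_upwards [hcont.eventually hS, hpair.eventually φ.leftFun_implicitFunction] with v h1 h2
    exact h1.2 h2
  · exact hpair.eventually φ.rightFun_implicitFunction
  · filter_upwards [φ.implicitFunction_apply_image, hS] with x hx hx' hxS
    have : φ.leftFun x = 0 := hx'.1 hxS
    rwa [this] at hx

/-- Within $S$ the map $h$ has both $L$ and $0$ as derivative, and these must agree on the tangent
cone. Conversely a kernel vector $v$ is the velocity of the curve $t\mapsto\psi(tv)$ in $S$. -/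
theorem tangentConeAt_eq_ker {S : Set E} {p : E} {h : E → F} {L : E →L[ℝ] F} (hp : p ∈ S)
    (hh : HasStrictFDerivAt h L p) (hL : Function.Surjective L)
    (hS : ∀ᶠ x in 𝓝 p, x ∈ S ↔ h x = 0) : tangentConeAt ℝ S p = L.ker := by
  apply Set.Subset.antisymm
  · intro v hv
    have h1 : HasFDerivWithinAt h L S p := hh.hasFDerivAt.hasFDerivWithinAt
    have h2 : HasFDerivWithinAt h (0 : E →L[ℝ] F) S p := by
      refine (hasFDerivWithinAt_const (0 : F) p S).congr_of_eventuallyEq ?_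
        ((hS.self_of_nhds).1 hp)
      filter_upwards [nhdsWithin_le_nhds hS, self_mem_nhdsWithin] with x hx hxS
      exact hx.1 hxS
    simpa using h1.unique_on h2 hv
  · intro v hv
    obtain ⟨ψ, hψ0, hψ, hψS, -, -⟩ := exists_local_param hp hh hL hS
    have hc : HasDerivAt (fun t : ℝ => ψ (t • (⟨v, hv⟩ : L.ker))) v 0 := by
      have h1 : HasDerivAt (fun t : ℝ => t • (⟨v, hv⟩ : L.ker)) ⟨v, hv⟩ 0 := by
        simpa using (hasDerivAt_id (0 : ℝ)).smul_const (⟨v, hv⟩ : L.ker)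
      have h2 : HasFDerivAt ψ L.ker.subtypeL ((0 : ℝ) • (⟨v, hv⟩ : L.ker)) := by
        rw [zero_smul]; exact hψ.hasFDerivAt
      exact h2.comp_hasDerivAt (0 : ℝ) h1
    have ht : Tendsto (fun t : ℝ => t • (⟨v, hv⟩ : L.ker)) (𝓝[≠] 0) (𝓝 0) := by
      have : Continuous fun t : ℝ => t • (⟨v, hv⟩ : L.ker) := by fun_prop
      have := this.tendsto 0
      rw [zero_smul] at this
      exact this.mono_left nhdsWithin_le_nhds
    have hslope := hasDerivAt_iff_tendsto_slope.1 hc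
    refine mem_tangentConeAt_of_frequently (𝓝[≠] (0 : ℝ)) (fun t => t⁻¹)
      (fun t => ψ (t • (⟨v, hv⟩ : L.ker)) - p) ?_ ?_ ?_
    · have h3 : Tendsto (fun t : ℝ => ψ (t • (⟨v, hv⟩ : L.ker))) (𝓝[≠] 0) (𝓝 p) := by
        have := hψ.hasFDerivAt.continuousAt.tendsto
        rw [hψ0] at this
        exact this.comp ht
      simpa using h3.sub_const p
    · apply Eventually.frequently
      filter_upwards [ht.eventually hψS] with t h
      simpa using h
    · refine hslope.congr fun t => ?_
      simp [slope, hψ0]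

theorem tang_eq_ker {S : Set E} {p : E} {h : E → F} {L : E →L[ℝ] F} (hp : p ∈ S)
    (hh : HasStrictFDerivAt h L p) (hL : Function.Surjective L)
    (hS : ∀ᶠ x in 𝓝 p, x ∈ S ↔ h x = 0) : tang S p = L.ker := by
  rw [tang, tangentConeAt_eq_ker hp hh hL hS, Submodule.span_eq]

/-- The derivative within `S` along tangent vectors is computed by any differentiable extension. -/
theorem fderivWithin_apply_of_mem_tang {S : Set E} {p u : E} {V V' : E → G} {L : E →L[ℝ] G}
    (hp : p ∈ S) (hV : HasFDerivAt V' L p) (h : ∀ᶠ x in 𝓝 p, x ∈ S → V x = V' x)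
    (hu : u ∈ tang S p) : fderivWithin ℝ V S p u = L u := by
  have h1 : HasFDerivWithinAt V L S p := by
    refine hV.hasFDerivWithinAt.congr_of_eventuallyEq ?_ (h.self_of_nhds hp)
    filter_upwards [nhdsWithin_le_nhds h, self_mem_nhdsWithin] with x hx hxS using hx hxS
  have h2 := h1.differentiableWithinAt.hasFDerivWithinAt
  have h3 := h2.unique_on h1
  refine Submodule.span_induction (p := fun x _ => fderivWithin ℝ V S p x = L x)
    (fun x hx => h3 hx) (by simp) (fun x y _ _ hx hy => by simp [hx, hy])
    (fun c x _ hx => by simp [hx]) hu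

theorem tang_mono {S T : Set E} (h : S ⊆ T) (p : E) : tang S p ≤ tang T p :=
  Submodule.span_mono (tangentConeAt_mono h)

end TangentSpace

/-! ### Eikonal pairs and first-order identities -/

theorem ContDiffAt.innerSL_comp {E G : Type*} [NormedAddCommGroup E] [InnerProductSpace ℝ E]
    [NormedAddCommGroup G] [NormedSpace ℝ G] {f : G → E} {y : G} {n : ℕ∞ω}
    (hf : ContDiffAt ℝ n f y) : ContDiffAt ℝ n (fun z => innerSL ℝ (f z)) y :=
  ContDiffAt.comp y (innerSL ℝ : E →L[ℝ] E →L[ℝ] ℝ).contDiff.contDiffAt hf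

/-- Two functions `u`, `w` with orthonormal gradients `q`, `p` on an open set `Ω`, homogeneous of
degree one in the sense of Euler's relation, such that `N` is given in `Ω` by `u = 0` in the unit
sphere. The trace of the Hessian of `u` has to be constant in the directions orthogonal to `p`
and `q`. Then the shape operators of `N` and of its parallel hypersurfaces are encoded in the
derivative of `q`. -/
structure EikonalPair {E : Type*} [NormedAddCommGroup E] [InnerProductSpace ℝ E]
    (N Ω : Set E) (u w : E → ℝ) (p q : E → E) : Prop where
  isOpen : IsOpen Ω
  contDiffOn_p : ContDiffOn ℝ ∞ p Ω
  contDiffOn_q : ContDiffOn ℝ ∞ q Ω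
  hasFDerivAt_u : ∀ y ∈ Ω, HasFDerivAt u (innerSL ℝ (q y)) y
  hasFDerivAt_w : ∀ y ∈ Ω, HasFDerivAt w (innerSL ℝ (p y)) y
  inner_pp : ∀ y ∈ Ω, ⟪p y, p y⟫ = 1
  inner_qq : ∀ y ∈ Ω, ⟪q y, q y⟫ = 1
  inner_pq : ∀ y ∈ Ω, ⟪p y, q y⟫ = 0
  decomp : ∀ y ∈ Ω, y = w y • p y + u y • q y
  w_pos : ∀ y ∈ Ω, 0 < w y
  mem_iff : ∀ y ∈ Ω, y ∈ N ↔ ‖y‖ = 1 ∧ u y = 0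
  trace_const : ∀ y ∈ Ω, ∀ v, ⟪p y, v⟫ = 0 → ⟪q y, v⟫ = 0 →
    fderiv ℝ (fun z => LinearMap.trace ℝ E (fderiv ℝ q z : E →ₗ[ℝ] E)) y v = 0

namespace EikonalPair

variable {E : Type*} [NormedAddCommGroup E] [InnerProductSpace ℝ E] [FiniteDimensional ℝ E]
  {N Ω : Set E} {u w : E → ℝ} {p q : E → E}

theorem mono (h : EikonalPair N Ω u w p q) {Ω' : Set E} (hΩ' : IsOpen Ω') (hsub : Ω' ⊆ Ω) :
    EikonalPair N Ω' u w p q where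
  isOpen := hΩ'
  contDiffOn_p := h.contDiffOn_p.mono hsub
  contDiffOn_q := h.contDiffOn_q.mono hsub
  hasFDerivAt_u y hy := h.hasFDerivAt_u y (hsub hy)
  hasFDerivAt_w y hy := h.hasFDerivAt_w y (hsub hy)
  inner_pp y hy := h.inner_pp y (hsub hy)
  inner_qq y hy := h.inner_qq y (hsub hy)
  inner_pq y hy := h.inner_pq y (hsub hy)
  decomp y hy := h.decomp y (hsub hy)
  w_pos y hy := h.w_pos y (hsub hy)
  mem_iff y hy := h.mem_iff y (hsub hy)
  trace_const y hy := h.trace_const y (hsub hy)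

section Basic

variable (h : EikonalPair N Ω u w p q) {y : E} (hy : y ∈ Ω)
include h hy

theorem norm_p : ‖p y‖ = 1 := by
  have h1 := h.inner_pp y hy
  rw [real_inner_self_eq_norm_sq] at h1
  nlinarith [norm_nonneg (p y)]

theorem norm_q : ‖q y‖ = 1 := by
  have h1 := h.inner_qq y hy
  rw [real_inner_self_eq_norm_sq] at h1
  nlinarith [norm_nonneg (q y)]

theorem contDiffAt_p : ContDiffAt ℝ ∞ p y := h.contDiffOn_p.contDiffAt (h.isOpen.mem_nhds hy)
theorem contDiffAt_q : ContDiffAt ℝ ∞ q y := h.contDiffOn_q.contDiffAt (h.isOpen.mem_nhds hy)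

theorem hasFDerivAt_p : HasFDerivAt p (fderiv ℝ p y) y :=
  ((h.contDiffAt_p hy).differentiableAt (by simp)).hasFDerivAt

theorem hasFDerivAt_q : HasFDerivAt q (fderiv ℝ q y) y :=
  ((h.contDiffAt_q hy).differentiableAt (by simp)).hasFDerivAt

theorem contDiffAt_fderiv_q : ContDiffAt ℝ ∞ (fderiv ℝ q) y :=
  (h.contDiffAt_q hy).fderiv_right (m := ∞) (by simp)

theorem hasFDerivAt_fderiv_q : HasFDerivAt (fderiv ℝ q) (fderiv ℝ (fderiv ℝ q) y) y :=
  ((h.contDiffAt_fderiv_q hy).differentiableAt (by simp)).hasFDerivAt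

theorem eventually_mem : ∀ᶠ z in 𝓝 y, z ∈ Ω := h.isOpen.mem_nhds hy

theorem symm_q (a b : E) : ⟪fderiv ℝ q y a, b⟫ = ⟪a, fderiv ℝ q y b⟫ := by
  have := second_derivative_symmetric_of_eventually (𝕜 := ℝ) (f := u)
    (f' := fun z => innerSL ℝ (q z)) (x := y)
    ((h.eventually_mem hy).mono fun z hz => h.hasFDerivAt_u z hz)
    ((innerSL ℝ (E := E)).hasFDerivAt.comp y (h.hasFDerivAt_q hy)) a b
  change ⟪fderiv ℝ q y a, b⟫ = ⟪fderiv ℝ q y b, a⟫ at this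
  rw [this, real_inner_comm]

theorem symm_p (a b : E) : ⟪fderiv ℝ p y a, b⟫ = ⟪a, fderiv ℝ p y b⟫ := by
  have := second_derivative_symmetric_of_eventually (𝕜 := ℝ) (f := w)
    (f' := fun z => innerSL ℝ (p z)) (x := y)
    ((h.eventually_mem hy).mono fun z hz => h.hasFDerivAt_w z hz)
    ((innerSL ℝ (E := E)).hasFDerivAt.comp y (h.hasFDerivAt_p hy)) a b
  change ⟪fderiv ℝ p y a, b⟫ = ⟪fderiv ℝ p y b, a⟫ at this
  rw [this, real_inner_comm]

theorem inner_q_fderiv_q (a : E) : ⟪q y, fderiv ℝ q y a⟫ = 0 := by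
  have h1 := (h.hasFDerivAt_q hy).inner ℝ (h.hasFDerivAt_q hy)
  have h2 : HasFDerivAt (fun z => ⟪q z, q z⟫) (0 : E →L[ℝ] ℝ) y :=
    (hasFDerivAt_const (1 : ℝ) y).congr_of_eventuallyEq
      ((h.eventually_mem hy).mono fun z hz => h.inner_qq z hz)
  have := congrArg (fun L : E →L[ℝ] ℝ => L a) (h1.unique h2)
  simp [fderivInnerCLM_apply, real_inner_comm] at this
  linarith [real_inner_comm (q y) (fderiv ℝ q y a)]

theorem inner_pq_fderiv (a : E) : ⟪p y, fderiv ℝ q y a⟫ + ⟪fderiv ℝ p y a, q y⟫ = 0 := by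
  have h1 := (h.hasFDerivAt_p hy).inner ℝ (h.hasFDerivAt_q hy)
  have h2 : HasFDerivAt (fun z => ⟪p z, q z⟫) (0 : E →L[ℝ] ℝ) y :=
    (hasFDerivAt_const (0 : ℝ) y).congr_of_eventuallyEq
      ((h.eventually_mem hy).mono fun z hz => h.inner_pq z hz)
  simpa [fderivInnerCLM_apply] using congrArg (fun L : E →L[ℝ] ℝ => L a) (h1.unique h2)

/-- The integral curves of a unit gradient field are straight: the derivative of `q` is a Hessian,
hence symmetric, and its image is orthogonal to `q`. -/
theorem fderiv_q_q : fderiv ℝ q y (q y) = 0 :=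
  ext_inner_right ℝ (E := E) fun a => by
    rw [h.symm_q hy, h.inner_q_fderiv_q hy, inner_zero_left]

theorem decomp_fderiv (a : E) : a = w y • fderiv ℝ p y a + ⟪p y, a⟫ • p y +
    (u y • fderiv ℝ q y a + ⟪q y, a⟫ • q y) := by
  have h1 := ((h.hasFDerivAt_w y hy).smul (h.hasFDerivAt_p hy)).add
    ((h.hasFDerivAt_u y hy).smul (h.hasFDerivAt_q hy))
  have h2 := (hasFDerivAt_id (𝕜 := ℝ) y).congr_of_eventuallyEq (f₁ := fun z => w z • p z + u z • q z)
    ((h.eventually_mem hy).mono fun z hz => (h.decomp z hz).symm)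
  simpa using congrArg (fun L : E →L[ℝ] E => L a) (h2.unique h1)

/-- Differentiating $y=wp+uq$ in the direction $q$ leaves $w\,dp(q)=0$. Together with `fderiv_q_q`
and `fderiv_q_p`, moving inside the plane of $p$ and $q$ does not change the normal, and moving
along $q$ does not change the foot point. -/
theorem fderiv_p_q : fderiv ℝ p y (q y) = 0 := by
  have := h.decomp_fderiv hy (q y)
  rw [h.fderiv_q_q hy, h.inner_pq y hy, h.inner_qq y hy] at this
  simp at this
  exact this.resolve_left (h.w_pos y hy).ne'

theorem fderiv_q_p : fderiv ℝ q y (p y) = 0 := by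
  refine ext_inner_right ℝ fun a => ?_
  have h1 := h.inner_pq_fderiv hy a
  rw [h.symm_p hy, h.fderiv_p_q hy, inner_zero_right, add_zero] at h1
  rw [h.symm_q hy, h1, inner_zero_left]

theorem inner_p_fderiv_q (a : E) : ⟪p y, fderiv ℝ q y a⟫ = 0 := by
  rw [← h.symm_q hy, h.fderiv_q_p hy, inner_zero_left]

theorem norm_sq_eq : ‖y‖ ^ 2 = w y ^ 2 + u y ^ 2 := by
  have h1 : ⟪y, y⟫ = ⟪w y • p y + u y • q y, w y • p y + u y • q y⟫ := by rw [← h.decomp y hy]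
  rw [← real_inner_self_eq_norm_sq, h1]
  simp only [inner_add_left, inner_add_right, real_inner_smul_left, real_inner_smul_right,
    h.inner_pp y hy, h.inner_qq y hy, h.inner_pq y hy, real_inner_comm (p y) (q y)]
  ring

end Basic

/-- The orthogonal projection to the complement of `p` and `q`. -/
noncomputable def tproj (p q : E → E) (y : E) : E →L[ℝ] E :=
  ContinuousLinearMap.id ℝ E - (innerSL ℝ (p y)).smulRight (p y)
    - (innerSL ℝ (q y)).smulRight (q y)

theorem tproj_apply (y a : E) : tproj p q y a = a - ⟪p y, a⟫ • p y - ⟪q y, a⟫ • q y := by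
  simp [tproj]

section Tproj

variable (h : EikonalPair N Ω u w p q) {y : E} (hy : y ∈ Ω)
include h hy

theorem inner_p_tproj (a : E) : ⟪p y, tproj p q y a⟫ = 0 := by
  simp [tproj_apply, h.norm_p hy, h.norm_q hy, inner_sub_right, real_inner_smul_right, h.inner_pp y hy, h.inner_pq y hy]

theorem inner_q_tproj (a : E) : ⟪q y, tproj p q y a⟫ = 0 := by
  simp [tproj_apply, h.norm_p hy, h.norm_q hy, inner_sub_right, real_inner_smul_right, h.inner_qq y hy,
    real_inner_comm (p y) (q y), h.inner_pq y hy]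

theorem tproj_p : tproj p q y (p y) = 0 := by
  simp [tproj_apply, h.norm_p hy, h.norm_q hy, h.inner_pp y hy, h.inner_pq y hy, real_inner_comm (p y) (q y)]

theorem tproj_q : tproj p q y (q y) = 0 := by
  simp [tproj_apply, h.norm_p hy, h.norm_q hy, h.inner_qq y hy, h.inner_pq y hy]

theorem w_smul_fderiv_p (a : E) :
    w y • fderiv ℝ p y a = tproj p q y a - u y • fderiv ℝ q y a := by
  have := h.decomp_fderiv hy a
  rw [tproj_apply]
  nth_rewrite 2 [this]
  abel

theorem contDiffAt_tproj : ContDiffAt ℝ ∞ (tproj p q) y := by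
  have hp := h.contDiffAt_p hy
  have hq := h.contDiffAt_q hy
  have hp' := hp.innerSL_comp
  have hq' := hq.innerSL_comp
  exact (contDiffAt_const.sub (hp'.smulRight hp)).sub (hq'.smulRight hq)

theorem hasFDerivAt_tproj : HasFDerivAt (tproj p q) (fderiv ℝ (tproj p q) y) y :=
  ((h.contDiffAt_tproj hy).differentiableAt (by simp)).hasFDerivAt

theorem fderiv_tproj_apply (a b : E) : fderiv ℝ (tproj p q) y a b =
    - (⟪fderiv ℝ p y a, b⟫ • p y + ⟪p y, b⟫ • fderiv ℝ p y a)
    - (⟪fderiv ℝ q y a, b⟫ • q y + ⟪q y, b⟫ • fderiv ℝ q y a) := by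
  have h1 : HasFDerivAt (fun z => tproj p q z b) ((ContinuousLinearMap.apply ℝ E b).comp
      (fderiv ℝ (tproj p q) y)) y :=
    (ContinuousLinearMap.apply ℝ E b).hasFDerivAt.comp y (h.hasFDerivAt_tproj hy)
  have hp := h.hasFDerivAt_p hy
  have hq := h.hasFDerivAt_q hy
  have h2 := ((hasFDerivAt_const b y).sub ((hp.inner ℝ (hasFDerivAt_const b y)).smul hp)).sub
    ((hq.inner ℝ (hasFDerivAt_const b y)).smul hq)
  have h3 : (fun z => tproj p q z b) = fun z => b - ⟪p z, b⟫ • p z - ⟪q z, b⟫ • q z := by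
    funext z; rw [tproj_apply]
  rw [h3] at h1
  have := congrArg (fun L : E →L[ℝ] E => L a) (h1.unique h2)
  simp [fderivInnerCLM_apply] at this
  rw [this]
  abel

end Tproj

section Hypersurface

variable (h : EikonalPair N Ω u w p q) {y : E} (hy : y ∈ Ω) (hyN : y ∈ N)
include h hy hyN

theorem u_eq_zero : u y = 0 := ((h.mem_iff y hy).1 hyN).2

theorem w_eq_one : w y = 1 := by
  have h1 := h.norm_sq_eq hy
  rw [((h.mem_iff y hy).1 hyN).1, h.u_eq_zero hy hyN] at h1
  have := h.w_pos y hy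
  nlinarith

theorem p_eq_self : p y = y := by
  have := h.decomp y hy
  rw [h.w_eq_one hy hyN, h.u_eq_zero hy hyN] at this
  simpa using this.symm

theorem fderiv_p_eq_tproj (a : E) : fderiv ℝ p y a = tproj p q y a := by
  have := h.w_smul_fderiv_p hy a
  simpa [h.w_eq_one hy hyN, h.u_eq_zero hy hyN] using this

/-- Near $y$ the hypersurface is the zero set of $(|z|^2-1,u)$, with gradients $2y$ and $q$, and
$y=p(y)$ on $N$. -/
theorem mem_tang_iff (a : E) : a ∈ tang N y ↔ ⟪p y, a⟫ = 0 ∧ ⟪q y, a⟫ = 0 := by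
  have hd : HasStrictFDerivAt (fun z => (‖z‖ ^ 2 - 1, u z))
      (((2 : ℕ) • innerSL ℝ y).prod (innerSL ℝ (q y))) y := by
    refine HasStrictFDerivAt.prodMk ?_ ?_
    · exact (hasStrictFDerivAt_norm_sq y).sub_const 1
    · have hu : ContDiffAt ℝ 1 u y := by
        refine (contDiffAt_succ_iff_hasFDerivAt (n := 0)).2
          ⟨fun z => innerSL ℝ (q z), ⟨Ω, h.isOpen.mem_nhds hy, h.hasFDerivAt_u⟩, ?_⟩
        exact ((h.contDiffAt_q hy).of_le (by simp)).innerSL_comp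
      have := hu.hasStrictFDerivAt (by simp)
      rwa [(h.hasFDerivAt_u y hy).fderiv] at this
  have hyy := h.p_eq_self hy hyN
  have hsurj : Function.Surjective (((2 : ℕ) • innerSL ℝ y).prod (innerSL ℝ (q y))) := by
    rintro ⟨s, t⟩
    refine ⟨(s / 2) • p y + t • q y, ?_⟩
    have e1 := h.inner_pp y hy
    have e2 := h.inner_qq y hy
    have e3 := h.inner_pq y hy
    have e4 := h.inner_pq y hy
    rw [real_inner_comm] at e4
    rw [ContinuousLinearMap.prod_apply]
    nth_rewrite 1 [← hyy]
    simp [inner_add_right, real_inner_smul_right, e3, e4, h.norm_p hy, h.norm_q hy]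
    ring
  rw [tang_eq_ker hyN hd hsurj]
  · have : p y = y := hyy
    simp [this]
  · filter_upwards [h.eventually_mem hy] with z hz
    rw [h.mem_iff z hz]
    simp only [Prod.mk_eq_zero, sub_eq_zero]
    refine and_congr_left fun _ => ?_
    constructor
    · intro hh; rw [hh]; norm_num
    · intro hh
      have := norm_nonneg z
      nlinarith

theorem proj_eq_tproj : proj N y = tproj p q y := by
  ext a
  rw [proj]
  refine Submodule.eq_starProjection_of_mem_of_inner_eq_zero (K := tang N y) ?_ ?_
  · rw [h.mem_tang_iff hy hyN]
    exact ⟨h.inner_p_tproj hy a, h.inner_q_tproj hy a⟩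
  · intro b hb
    rw [h.mem_tang_iff hy hyN] at hb
    simp [tproj_apply, inner_add_left, inner_sub_left, real_inner_smul_left, hb.1, hb.2]

theorem tproj_of_mem_tang {a : E} (ha : a ∈ tang N y) : tproj p q y a = a := by
  rw [h.mem_tang_iff hy hyN] at ha
  simp [tproj_apply, ha.1, ha.2]

end Hypersurface

end EikonalPair

/-! ### Second fundamental form and Gauss equation -/

namespace EikonalPair

variable {E : Type*} [NormedAddCommGroup E] [InnerProductSpace ℝ E] [FiniteDimensional ℝ E]
  {N Ω : Set E} {u w : E → ℝ} {p q : E → E}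
  (h : EikonalPair N Ω u w p q) {x : E} (hx : x ∈ Ω) (hxN : x ∈ N)
include h hx

theorem eventually_ext_eq (v : E) : ∀ᶠ z in 𝓝 x, z ∈ N → ext N v z = tproj p q z v := by
  filter_upwards [h.eventually_mem hx] with z hz hzN
  rw [ext, h.proj_eq_tproj hz hzN]

theorem hasFDerivAt_tproj_apply (v : E) : HasFDerivAt (fun z => tproj p q z v)
    ((fderiv ℝ (tproj p q) x).flip v) x := by
  have := (ContinuousLinearMap.apply ℝ E v).hasFDerivAt.comp x (h.hasFDerivAt_tproj hx)
  exact this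

/-- This is what makes the bracket of the two projected fields `ext N a` and `ext N b` vanish at the
point, so the third term of the curvature drops out. -/
theorem fderiv_tproj_symm (a b : E) (ha : a = tproj p q x a) (hb : b = tproj p q x b) :
    fderiv ℝ (tproj p q) x a b = fderiv ℝ (tproj p q) x b a := by
  have a1 : ⟪p x, a⟫ = 0 := by rw [ha, h.inner_p_tproj hx]
  have a2 : ⟪q x, a⟫ = 0 := by rw [ha, h.inner_q_tproj hx]
  have b1 : ⟪p x, b⟫ = 0 := by rw [hb, h.inner_p_tproj hx]
  have b2 : ⟪q x, b⟫ = 0 := by rw [hb, h.inner_q_tproj hx]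
  rw [h.fderiv_tproj_apply hx, h.fderiv_tproj_apply hx, a1, a2, b1, b2, h.symm_p hx a b,
    h.symm_q hx a b, real_inner_comm a, real_inner_comm a]
  simp

include hxN

theorem fderivWithin_ext {a : E} (ha : a ∈ tang N x) (v : E) :
    fderivWithin ℝ (ext N v) N x a = fderiv ℝ (tproj p q) x a v :=
  fderivWithin_apply_of_mem_tang hxN (h.hasFDerivAt_tproj_apply hx v)
    (h.eventually_ext_eq hx v) ha

theorem fderiv_tproj_of_mem_tang {a b : E} (ha : a ∈ tang N x) (hb : b ∈ tang N x) :
    fderiv ℝ (tproj p q) x a b = -(⟪a, b⟫ • p x) - ⟪fderiv ℝ q x a, b⟫ • q x := by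
  rw [h.mem_tang_iff hx hxN] at hb
  rw [h.fderiv_tproj_apply hx, hb.1, hb.2, h.fderiv_p_eq_tproj hx hxN,
    h.tproj_of_mem_tang hx hxN ha]
  simp

theorem sff_eq {a b : E} (ha : a ∈ tang N x) (hb : b ∈ tang N x) :
    sff N x a b = -(⟪a, b⟫ • p x) - ⟪fderiv ℝ q x a, b⟫ • q x := by
  rw [sff, h.proj_eq_tproj hx hxN, h.fderivWithin_ext hx hxN ha,
    h.fderiv_tproj_of_mem_tang hx hxN ha hb]
  simp [h.tproj_p hx, h.tproj_q hx]

theorem norm_sff_sq {a b : E} (ha : a ∈ tang N x) (hb : b ∈ tang N x) :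
    ‖sff N x a b‖ ^ 2 = ⟪a, b⟫ ^ 2 + ⟪fderiv ℝ q x a, b⟫ ^ 2 := by
  rw [h.sff_eq hx hxN ha hb, ← real_inner_self_eq_norm_sq]
  simp only [inner_sub_left, inner_sub_right, inner_neg_left, inner_neg_right,
    real_inner_smul_left, real_inner_smul_right, real_inner_comm (p x) (q x), h.inner_pp x hx, h.inner_qq x hx, h.inner_pq x hx]
  ring

theorem fderiv_q_mem_tang (a : E) : fderiv ℝ q x a ∈ tang N x := by
  rw [h.mem_tang_iff hx hxN]
  exact ⟨h.inner_p_fderiv_q hx a, h.inner_q_fderiv_q hx a⟩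

theorem inner_sff_q {a b : E} (ha : a ∈ tang N x) (hb : b ∈ tang N x) :
    ⟪sff N x a b, q x⟫ = -⟪fderiv ℝ q x a, b⟫ := by
  rw [h.sff_eq hx hxN ha hb]
  simp [inner_sub_left, real_inner_smul_left, h.inner_pq x hx, h.norm_q hx]

omit hxN in
theorem cov_ext_eq (v z : E) : ∀ᶠ y in 𝓝 x, y ∈ N →
    cov N (ext N v) (ext N z) y =
      tproj p q y (fderiv ℝ (tproj p q) y (tproj p q y v) z) := by
  filter_upwards [h.eventually_mem hx] with y hy hyN
  rw [cov, h.proj_eq_tproj hy hyN, h.fderivWithin_ext hy hyN]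
  · rw [ext, h.proj_eq_tproj hy hyN]
  · rw [ext, h.proj_eq_tproj hy hyN, h.mem_tang_iff hy hyN]
    exact ⟨h.inner_p_tproj hy v, h.inner_q_tproj hy v⟩

omit hxN in
theorem hasFDerivAt_cov (v z : E) : HasFDerivAt
    (fun y => tproj p q y (fderiv ℝ (tproj p q) y (tproj p q y v) z))
    ((tproj p q x).comp (((fderiv ℝ (tproj p q) x).comp ((fderiv ℝ (tproj p q) x).flip v) +
      (fderiv ℝ (fderiv ℝ (tproj p q)) x).flip (tproj p q x v)).flip z) +
      (fderiv ℝ (tproj p q) x).flip (fderiv ℝ (tproj p q) x (tproj p q x v) z)) x := by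
  have h1 := h.hasFDerivAt_tproj hx
  have h2 : HasFDerivAt (fderiv ℝ (tproj p q)) (fderiv ℝ (fderiv ℝ (tproj p q)) x) x :=
    (((h.contDiffAt_tproj hx).fderiv_right (m := ∞) (by simp)).differentiableAt
      (by simp)).hasFDerivAt
  have h3 := h2.clm_apply (h.hasFDerivAt_tproj_apply hx v)
  have h4 : HasFDerivAt (fun y => fderiv ℝ (tproj p q) y (tproj p q y v) z) _ x :=
    (ContinuousLinearMap.apply ℝ E z).hasFDerivAt.comp x h3
  have h5 := h1.clm_apply h4
  exact h5

theorem cov_cov_eq {a v : E} (ha : a ∈ tang N x) (hv : v ∈ tang N x) (z : E) :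
    cov N (ext N a) (cov N (ext N v) (ext N z)) x =
      tproj p q x (fderiv ℝ (tproj p q) x a (fderiv ℝ (tproj p q) x v z)
        + tproj p q x (fderiv ℝ (tproj p q) x (fderiv ℝ (tproj p q) x a v) z)
        + tproj p q x (fderiv ℝ (fderiv ℝ (tproj p q)) x a v z)) := by
  have hb : ext N a x = a := by rw [ext, h.proj_eq_tproj hx hxN, h.tproj_of_mem_tang hx hxN ha]
  rw [cov, h.proj_eq_tproj hx hxN, hb,
    fderivWithin_apply_of_mem_tang hxN (h.hasFDerivAt_cov hx v z) (h.cov_ext_eq hx v z) ha]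
  simp only [h.tproj_of_mem_tang hx hxN hv, add_apply,
    ContinuousLinearMap.comp_apply, ContinuousLinearMap.flip_apply, map_add]
  abel

/-- The Gauss equation for $N$ in Euclidean space. In the commutator of covariant derivatives the
second derivatives of the projection cancel by symmetry, the terms containing the derivative of the
inner extension cancel by `fderiv_tproj_symm`, and only the product of two first derivatives of the
projection survives. -/
theorem curv_eq {a v z : E} (ha : a ∈ tang N x) (hv : v ∈ tang N x) (hz : z ∈ tang N x) :
    curv N x a v z = ⟪v, z⟫ • a + ⟪fderiv ℝ q x v, z⟫ • fderiv ℝ q x a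
      - (⟪a, z⟫ • v + ⟪fderiv ℝ q x a, z⟫ • fderiv ℝ q x v) := by
  have e : ∀ {a}, a ∈ tang N x → ext N a x = a := fun {a} ha => by
    rw [ext, h.proj_eq_tproj hx hxN, h.tproj_of_mem_tang hx hxN ha]
  have hsymm := h.fderiv_tproj_symm hx a v (h.tproj_of_mem_tang hx hxN ha).symm
    (h.tproj_of_mem_tang hx hxN hv).symm
  have hlie : VectorField.lieBracketWithin ℝ (ext N a) (ext N v) N x = 0 := by
    rw [VectorField.lieBracketWithin, e ha, e hv, h.fderivWithin_ext hx hxN ha,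
      h.fderivWithin_ext hx hxN hv, hsymm, sub_self]
  have hlast : cov N (VectorField.lieBracketWithin ℝ (ext N a) (ext N v) N) (ext N z) x = 0 := by
    rw [cov, hlie, map_zero, map_zero]
  have h2 : fderiv ℝ (fderiv ℝ (tproj p q)) x a v = fderiv ℝ (fderiv ℝ (tproj p q)) x v a :=
    (h.contDiffAt_tproj hx).isSymmSndFDerivAt (by simpa using (ENat.LEInfty.out : (2 : ℕ∞ω) ≤ ∞)) a v
  have key : ∀ {a v}, a ∈ tang N x → v ∈ tang N x →
      tproj p q x (fderiv ℝ (tproj p q) x a (fderiv ℝ (tproj p q) x v z)) =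
        ⟪v, z⟫ • a + ⟪fderiv ℝ q x v, z⟫ • fderiv ℝ q x a := by
    intro a v ha hv
    rw [h.fderiv_tproj_of_mem_tang hx hxN hv hz, map_sub, map_neg, map_smul, map_smul,
      h.fderiv_tproj_apply hx, h.fderiv_tproj_apply hx, h.fderiv_p_eq_tproj hx hxN,
      h.tproj_of_mem_tang hx hxN ha, h.inner_pp x hx, h.inner_pq x hx, h.inner_qq x hx,
      real_inner_comm (p x) (q x), h.inner_pq x hx]
    simp only [map_sub, map_neg, map_smul, map_add, h.tproj_p hx, h.tproj_q hx,
      h.tproj_of_mem_tang hx hxN ha, h.tproj_of_mem_tang hx hxN (h.fderiv_q_mem_tang hx hxN a)]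
    simp
  simp only [curv]
  rw [h.cov_cov_eq hx hxN ha hv, h.cov_cov_eq hx hxN hv ha, hlast, hsymm, h2]
  simp only [map_add, key ha hv, key hv ha]
  abel

theorem curv4_eq {a v : E} (ha : a ∈ tang N x) (hv : v ∈ tang N x) :
    curv4 N x a v a v = ⟪a, a⟫ * ⟪v, v⟫ + ⟪fderiv ℝ q x a, a⟫ * ⟪fderiv ℝ q x v, v⟫
      - ⟪a, v⟫ ^ 2 - ⟪fderiv ℝ q x a, v⟫ ^ 2 := by
  rw [curv4, h.curv_eq hx hxN ha hv hv]
  simp only [inner_sub_left, inner_add_left, real_inner_smul_left]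
  rw [h.symm_q hx v a, real_inner_comm a v, real_inner_comm (fderiv ℝ q x a) v]
  ring

end EikonalPair

/-! ### Traces of powers of operators -/

section Trace

variable {E : Type*} [NormedAddCommGroup E] [InnerProductSpace ℝ E] [FiniteDimensional ℝ E]

/-- The trace as a continuous linear functional. -/
noncomputable def traceCLM (E : Type*) [NormedAddCommGroup E] [InnerProductSpace ℝ E]
    [FiniteDimensional ℝ E] : (E →L[ℝ] E) →L[ℝ] ℝ :=
  LinearMap.toContinuousLinearMap ((LinearMap.trace ℝ E).comp (ContinuousLinearMap.coeLM ℝ))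

theorem traceCLM_apply (A : E →L[ℝ] E) :
    traceCLM E A = LinearMap.trace ℝ E (A : E →ₗ[ℝ] E) := rfl

theorem traceCLM_mul_comm (A B : E →L[ℝ] E) : traceCLM E (A * B) = traceCLM E (B * A) :=
  LinearMap.trace_mul_comm ℝ (A : E →ₗ[ℝ] E) (B : E →ₗ[ℝ] E)

theorem traceCLM_eq_sum {ι : Type*} [Fintype ι] (b : OrthonormalBasis ι ℝ E) (A : E →L[ℝ] E) :
    traceCLM E A = ∑ i, ⟪b i, A (b i)⟫ :=
  LinearMap.trace_eq_sum_inner (A : E →ₗ[ℝ] E) b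

theorem traceCLM_one : traceCLM E 1 = finrank ℝ E :=
  LinearMap.trace_one ℝ E

theorem traceCLM_smulRight (f : E →L[ℝ] ℝ) (x : E) : traceCLM E (f.smulRight x) = f x :=
  LinearMap.trace_smulRight f.toLinearMap x

/-- The derivative of the trace of a power. -/
theorem HasFDerivAt.trace_mul_pow {G : Type*} [NormedAddCommGroup G] [NormedSpace ℝ G]
    {A : G → E →L[ℝ] E} {A' : G →L[ℝ] E →L[ℝ] E} {y : G} (hA : HasFDerivAt A A' y) (m : ℕ) :
    ∃ D : G →L[ℝ] E →L[ℝ] E, HasFDerivAt (fun z => A z ^ m) D y ∧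
      ∀ (X : E →L[ℝ] E) (a : G), Commute X (A y) →
        traceCLM E (X * D a) = m * traceCLM E (X * A y ^ (m - 1) * A' a) := by
  induction m with
  | zero => exact ⟨0, by simpa using hasFDerivAt_const _ _, by simp⟩
  | succ m ih =>
    obtain ⟨D, hD, hX⟩ := ih
    refine ⟨A y ^ m • A' + MulOpposite.op (A y) • D, by simp only [pow_succ]; exact hD.mul' hA, fun X a hXA => ?_⟩
    have e1 : X * ((A y ^ m • A' + MulOpposite.op (A y) • D) a) = X * A y ^ m * A' a + X * (D a * A y) := by
      simp [mul_add, mul_assoc]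
    have e2 : traceCLM E (X * (D a * A y)) = traceCLM E ((A y * X) * D a) := by
      rw [← mul_assoc, traceCLM_mul_comm, mul_assoc]
    rw [e1, map_add, e2, hX _ _ ((Commute.refl _).mul_left hXA)]
    rcases m with _ | m
    · simp
    · rw [← hXA.eq, Nat.add_sub_cancel, Nat.add_sub_cancel, mul_assoc X (A y), ← pow_succ']
      push_cast
      ring

theorem fderiv_trace_pow {G : Type*} [NormedAddCommGroup G] [NormedSpace ℝ G]
    {A : G → E →L[ℝ] E} {A' : G →L[ℝ] E →L[ℝ] E} {y : G} (hA : HasFDerivAt A A' y) (m : ℕ)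
    (a : G) : fderiv ℝ (fun z => traceCLM E (A z ^ m)) y a =
      m * traceCLM E (A y ^ (m - 1) * A' a) := by
  obtain ⟨D, hD, hX⟩ := hA.trace_mul_pow m
  have := (traceCLM E).hasFDerivAt.comp y hD
  rw [HasFDerivAt.fderiv (f := fun z => traceCLM E (A z ^ m)) this]
  simpa using hX 1 a (Commute.one_left _)

end Trace

/-- In a finite-dimensional algebra the inverse of `x` lies in the algebra generated by `x`. -/
theorem Subalgebra.inv_mem_of_finiteDimensional {R : Type*} [Ring R] [Algebra ℝ R]
    [FiniteDimensional ℝ R] (B : Subalgebra ℝ R) {x y : R} (hx : x ∈ B) (hyx : y * x = 1) :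
    y ∈ B := by
  have hinj : Function.Injective (LinearMap.mulLeft ℝ (⟨x, hx⟩ : B)) := by
    intro a b hab
    have : x * a = x * b := congrArg Subtype.val hab
    apply Subtype.ext
    calc (a : R) = y * (x * a) := by rw [← mul_assoc, hyx, one_mul]
      _ = b := by rw [this, ← mul_assoc, hyx, one_mul]
  obtain ⟨b, hb⟩ := LinearMap.surjective_of_injective hinj 1
  have hb' : x * b = 1 := congrArg Subtype.val hb
  have : y = b := by rw [← mul_one y, ← hb', ← mul_assoc, hyx, one_mul]
  rw [this]
  exact b.2

/-! ### Riccati equation and constancy of the traces of the Hessian -/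

namespace EikonalPair

variable {E : Type*} [NormedAddCommGroup E] [InnerProductSpace ℝ E] [FiniteDimensional ℝ E]
  {N Ω : Set E} {u w : E → ℝ} {p q : E → E}
  (h : EikonalPair N Ω u w p q)
include h

section Hessian

variable {y : E} (hy : y ∈ Ω)
include hy

theorem sndDeriv_q_symm (a b : E) :
    fderiv ℝ (fderiv ℝ q) y a b = fderiv ℝ (fderiv ℝ q) y b a :=
  (h.contDiffAt_q hy).isSymmSndFDerivAt (by simpa using (ENat.LEInfty.out : (2 : ℕ∞ω) ≤ ∞)) a b

/-- The Riccati equation: differentiate $S(q)=0$ and use the symmetry of the second derivative of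
$q$. -/
theorem sndDeriv_q_q : fderiv ℝ (fderiv ℝ q) y (q y) = -(fderiv ℝ q y * fderiv ℝ q y) := by
  have h1 := (h.hasFDerivAt_fderiv_q hy).clm_apply (h.hasFDerivAt_q hy)
  have h2 : HasFDerivAt (fun z => fderiv ℝ q z (q z)) (0 : E →L[ℝ] E) y :=
    (hasFDerivAt_const (0 : E) y).congr_of_eventuallyEq
      ((h.eventually_mem hy).mono fun z hz => h.fderiv_q_q hz)
  ext a
  have := congrArg (fun L : E →L[ℝ] E => L a) (h1.unique h2)
  simp at this
  rw [h.sndDeriv_q_symm hy]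
  simp [eq_neg_of_add_eq_zero_right this]

/-- Differentiate $S(p)=0$ and replace $w\,dp$ by the tangential projection minus $uS$. -/
theorem sndDeriv_q_p : w y • fderiv ℝ (fderiv ℝ q) y (p y) =
    -(fderiv ℝ q y * (1 - u y • fderiv ℝ q y)) := by
  have h1 := (h.hasFDerivAt_fderiv_q hy).clm_apply (h.hasFDerivAt_p hy)
  have h2 : HasFDerivAt (fun z => fderiv ℝ q z (p z)) (0 : E →L[ℝ] E) y :=
    (hasFDerivAt_const (0 : E) y).congr_of_eventuallyEq
      ((h.eventually_mem hy).mono fun z hz => h.fderiv_q_p hz)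
  ext a
  have := congrArg (fun L : E →L[ℝ] E => L a) (h1.unique h2)
  simp at this
  have h3 : fderiv ℝ (fderiv ℝ q) y (p y) a = -(fderiv ℝ q y (fderiv ℝ p y a)) := by
    rw [h.sndDeriv_q_symm hy, eq_neg_of_add_eq_zero_right this]
  rw [smul_apply, h3, smul_neg, ← map_smul, h.w_smul_fderiv_p hy, tproj_apply]
  simp [h.fderiv_q_p hy, h.fderiv_q_q hy]

end Hessian

/-- If `g` is constant in the directions orthogonal to `p` and `q`, so is its derivative along
`q`. -/
theorem fderiv_fderiv_apply_q {g : E → ℝ} (hg : ContDiffOn ℝ ∞ g Ω)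
    (hT : ∀ y ∈ Ω, ∀ v, ⟪p y, v⟫ = 0 → ⟪q y, v⟫ = 0 → fderiv ℝ g y v = 0) :
    ∀ y ∈ Ω, ∀ v, ⟪p y, v⟫ = 0 → ⟪q y, v⟫ = 0 →
      fderiv ℝ (fun z => fderiv ℝ g z (q z)) y v = 0 := by
  intro y hy v hpv hqv
  have hg' : ContDiffAt ℝ ∞ g y := hg.contDiffAt (h.isOpen.mem_nhds hy)
  have h1 : HasFDerivAt (fderiv ℝ g) (fderiv ℝ (fderiv ℝ g) y) y :=
    ((hg'.fderiv_right (m := ∞) (by simp)).differentiableAt (by simp)).hasFDerivAt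
  rw [(h1.clm_apply (h.hasFDerivAt_q hy)).fderiv]
  have h2 : HasFDerivAt (fun z => fderiv ℝ g z (tproj p q z v)) (0 : E →L[ℝ] ℝ) y :=
    (hasFDerivAt_const (0 : ℝ) y).congr_of_eventuallyEq
      ((h.eventually_mem hy).mono fun z hz => hT z hz _ (h.inner_p_tproj hz v)
        (h.inner_q_tproj hz v))
  have h3 := h1.clm_apply (h.hasFDerivAt_tproj_apply hy v)
  have h4 := congrArg (fun L : E →L[ℝ] ℝ => L (q y)) (h2.unique h3)
  have h5 : tproj p q y v = v := by simp [tproj_apply, hpv, hqv]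
  simp [h.fderiv_tproj_apply hy, h.fderiv_p_q hy, h.fderiv_q_q hy, h5] at h4
  have h6 : fderiv ℝ (fderiv ℝ g) y v (q y) = fderiv ℝ (fderiv ℝ g) y (q y) v :=
    hg'.isSymmSndFDerivAt (by simpa using (ENat.LEInfty.out : (2 : ℕ∞ω) ≤ ∞)) _ _
  simp [h6, ← h4, hT y hy _ (h.inner_p_fderiv_q hy v) (h.inner_q_fderiv_q hy v)]

theorem contDiffOn_trace_pow (m : ℕ) :
    ContDiffOn ℝ ∞ (fun z => traceCLM E (fderiv ℝ q z ^ m)) Ω := fun y hy =>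
  ((traceCLM E).contDiff.contDiffAt.comp y ((h.contDiffAt_fderiv_q hy).pow m)).contDiffWithinAt

/-- By the Riccati equation the derivative of $\operatorname{tr}S^{m+1}$ along $q$ is
$-(m+1)\operatorname{tr}S^{m+2}$. A function constant along the leaves has a $q$-derivative constant
along the leaves, so the assumption on $\operatorname{tr}S$ propagates to every power. -/
theorem fderiv_trace_pow_eq_zero (m : ℕ) : ∀ y ∈ Ω, ∀ v, ⟪p y, v⟫ = 0 → ⟪q y, v⟫ = 0 →
    fderiv ℝ (fun z => traceCLM E (fderiv ℝ q z ^ (m + 1))) y v = 0 := by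
  induction m with
  | zero =>
    intro y hy v h1 h2
    simpa [traceCLM_apply] using h.trace_const y hy v h1 h2
  | succ m ih =>
    intro y hy v h1 h2
    have h3 := h.fderiv_fderiv_apply_q (h.contDiffOn_trace_pow (m + 1)) ih y hy v h1 h2
    have h4 : (fun z => fderiv ℝ (fun z => traceCLM E (fderiv ℝ q z ^ (m + 1))) z (q z))
        =ᶠ[𝓝 y] fun z => (-(m + 1 : ℝ)) • traceCLM E (fderiv ℝ q z ^ (m + 1 + 1)) := by
      filter_upwards [h.eventually_mem hy] with z hz
      rw [fderiv_trace_pow (h.hasFDerivAt_fderiv_q hz), h.sndDeriv_q_q hz]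
      rw [Nat.add_sub_cancel, mul_neg, map_neg, ← mul_assoc, ← pow_succ, ← pow_succ]
      push_cast
      rw [smul_eq_mul]; ring
    rw [h4.fderiv_eq, fderiv_fun_const_smul] at h3
    · have : (m + 1 : ℝ) ≠ 0 := by positivity
      rw [smul_apply, smul_eq_mul] at h3
      exact (mul_eq_zero.1 h3).resolve_left (neg_ne_zero.2 this)
    · exact ((h.contDiffOn_trace_pow (m + 1 + 1)).contDiffAt
        (h.isOpen.mem_nhds hy)).differentiableAt (by simp)

/-- For a monomial, $\operatorname{tr}(S^mD_vS)$ is $D_v\operatorname{tr}S^{m+1}$ divided by $m+1$.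
Polynomials in $S$ follow by linearity; the adjoined algebra is used so that $(1-uS)^{-1}$ is
covered as well. -/
theorem trace_mul_sndDeriv {y : E} (hy : y ∈ Ω) {v : E} (hpv : ⟪p y, v⟫ = 0) (hqv : ⟪q y, v⟫ = 0)
    {X : E →L[ℝ] E} (hX : X ∈ Algebra.adjoin ℝ {fderiv ℝ q y}) :
    traceCLM E (X * fderiv ℝ (fderiv ℝ q) y v) = 0 := by
  rw [Algebra.adjoin_singleton_eq_range_aeval] at hX
  obtain ⟨f, rfl⟩ := hX
  induction f using Polynomial.induction_on' with
  | add f g hf hg => rw [map_add, add_mul, map_add, hf, hg, add_zero]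
  | monomial m c =>
    have h1 := h.fderiv_trace_pow_eq_zero m y hy v hpv hqv
    rw [fderiv_trace_pow (h.hasFDerivAt_fderiv_q hy), Nat.add_sub_cancel] at h1
    have h2 := (mul_eq_zero.1 h1).resolve_left (by positivity)
    simp [Polynomial.aeval_monomial, Algebra.algebraMap_eq_smul_one, h2]

end EikonalPair

theorem HasFDerivAt.inverse_one_sub_smul {G R : Type*} [NormedAddCommGroup G] [NormedSpace ℝ G]
    [NormedRing R] [NormedAlgebra ℝ R] [HasSummableGeomSeries R] {S : G → R} {S' : G →L[ℝ] R}
    {u : G → ℝ} {u' : G →L[ℝ] ℝ} {y : G} (hS : HasFDerivAt S S' y) (hu : HasFDerivAt u u' y)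
    (hinv : IsUnit (1 - u y • S y)) :
    ∃ D : G →L[ℝ] R, HasFDerivAt (fun z => Ring.inverse (1 - u z • S z)) D y ∧
      ∀ a, D a = Ring.inverse (1 - u y • S y) * (u' a • S y + u y • S' a) *
        Ring.inverse (1 - u y • S y) := by
  have h1 : HasFDerivAt (fun z => 1 - u z • S z) (0 - (u y • S' + u'.smulRight (S y))) y :=
    (hasFDerivAt_const (1 : R) y).sub (hu.smul hS)
  obtain ⟨x, hx⟩ := id hinv
  have h2 : HasFDerivAt Ring.inverse _ (1 - u y • S y) :=
    hx ▸ hasFDerivAt_ringInverse (𝕜 := ℝ) x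
  refine ⟨_, HasFDerivAt.comp (g := Ring.inverse) y h2 h1, fun a => ?_⟩
  have h4 : (↑x⁻¹ : R) = Ring.inverse (1 - u y • S y) := by rw [← hx, Ring.inverse_unit]
  rw [← h4]
  simp only [ContinuousLinearMap.comp_apply, neg_apply, sub_apply, add_apply, smul_apply,
    zero_apply, ContinuousLinearMap.smulRight_apply, ContinuousLinearMap.mulLeftRight_apply]
  rw [zero_sub, mul_neg, neg_mul, neg_neg, add_comm]

/-! ### The shape operator at the foot point and its constant spectrum -/

namespace EikonalPair

variable {E : Type*} [NormedAddCommGroup E] [InnerProductSpace ℝ E] [FiniteDimensional ℝ E]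
  {N Ω : Set E} {u w : E → ℝ} {p q : E → E}

/-- The inverse of `1 - u S`, where `S` is the derivative of `q`. -/
noncomputable def resolv (u : E → ℝ) (q : E → E) (y : E) : E →L[ℝ] E :=
  Ring.inverse (1 - u y • fderiv ℝ q y)

/-- The shape operator of the hypersurface `N`, extended to be constant along the planes spanned by
`p` and `q`. -/
noncomputable def shape (u w : E → ℝ) (q : E → E) (y : E) : E →L[ℝ] E :=
  -(w y • (fderiv ℝ q y * resolv u q y))

section Algebra

variable {y : E} (hinv : IsUnit (1 - u y • fderiv ℝ q y))
include hinv

theorem resolv_mul : resolv u q y * (1 - u y • fderiv ℝ q y) = 1 :=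
  Ring.inverse_mul_cancel _ hinv

theorem mul_resolv : (1 - u y • fderiv ℝ q y) * resolv u q y = 1 :=
  Ring.mul_inverse_cancel _ hinv

theorem commute_resolv : Commute (fderiv ℝ q y) (resolv u q y) := by
  have hc : fderiv ℝ q y * (1 - u y • fderiv ℝ q y) = (1 - u y • fderiv ℝ q y) * fderiv ℝ q y := by
    rw [mul_sub, sub_mul, mul_one, one_mul, mul_smul_comm, smul_mul_assoc]
  have h1 : fderiv ℝ q y * resolv u q y = resolv u q y * (1 - u y • fderiv ℝ q y) *
      (fderiv ℝ q y * resolv u q y) := by rw [resolv_mul hinv, one_mul]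
  rw [Commute, SemiconjBy, h1, mul_assoc, ← mul_assoc _ (fderiv ℝ q y), ← hc, mul_assoc,
    mul_resolv hinv, mul_one]

theorem resolv_eq : resolv u q y = 1 + u y • (fderiv ℝ q y * resolv u q y) := by
  have := mul_resolv hinv
  rw [sub_mul, one_mul, smul_mul_assoc, sub_eq_iff_eq_add] at this
  exact this

theorem w_sub_u_smul_shape : w y • 1 - u y • shape u w q y = w y • resolv u q y := by
  conv_rhs => rw [resolv_eq hinv]
  rw [shape, smul_neg, sub_neg_eq_add, smul_add, smul_comm (u y)]

theorem commute_fderiv_shape : Commute (fderiv ℝ q y) (shape u w q y) := by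
  unfold shape
  exact (((Commute.refl _).mul_right (commute_resolv hinv)).smul_right _).neg_right

theorem resolv_mem_adjoin : resolv u q y ∈ Algebra.adjoin ℝ {fderiv ℝ q y} := by
  refine Subalgebra.inv_mem_of_finiteDimensional _ (x := 1 - u y • fderiv ℝ q y) ?_
    (resolv_mul hinv)
  exact sub_mem (one_mem _) (Subalgebra.smul_mem _ (Algebra.self_mem_adjoin_singleton _ _) _)

theorem shape_mem_adjoin : shape u w q y ∈ Algebra.adjoin ℝ {fderiv ℝ q y} :=
  neg_mem (Subalgebra.smul_mem _ (mul_mem (Algebra.self_mem_adjoin_singleton _ _)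
    (resolv_mem_adjoin hinv)) _)

end Algebra

variable (h : EikonalPair N Ω u w p q) {y : E} (hy : y ∈ Ω)
  (hinv : IsUnit (1 - u y • fderiv ℝ q y))
include h hy hinv

omit hinv in
theorem contDiffAt_u : ContDiffAt ℝ ∞ u y := by
  have h1 : ContDiffAt ℝ ∞ (fun z => ⟪q z, z⟫) y := (h.contDiffAt_q hy).inner ℝ contDiffAt_id
  refine h1.congr_of_eventuallyEq ((h.eventually_mem hy).mono fun z hz => ?_)
  beta_reduce
  have h2 : ⟪q z, z⟫ = ⟪q z, w z • p z + u z • q z⟫ := by rw [← h.decomp z hz]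
  rw [h2]
  simp [inner_add_right, real_inner_smul_right, h.norm_q hz, real_inner_comm (p z) (q z),
    h.inner_pq z hz]

omit hinv in
theorem contDiffAt_w : ContDiffAt ℝ ∞ w y := by
  have h1 : ContDiffAt ℝ ∞ (fun z => ⟪p z, z⟫) y := (h.contDiffAt_p hy).inner ℝ contDiffAt_id
  refine h1.congr_of_eventuallyEq ((h.eventually_mem hy).mono fun z hz => ?_)
  beta_reduce
  have h2 : ⟪p z, z⟫ = ⟪p z, w z • p z + u z • q z⟫ := by rw [← h.decomp z hz]
  rw [h2]
  simp [inner_add_right, real_inner_smul_right, h.norm_p hz, h.inner_pq z hz]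

theorem contDiffAt_resolv : ContDiffAt ℝ ∞ (resolv u q) y := by
  have h1 : ContDiffAt ℝ ∞ (fun z => 1 - u z • fderiv ℝ q z) y :=
    contDiffAt_const.sub ((h.contDiffAt_u hy).smul (h.contDiffAt_fderiv_q hy))
  obtain ⟨x, hx⟩ := hinv
  have h2 : ContDiffAt ℝ ∞ Ring.inverse (1 - u y • fderiv ℝ q y) := by
    rw [← hx]; exact contDiffAt_ringInverse ℝ x
  exact h2.comp y h1

theorem contDiffAt_shape : ContDiffAt ℝ ∞ (shape u w q) y :=
  ((h.contDiffAt_w hy).smul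
    ((h.contDiffAt_fderiv_q hy).mul (h.contDiffAt_resolv hy hinv))).neg

theorem hasFDerivAt_shape : HasFDerivAt (shape u w q) (fderiv ℝ (shape u w q) y) y :=
  ((h.contDiffAt_shape hy hinv).differentiableAt (by simp)).hasFDerivAt

theorem fderiv_shape_apply (a : E) : fderiv ℝ (shape u w q) y a =
    -(⟪p y, a⟫ • (fderiv ℝ q y * resolv u q y) +
      w y • (fderiv ℝ (fderiv ℝ q) y a * resolv u q y +
        fderiv ℝ q y * (resolv u q y * (⟪q y, a⟫ • fderiv ℝ q y +
          u y • fderiv ℝ (fderiv ℝ q) y a) * resolv u q y))) := by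
  obtain ⟨D, hD, hDa⟩ := (h.hasFDerivAt_fderiv_q hy).inverse_one_sub_smul
    (h.hasFDerivAt_u y hy) hinv
  have h3 : HasFDerivAt (resolv u q) D y := hD
  have h5 := ((h.hasFDerivAt_w y hy).smul ((h.hasFDerivAt_fderiv_q hy).mul' h3)).neg
  have h6 := congrArg (fun L : E →L[ℝ] E →L[ℝ] E => L a)
    ((h.hasFDerivAt_shape hy hinv).unique h5)
  have h7 : D a = resolv u q y * (⟪q y, a⟫ • fderiv ℝ q y +
      u y • fderiv ℝ (fderiv ℝ q) y a) * resolv u q y := hDa a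
  rw [h6, ← h7]
  simp only [neg_apply, add_apply, smul_apply, ContinuousLinearMap.smulRight_apply,
    innerSL_apply_apply, MulOpposite.smul_eq_mul_unop, MulOpposite.unop_op, smul_eq_mul]
  rw [add_comm, add_comm (fderiv ℝ q y * D a)]
  rfl

theorem fderiv_shape_of_orthogonal {v : E} (hpv : ⟪p y, v⟫ = 0) (hqv : ⟪q y, v⟫ = 0) :
    fderiv ℝ (shape u w q) y v =
      -(w y • (resolv u q y * fderiv ℝ (fderiv ℝ q) y v * resolv u q y)) := by
  rw [h.fderiv_shape_apply hy hinv, hpv, hqv]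
  conv_rhs => rw [resolv_eq hinv]
  have : resolv u q y * fderiv ℝ (fderiv ℝ q) y v * resolv u q y = 
      fderiv ℝ (fderiv ℝ q) y v * resolv u q y +
        fderiv ℝ q y * (resolv u q y * (u y • fderiv ℝ (fderiv ℝ q) y v) * resolv u q y) := by
    nth_rewrite 1 [resolv_eq hinv]
    simp [add_mul, mul_assoc]
  rw [← resolv_eq hinv, this]
  simp

/-- The foot point is fixed along $q$. In the formula, $u$ grows at unit rate, and
$S+u\,D_qS=(1-uS)S$ by the Riccati equation, so the two contributions cancel. -/
theorem fderiv_shape_q : fderiv ℝ (shape u w q) y (q y) = 0 := by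
  rw [h.fderiv_shape_apply hy hinv, h.inner_pq y hy, h.inner_qq y hy, h.sndDeriv_q_q hy]
  have e1 : (1 : ℝ) • fderiv ℝ q y + u y • -(fderiv ℝ q y * fderiv ℝ q y) =
      (1 - u y • fderiv ℝ q y) * fderiv ℝ q y := by
    rw [sub_mul, one_mul, one_smul, smul_mul_assoc, smul_neg, sub_eq_add_neg]
  rw [e1, ← mul_assoc (resolv u q y), resolv_mul hinv, one_mul]
  simp [mul_assoc]

theorem fderiv_shape_p : fderiv ℝ (shape u w q) y (p y) = 0 := by
  rw [h.fderiv_shape_apply hy hinv, real_inner_comm (p y) (q y), h.inner_pq y hy, h.inner_pp y hy]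
  have e1 : w y • (fderiv ℝ (fderiv ℝ q) y (p y) * resolv u q y +
        fderiv ℝ q y * (resolv u q y * ((0 : ℝ) • fderiv ℝ q y +
          u y • fderiv ℝ (fderiv ℝ q) y (p y)) * resolv u q y)) =
      (w y • fderiv ℝ (fderiv ℝ q) y (p y)) * resolv u q y +
        u y • (fderiv ℝ q y * (resolv u q y *
          ((w y • fderiv ℝ (fderiv ℝ q) y (p y)) * resolv u q y))) := by
    simp [mul_assoc, smul_comm (w y)]
  have e2 : (w y • fderiv ℝ (fderiv ℝ q) y (p y)) * resolv u q y = -fderiv ℝ q y := by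
    rw [h.sndDeriv_q_p hy, neg_mul, mul_assoc, mul_resolv hinv, mul_one]
  rw [e1, e2]
  have e3 := resolv_eq hinv
  have e4 := (commute_resolv hinv).eq
  have e5 : fderiv ℝ q y * resolv u q y = fderiv ℝ q y +
      u y • (fderiv ℝ q y * (resolv u q y * fderiv ℝ q y)) := by
    nth_rewrite 1 [e3]
    rw [mul_add, mul_one, mul_smul_comm, e4]
  rw [one_smul, mul_neg, mul_neg, smul_neg]
  nth_rewrite 1 [e5]
  abel

/-- Only directions orthogonal to $p$ and $q$ matter. There $D_vA=-wR\,(D_vS)\,R$ with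
$R=(1-uS)^{-1}$, so by cyclicity the trace of $A^{m-1}D_vA$ pairs $D_vS$ with $RA^{m-1}R$, which is
a polynomial in $S$. -/
theorem fderiv_trace_shape_pow (m : ℕ) :
    fderiv ℝ (fun z => traceCLM E (shape u w q z ^ m)) y = 0 := by
  ext a
  rw [fderiv_trace_pow (h.hasFDerivAt_shape hy hinv)]
  have hv : fderiv ℝ (shape u w q) y a = fderiv ℝ (shape u w q) y (tproj p q y a) := by
    rw [tproj_apply]
    simp [h.fderiv_shape_p hy hinv, h.fderiv_shape_q hy hinv]
  rw [hv, h.fderiv_shape_of_orthogonal hy hinv (h.inner_p_tproj hy a) (h.inner_q_tproj hy a)]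
  have hmem : resolv u q y * (shape u w q y ^ (m - 1) * resolv u q y) ∈
      Algebra.adjoin ℝ {fderiv ℝ q y} :=
    mul_mem (resolv_mem_adjoin hinv) (mul_mem (pow_mem (shape_mem_adjoin hinv) _)
      (resolv_mem_adjoin hinv))
  have h1 := h.trace_mul_sndDeriv hy (h.inner_p_tproj hy a) (h.inner_q_tproj hy a) hmem
  have h2 : traceCLM E (shape u w q y ^ (m - 1) *
      (resolv u q y * fderiv ℝ (fderiv ℝ q) y (tproj p q y a) * resolv u q y)) = 0 := by
    rw [← mul_assoc, traceCLM_mul_comm]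
    simpa only [mul_assoc] using h1
  simp [h2]

omit hinv in
theorem resolv_symm (a b : E) : ⟪resolv u q y a, b⟫ = ⟪a, resolv u q y b⟫ := by
  by_cases hinv : IsUnit (1 - u y • fderiv ℝ q y)
  · have key : ∀ a, a = resolv u q y a - u y • fderiv ℝ q y (resolv u q y a) := fun a => by
      have := congrArg (fun L : E →L[ℝ] E => L a) (mul_resolv hinv)
      simpa using this.symm
    nth_rewrite 2 [key a]
    nth_rewrite 1 [key b]
    simp only [inner_sub_left, inner_sub_right, real_inner_smul_left, real_inner_smul_right,
      h.symm_q hy]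
  · simp [resolv, Ring.inverse_non_unit _ hinv]

theorem shape_symm (a b : E) : ⟪shape u w q y a, b⟫ = ⟪a, shape u w q y b⟫ := by
  have h1 := congrArg (fun L : E →L[ℝ] E => L b) (commute_resolv hinv).eq
  simp at h1
  simp [shape, inner_neg_left, inner_neg_right, real_inner_smul_left, real_inner_smul_right,
    h.symm_q hy, h.resolv_symm hy, h1]

theorem shape_p : shape u w q y (p y) = 0 := by
  have h1 := congrArg (fun L : E →L[ℝ] E => L (p y)) (commute_resolv hinv).eq
  simp at h1
  simp [shape, h1, h.fderiv_q_p hy]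

theorem shape_q : shape u w q y (q y) = 0 := by
  have h1 := congrArg (fun L : E →L[ℝ] E => L (q y)) (commute_resolv hinv).eq
  simp at h1
  simp [shape, h1, h.fderiv_q_q hy]

omit hinv in
theorem resolv_of_mem (hyN : y ∈ N) : resolv u q y = 1 := by
  simp [resolv, h.u_eq_zero hy hyN]

omit hinv in
theorem shape_of_mem (hyN : y ∈ N) : shape u w q y = -fderiv ℝ q y := by
  simp [shape, h.resolv_of_mem hy hyN, h.w_eq_one hy hyN]

omit hy hinv in
theorem trace_shape_pow_eq (hΩ : Convex ℝ Ω)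
    (hinv : ∀ y ∈ Ω, IsUnit (1 - u y • fderiv ℝ q y)) {y z : E} (hy : y ∈ Ω) (hz : z ∈ Ω) (m : ℕ) :
    traceCLM E (shape u w q y ^ m) = traceCLM E (shape u w q z ^ m) := by
  have hd : ∀ x ∈ Ω, HasFDerivWithinAt (fun z => traceCLM E (shape u w q z ^ m))
      (0 : E →L[ℝ] ℝ) Ω x := fun x hx => by
    have : DifferentiableAt ℝ (fun z => traceCLM E (shape u w q z ^ m)) x :=
      ((traceCLM E).contDiff.contDiffAt.comp x
      ((h.contDiffAt_shape hx (hinv x hx)).pow m)).differentiableAt (by simp)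
    have := this.hasFDerivAt
    rw [h.fderiv_trace_shape_pow hx (hinv x hx) m] at this
    exact this.hasFDerivWithinAt
  have := hΩ.norm_image_sub_le_of_norm_hasFDerivWithin_le (C := 0) hd (by simp) hz hy
  simpa [sub_eq_zero] using this

end EikonalPair

/-! ### Gradient maps of constant rank -/

/-- A map `Φ` whose derivative is symmetric and of constant rank: `P` is the orthogonal projection
to the kernel of the derivative and `Z` is its pseudo-inverse. -/
structure ConstantRankGradient {E : Type*} [NormedAddCommGroup E] [InnerProductSpace ℝ E]
    (Ω : Set E) (Φ : E → E) (P Z : E → E →L[ℝ] E) : Prop where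
  isOpen : IsOpen Ω
  convex : Convex ℝ Ω
  contDiffOn : ContDiffOn ℝ ∞ Φ Ω
  contDiffOn_P : ContDiffOn ℝ ∞ P Ω
  continuousOn_Z : ContinuousOn Z Ω
  symm : ∀ y ∈ Ω, ∀ a b, ⟪fderiv ℝ Φ y a, b⟫ = ⟪a, fderiv ℝ Φ y b⟫
  symm_P : ∀ y ∈ Ω, ∀ a b, ⟪P y a, b⟫ = ⟪a, P y b⟫
  fderiv_mul_P : ∀ y ∈ Ω, fderiv ℝ Φ y * P y = 0
  Z_mul_fderiv : ∀ y ∈ Ω, Z y * fderiv ℝ Φ y = 1 - P y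
  fderiv_mul_Z : ∀ y ∈ Ω, fderiv ℝ Φ y * Z y = 1 - P y
  Z_mul_P : ∀ y ∈ Ω, Z y * P y = 0
  P_mul_P : ∀ y ∈ Ω, P y * P y = P y

namespace ConstantRankGradient

variable {E : Type*} [NormedAddCommGroup E] [InnerProductSpace ℝ E] [FiniteDimensional ℝ E]
  {Ω : Set E} {Φ : E → E} {P Z : E → E →L[ℝ] E} (h : ConstantRankGradient Ω Φ P Z)
include h

section Pointwise

variable {y : E} (hy : y ∈ Ω)
include hy

theorem eventually_mem : ∀ᶠ z in 𝓝 y, z ∈ Ω := h.isOpen.mem_nhds hy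

theorem contDiffAt : ContDiffAt ℝ ∞ Φ y := h.contDiffOn.contDiffAt (h.isOpen.mem_nhds hy)

theorem contDiffAt_fderiv : ContDiffAt ℝ ∞ (fderiv ℝ Φ) y :=
  (h.contDiffAt hy).fderiv_right (m := ∞) (by simp)

theorem hasFDerivAt : HasFDerivAt Φ (fderiv ℝ Φ y) y :=
  ((h.contDiffAt hy).differentiableAt (by simp)).hasFDerivAt

theorem hasFDerivAt_fderiv : HasFDerivAt (fderiv ℝ Φ) (fderiv ℝ (fderiv ℝ Φ) y) y :=
  ((h.contDiffAt_fderiv hy).differentiableAt (by simp)).hasFDerivAt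

theorem hasFDerivAt_P : HasFDerivAt P (fderiv ℝ P y) y :=
  ((h.contDiffOn_P.contDiffAt (h.isOpen.mem_nhds hy)).differentiableAt (by simp)).hasFDerivAt

theorem sndDeriv_symm (a b : E) :
    fderiv ℝ (fderiv ℝ Φ) y a b = fderiv ℝ (fderiv ℝ Φ) y b a :=
  (h.contDiffAt hy).isSymmSndFDerivAt (by simpa using (ENat.LEInfty.out : (2 : ℕ∞ω) ≤ ∞)) a b

theorem sndDeriv_adj (a b c : E) : ⟪fderiv ℝ (fderiv ℝ Φ) y a b, c⟫ =
    ⟪b, fderiv ℝ (fderiv ℝ Φ) y a c⟫ := by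
  have h0 := h.hasFDerivAt_fderiv hy
  have h1 := (h0.clm_apply (hasFDerivAt_const b y)).inner ℝ (hasFDerivAt_const c y)
  have h2 := (hasFDerivAt_const b y).inner ℝ (h0.clm_apply (hasFDerivAt_const c y))
  have h3 := h2.congr_of_eventuallyEq (f₁ := fun z => ⟪fderiv ℝ Φ z b, c⟫)
    ((h.eventually_mem hy).mono fun z hz => h.symm z hz b c)
  simpa [fderivInnerCLM_apply] using congrArg (fun L : E →L[ℝ] ℝ => L a) (h1.unique h3)

theorem sndDeriv_P (b v : E) : fderiv ℝ (fderiv ℝ Φ) y b (P y v) =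
    -fderiv ℝ Φ y (fderiv ℝ P y b v) := by
  have h1 := (h.hasFDerivAt_fderiv hy).clm_apply
    ((h.hasFDerivAt_P hy).clm_apply (hasFDerivAt_const v y))
  have h2 : HasFDerivAt (fun z => fderiv ℝ Φ z (P z v)) (0 : E →L[ℝ] E) y :=
    (hasFDerivAt_const (0 : E) y).congr_of_eventuallyEq
      ((h.eventually_mem hy).mono fun z hz =>
        congrArg (fun L : E →L[ℝ] E => L v) (h.fderiv_mul_P z hz))
  have := congrArg (fun L : E →L[ℝ] E => L b) (h1.unique h2)
  simp at this
  exact eq_neg_of_add_eq_zero_right this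

theorem fderiv_P_apply (v : E) : fderiv ℝ Φ y (P y v) = 0 :=
  congrArg (fun L : E →L[ℝ] E => L v) (h.fderiv_mul_P y hy)

/-- $\Phi$ is locally a gradient, so $\langle D^2\Phi(a,b),c\rangle$ is symmetric in all three
arguments. With two of them in the kernel, differentiating $d\Phi\,P=0$ puts $d\Phi$ on a vector
paired with a kernel vector, which gives zero. -/
theorem sndDeriv_P_P (v : E) : fderiv ℝ (fderiv ℝ Φ) y (P y v) (P y v) = 0 :=
  ext_inner_right ℝ fun b => by
    rw [h.sndDeriv_adj hy, h.sndDeriv_symm hy, h.sndDeriv_P hy, inner_neg_right, ← h.symm y hy,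
      h.fderiv_P_apply hy, inner_zero_left, neg_zero, inner_zero_left]

theorem eq_P_add (v : E) : v = P y v + Z y (fderiv ℝ Φ y v) := by
  have := congrArg (fun L : E →L[ℝ] E => L v) (h.Z_mul_fderiv y hy)
  simp at this
  rw [this]; abel

/-- Split $v$ into its kernel part and $Z\,d\Phi(v)$. The purely kernel contribution vanishes, so
$D^2\Phi(v,v)$ is linear in $d\Phi(v)$. This is the differential inequality for the Gronwall
argument along the segment. -/
theorem sndDeriv_self (v : E) : fderiv ℝ (fderiv ℝ Φ) y v v =
    ((fderiv ℝ (fderiv ℝ Φ) y v + fderiv ℝ (fderiv ℝ Φ) y (P y v)) * Z y)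
      (fderiv ℝ Φ y v) := by
  have h1 := h.eq_P_add hy v
  have h2 : fderiv ℝ (fderiv ℝ Φ) y v v = fderiv ℝ (fderiv ℝ Φ) y v (P y v)
      + fderiv ℝ (fderiv ℝ Φ) y v (Z y (fderiv ℝ Φ y v)) := by
    rw [← map_add, ← h1]
  have h3 : fderiv ℝ (fderiv ℝ Φ) y v (P y v) =
      fderiv ℝ (fderiv ℝ Φ) y (P y v) (Z y (fderiv ℝ Φ y v)) := by
    calc fderiv ℝ (fderiv ℝ Φ) y v (P y v) = fderiv ℝ (fderiv ℝ Φ) y (P y v) v :=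
          h.sndDeriv_symm hy _ _
      _ = fderiv ℝ (fderiv ℝ Φ) y (P y v) (P y v + Z y (fderiv ℝ Φ y v)) := by rw [← h1]
      _ = _ := by rw [map_add, h.sndDeriv_P_P hy, zero_add]
  rw [h2, h3]
  simp [add_comm]

end Pointwise

variable {y v : E} (hy : y ∈ Ω) (hyv : y + v ∈ Ω) (hv : P y v = v)
include hy hyv

omit [FiniteDimensional ℝ E] in
theorem add_smul_mem {t : ℝ} (ht : t ∈ Set.Icc (0 : ℝ) 1) : y + t • v ∈ Ω :=
  h.convex.add_smul_mem hy hyv ht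

include hv

/-- A vector in the kernel of the derivative at `y` stays in the kernel along the segment. -/
theorem fderiv_add_smul_apply {t : ℝ} (ht : t ∈ Set.Icc (0 : ℝ) 1) :
    fderiv ℝ Φ (y + t • v) v = 0 := by
  have hmem : ∀ t ∈ Set.Icc (0 : ℝ) 1, y + t • v ∈ Ω := fun t ht => h.add_smul_mem hy hyv ht
  have hline : Continuous fun t : ℝ => y + t • v := by fun_prop
  have hcomp : ∀ {F : Type _} [TopologicalSpace F] {g : E → F}, ContinuousOn g Ω →
      ContinuousOn (fun t : ℝ => g (y + t • v)) (Set.Icc 0 1) := fun hg =>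
    hg.comp hline.continuousOn hmem
  have hc1 : ContinuousOn (fderiv ℝ (fderiv ℝ Φ)) Ω := fun z hz =>
    (((h.contDiffAt_fderiv hz).fderiv_right (m := ∞) (by simp)).continuousAt).continuousWithinAt
  have hc2 : ContinuousOn (fderiv ℝ Φ) Ω := fun z hz =>
    (h.contDiffAt_fderiv hz).continuousAt.continuousWithinAt
  have hc : ContinuousOn (fun t : ℝ => (fderiv ℝ (fderiv ℝ Φ) (y + t • v) v +
      fderiv ℝ (fderiv ℝ Φ) (y + t • v) (P (y + t • v) v)) * Z (y + t • v)) (Set.Icc 0 1) :=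
    (((hcomp hc1).clm_apply continuousOn_const).add ((hcomp hc1).clm_apply
      ((hcomp h.contDiffOn_P.continuousOn).clm_apply continuousOn_const))).mul
      (hcomp h.continuousOn_Z)
  obtain ⟨C, hC⟩ := isCompact_Icc.exists_bound_of_continuousOn hc
  refine eq_zero_of_abs_deriv_le_mul_abs_self_of_eq_zero_right (K := C)
    (f := fun t : ℝ => fderiv ℝ Φ (y + t • v) v)
    (f' := fun t : ℝ => fderiv ℝ (fderiv ℝ Φ) (y + t • v) v v)
    ((hcomp hc2).clm_apply continuousOn_const) ?_ ?_ ?_ t ht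
  · intro t ht
    have h1 := h.hasFDerivAt_fderiv (hmem t (Set.Ico_subset_Icc_self ht))
    have h2 : HasDerivAt (fun t : ℝ => y + t • v) v t := by
      simpa using ((hasDerivAt_id t).smul_const v).const_add y
    have h3 : HasDerivAt (fun t : ℝ => fderiv ℝ Φ (y + t • v))
        (fderiv ℝ (fderiv ℝ Φ) (y + t • v) v) t := h1.comp_hasDerivAt t h2
    have h4 := h3.clm_apply (hasDerivAt_const t v)
    rw [map_zero, add_zero] at h4
    exact h4.hasDerivWithinAt
  · have := h.fderiv_P_apply hy v
    rw [hv] at this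
    simpa using this
  · intro t ht
    have ht' := Set.Ico_subset_Icc_self ht
    rw [h.sndDeriv_self (hmem t ht') v]
    exact (ContinuousLinearMap.le_opNorm _ _).trans
      (mul_le_mul_of_nonneg_right (hC t ht') (norm_nonneg _))

/-- `Φ` is constant on the affine pieces tangent to the kernel of its derivative. -/
theorem apply_add : Φ (y + v) = Φ y := by
  have h1 : ∀ t ∈ Set.Icc (0 : ℝ) 1,
      HasDerivWithinAt (fun t : ℝ => Φ (y + t • v)) 0 (Set.Icc 0 1) t := by
    intro t ht
    have h2 : HasDerivAt (fun t : ℝ => y + t • v) v t := by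
      simpa using ((hasDerivAt_id t).smul_const v).const_add y
    have h3 := (h.hasFDerivAt (h.add_smul_mem hy hyv ht)).comp_hasDerivAt t h2
    rw [h.fderiv_add_smul_apply hy hyv hv ht] at h3
    exact h3.hasDerivWithinAt
  have h4 := (convex_Icc (0 : ℝ) 1).norm_image_sub_le_of_norm_hasDerivWithin_le (C := 0) h1
    (by simp) (Set.left_mem_Icc.2 zero_le_one) (Set.right_mem_Icc.2 zero_le_one)
  simpa [sub_eq_zero] using h4

/-- The derivative of `Φ` along a segment in the kernel. -/
theorem exists_fderiv_mul_eq : ∃ C : E →L[ℝ] E, ∀ t ∈ Set.Icc (0 : ℝ) 1,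
    fderiv ℝ Φ (y + t • v) * (1 + t • C) = fderiv ℝ Φ y := by
  -- $C$ is the derivative of $z\mapsto P(z)v$ at $y$. The relation comes from differentiating
  -- $\Phi(z+tP(z)v)=\Phi(z)$, which holds for all $z$ near $y$.
  refine ⟨(fderiv ℝ P y).flip v, fun t ht => ?_⟩
  have h1 : HasFDerivAt (fun z => z + t • P z v) (1 + t • (fderiv ℝ P y).flip v) y := by
    have := (h.hasFDerivAt_P hy).clm_apply (hasFDerivAt_const v y)
    have h2 := (hasFDerivAt_id (𝕜 := ℝ) y).add (this.const_smul t)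
    rw [ContinuousLinearMap.comp_zero, zero_add] at h2
    exact h2
  have hmem : y + t • P y v ∈ Ω := by rw [hv]; exact h.add_smul_mem hy hyv ht
  have h2 : HasFDerivAt (fun z => Φ (z + t • P z v)) _ y := (h.hasFDerivAt hmem).comp y h1
  have h3 : (fun z => Φ (z + t • P z v)) =ᶠ[𝓝 y] Φ := by
    filter_upwards [h.eventually_mem hy, h1.continuousAt (h.isOpen.mem_nhds hmem)] with z hz hz'
    refine h.apply_add hz hz' ?_
    rw [map_smul, show P z (P z v) = P z v from
      congrArg (fun L : E →L[ℝ] E => L v) (h.P_mul_P z hz)]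
  have h4 := h2.unique ((h.hasFDerivAt hy).congr_of_eventuallyEq h3)
  rw [hv] at h4
  exact h4

/-- The kernel of the derivative is constant along a segment in the kernel. -/
theorem P_add_eq : P (y + v) = P y := by
  -- $\Phi$ is constant on $y+\ker d\Phi_y$ near $y+v$, so every kernel vector at $y$ is one at
  -- $y+v$.
  have h1 : P (y + v) * P y = P y := by
    ext a
    set n := P y a with hn
    have hPn : P y n = n := congrArg (fun L : E →L[ℝ] E => L a) (h.P_mul_P y hy)
    have hline : HasDerivAt (fun ε : ℝ => y + v + ε • n) n 0 := by
      simpa using ((hasDerivAt_id (0 : ℝ)).smul_const n).const_add (y + v)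
    have h2 : HasFDerivAt Φ (fderiv ℝ Φ (y + v)) (y + v + (0 : ℝ) • n) := by
      simpa using h.hasFDerivAt hyv
    have h3 : HasDerivAt (fun ε : ℝ => Φ (y + v + ε • n)) _ 0 := h2.comp_hasDerivAt 0 hline
    have h4 : (fun ε : ℝ => Φ (y + v + ε • n)) =ᶠ[𝓝 0] fun _ => Φ y := by
      have hmem : y + v + (0 : ℝ) • n ∈ Ω := by simpa using hyv
      filter_upwards [hline.continuousAt (h.isOpen.mem_nhds hmem)] with ε hε
      have hε' : y + (v + ε • n) ∈ Ω := by simpa [add_assoc] using hε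
      rw [add_assoc]
      exact h.apply_add hy hε' (by rw [map_add, map_smul, hv, hPn])
    have h5 := h3.unique ((hasDerivAt_const (0 : ℝ) (Φ y)).congr_of_eventuallyEq h4)
    have h6 := h.eq_P_add hyv n
    rw [h5, map_zero, add_zero] at h6
    exact h6.symm
  -- The opposite inclusion: $d\Phi_y=d\Phi_{y+v}(1+C)$, and symmetry moves $d\Phi_{y+v}$ onto its
  -- own kernel vector.
  have h2 : P y * P (y + v) = P (y + v) := by
    obtain ⟨C, hC⟩ := h.exists_fderiv_mul_eq hy hyv hv
    have hC1 := hC 1 (Set.right_mem_Icc.2 zero_le_one)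
    rw [one_smul, one_smul] at hC1
    ext a
    have h3 : fderiv ℝ Φ y (P (y + v) a) = 0 := ext_inner_right ℝ fun b => by
      rw [h.symm y hy, ← hC1, mul_apply_eq_comp, ← h.symm _ hyv, h.fderiv_P_apply hyv,
        inner_zero_left, inner_zero_left]
    have h6 := h.eq_P_add hy (P (y + v) a)
    rw [h3, map_zero, add_zero] at h6
    exact h6.symm
  ext a
  refine ext_inner_right ℝ fun b => ?_
  calc ⟪P (y + v) a, b⟫ = ⟪a, (P y * P (y + v)) b⟫ := by rw [h2, h.symm_P _ hyv]
    _ = ⟪(P (y + v) * P y) a, b⟫ := by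
      rw [mul_apply_eq_comp, mul_apply_eq_comp, ← h.symm_P y hy, ← h.symm_P _ hyv]
    _ = ⟪P y a, b⟫ := by rw [h1]

/-- The pseudo-inverse of the derivative is affine along a segment in the kernel. -/
theorem exists_Z_affine : ∃ Z₁ : E →L[ℝ] E, ∀ t ∈ Set.Icc (0 : ℝ) 1,
    Z (y + t • v) = Z y + t • Z₁ ∧ P (y + t • v) = P y := by
  obtain ⟨C, hC⟩ := h.exists_fderiv_mul_eq hy hyv hv
  refine ⟨(1 - P y) * C * Z y, fun t ht => ?_⟩
  have hmem := h.add_smul_mem hy hyv ht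
  have hP : P (y + t • v) = P y := h.P_add_eq hy hmem (by rw [map_smul, hv])
  refine ⟨?_, hP⟩
  have hPZ : P y * Z y = 0 := by
    have e1 : Z y * (1 - P y) = (1 - P y) * Z y := by
      nth_rewrite 1 [← h.fderiv_mul_Z y hy]
      rw [← h.Z_mul_fderiv y hy, mul_assoc]
    rw [mul_sub, sub_mul, h.Z_mul_P y hy, mul_one, one_mul, sub_zero] at e1
    exact sub_eq_self.1 e1.symm
  -- With common kernel projection $P$:
  -- $Z_t=Z_t(1-P)=Z_t\,d\Phi_0\,Z_0=Z_t\,d\Phi_t(1+tC)Z_0=(1-P)(1+tC)Z_0$.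
  calc Z (y + t • v) = Z (y + t • v) * (1 - P y) := by
        rw [mul_sub, ← hP, h.Z_mul_P _ hmem, mul_one, sub_zero]
    _ = Z (y + t • v) * (fderiv ℝ Φ (y + t • v) * (1 + t • C)) * Z y := by
        rw [hC t ht, mul_assoc, h.fderiv_mul_Z y hy]
    _ = (1 - P y) * (1 + t • C) * Z y := by
        rw [← mul_assoc, h.Z_mul_fderiv _ hmem, hP]
    _ = Z y + t • ((1 - P y) * C * Z y) := by
        rw [mul_add, mul_one, add_mul, sub_mul, one_mul, hPZ, sub_zero, mul_smul_comm,
          smul_mul_assoc]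

end ConstantRankGradient

/-! ### Odd powers of $\sqrt{1+\mu t^2}$ and polynomial traces -/

open Polynomial in
theorem irreducible_one_add_sq {μ : ℝ} (hμ : 0 < μ) : Irreducible (1 + C μ * X ^ 2 : ℝ[X]) := by
  have hdeg : (1 + C μ * X ^ 2 : ℝ[X]).natDegree = 2 := by
    rw [add_comm, show (1 : ℝ[X]) = C 1 from rfl, natDegree_add_C, natDegree_C_mul_X_pow 2 μ hμ.ne']
  rw [Polynomial.irreducible_iff_roots_eq_zero_of_degree_le_three (by omega) (by omega)]
  refine Multiset.eq_zero_of_forall_notMem fun x hx => ?_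
  have h1 := isRoot_of_mem_roots hx
  simp [IsRoot] at h1
  nlinarith [mul_nonneg hμ.le (sq_nonneg x)]

-- The irreducible $D$ has even multiplicity in a square and odd multiplicity on the right; the
-- induction strips $D^2$ from both sides.
open Polynomial in
theorem sq_ne_C_mul_odd_pow {D : ℝ[X]} (hD : Irreducible D) {c : ℝ} (hc : c ≠ 0) (k : ℕ) :
    ∀ R : ℝ[X], R ^ 2 ≠ C c * D ^ (2 * k + 1) := by
  induction k with
  | zero =>
    intro R hR
    have hdvd : D ∣ R := hD.prime.dvd_of_dvd_pow (n := 2) ⟨C c, by rw [hR]; ring⟩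
    obtain ⟨R', rfl⟩ := hdvd
    have h1 : D * R' ^ 2 = C c := mul_left_cancel₀ hD.ne_zero (by linear_combination hR)
    exact hD.not_isUnit (isUnit_of_dvd_unit ⟨_, h1.symm⟩ (isUnit_C.2 hc.isUnit))
  | succ k ih =>
    intro R hR
    have hdvd : D ∣ R := hD.prime.dvd_of_dvd_pow (n := 2)
      ⟨C c * D ^ (2 * k + 2), by rw [hR]; ring⟩
    obtain ⟨R', rfl⟩ := hdvd
    refine ih R' (mul_left_cancel₀ (pow_ne_zero 2 hD.ne_zero) ?_)
    linear_combination hR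

open Polynomial in
/-- An odd power of `√(1 + μ t²)` is not a polynomial in `t`. -/
theorem eq_zero_of_eval_eq_mul_odd_pow {R : ℝ[X]} {c μ : ℝ} (hμ : 0 < μ) {l : ℕ} (hl : Odd l)
    {k : ℝ → ℝ} (hk : ∀ t ∈ Set.Icc (0 : ℝ) 1, k t ^ 2 = 1 + μ * t ^ 2)
    (hR : ∀ t ∈ Set.Icc (0 : ℝ) 1, R.eval t = k t ^ l * c) : c = 0 := by
  by_contra hc
  obtain ⟨j, rfl⟩ := hl
  refine sq_ne_C_mul_odd_pow (irreducible_one_add_sq hμ) (pow_ne_zero 2 hc) j R ?_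
  refine eq_of_infinite_eval_eq _ _ ((Set.Icc_infinite zero_lt_one).mono fun t ht => ?_)
  simp only [Set.mem_ofPred_eq, eval_pow, eval_mul, eval_C, eval_add, eval_one, eval_X]
  rw [hR t ht, ← hk t ht]
  ring

section

variable {E : Type*} [NormedAddCommGroup E] [InnerProductSpace ℝ E] [FiniteDimensional ℝ E]

open Polynomial in
theorem exists_trace_affine_pow (Y₀ Y₁ : E →L[ℝ] E) (l : ℕ) : ∀ X : E →L[ℝ] E, ∃ R : ℝ[X],
    ∀ t : ℝ, traceCLM E (X * (Y₀ + t • Y₁) ^ l) = R.eval t := by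
  induction l with
  | zero => exact fun X => ⟨C (traceCLM E X), fun t => by simp⟩
  | succ l ih =>
    intro X
    obtain ⟨R₀, h₀⟩ := ih (X * Y₀)
    obtain ⟨R₁, h₁⟩ := ih (X * Y₁)
    refine ⟨R₀ + Polynomial.X * R₁, fun t => ?_⟩
    rw [pow_succ', ← mul_assoc, mul_add, add_mul, map_add, h₀, mul_smul_comm, smul_mul_assoc,
      map_smul, h₁]
    simp

/-- For symmetric $B$ the trace of $B^2$ is the squared Hilbert–Schmidt norm. -/
theorem eq_zero_of_trace_mul_self {B : E →L[ℝ] E} (hB : ∀ a b, ⟪B a, b⟫ = ⟪a, B b⟫)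
    (h : traceCLM E (B * B) = 0) : B = 0 := by
  have e := traceCLM_eq_sum (stdOrthonormalBasis ℝ E) (B * B)
  rw [h] at e
  have h1 : ∀ i, ⟪stdOrthonormalBasis ℝ E i, (B * B) (stdOrthonormalBasis ℝ E i)⟫ =
      ‖B (stdOrthonormalBasis ℝ E i)‖ ^ 2 := fun i => by
    rw [mul_apply_eq_comp, ← hB, real_inner_self_eq_norm_sq]
  simp only [h1] at e
  have h2 := (Finset.sum_eq_zero_iff_of_nonneg fun i _ => sq_nonneg _).1 e.symm
  ext v
  have h3 : ∀ i, B (stdOrthonormalBasis ℝ E i) = 0 := fun i => by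
    have := h2 i (Finset.mem_univ i)
    simpa using this
  rw [← (stdOrthonormalBasis ℝ E).sum_repr v, map_sum]
  simp [h3]

end

/-! ### Functional calculus of the shape operator -/

namespace EikonalPair

open Polynomial

variable {E : Type*} [NormedAddCommGroup E] [InnerProductSpace ℝ E] [FiniteDimensional ℝ E]
  {N Ω : Set E} {u w : E → ℝ} {p q : E → E} {ι : Type*} [Fintype ι] [DecidableEq ι] {κ : ι → ℝ}

/-- The function with values `r j` at the principal curvatures `κ j`, applied to the shape operator
and extended by zero to the span of `p` and `q`. -/
noncomputable def fcalc (u w : E → ℝ) (p q : E → E) (κ r : ι → ℝ) (y : E) : E →L[ℝ] E :=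
  aeval (shape u w q y) (Lagrange.interpolate Finset.univ κ r) * tproj p q y

section Pointwise

variable (h : EikonalPair N Ω u w p q) {y : E} (hy : y ∈ Ω)
  (hinv : IsUnit (1 - u y • fderiv ℝ q y))
include h hy

theorem tproj_mul_tproj : tproj p q y * tproj p q y = tproj p q y := by
  ext a
  rw [mul_apply_eq_comp, tproj_apply (a := tproj p q y a), h.inner_p_tproj hy, h.inner_q_tproj hy]
  simp

theorem tproj_symm (a b : E) : ⟪tproj p q y a, b⟫ = ⟪a, tproj p q y b⟫ := by
  simp only [tproj_apply, inner_sub_left, inner_sub_right, real_inner_smul_left,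
    real_inner_smul_right, real_inner_comm a]
  ring

theorem fderiv_mul_tproj : fderiv ℝ q y * tproj p q y = fderiv ℝ q y := by
  ext a
  simp [tproj_apply, h.fderiv_q_p hy, h.fderiv_q_q hy]

theorem tproj_mul_fderiv : tproj p q y * fderiv ℝ q y = fderiv ℝ q y := by
  ext a
  simp [tproj_apply, h.inner_p_fderiv_q hy, h.inner_q_fderiv_q hy]

theorem commute_fderiv_tproj : Commute (fderiv ℝ q y) (tproj p q y) := by
  rw [Commute, SemiconjBy, h.fderiv_mul_tproj hy, h.tproj_mul_fderiv hy]

include hinv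

theorem shape_mul_tproj : shape u w q y * tproj p q y = shape u w q y := by
  ext a
  simp [tproj_apply, h.shape_p hy hinv, h.shape_q hy hinv]

theorem tproj_mul_shape : tproj p q y * shape u w q y = shape u w q y := by
  ext a
  have h1 : ⟪p y, shape u w q y a⟫ = 0 := by
    rw [← h.shape_symm hy hinv, h.shape_p hy hinv, inner_zero_left]
  have h2 : ⟪q y, shape u w q y a⟫ = 0 := by
    rw [← h.shape_symm hy hinv, h.shape_q hy hinv, inner_zero_left]
  simp [tproj_apply, h1, h2]

theorem commute_aeval_tproj (f : ℝ[X]) : Commute (aeval (shape u w q y) f) (tproj p q y) := by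
  have h1 : Commute (shape u w q y) (tproj p q y) := by
    rw [Commute, SemiconjBy, h.shape_mul_tproj hy hinv, h.tproj_mul_shape hy hinv]
  induction f using Polynomial.induction_on' with
  | add f g hf hg => rw [map_add]; exact hf.add_left hg
  | monomial m c =>
    rw [aeval_monomial, Algebra.algebraMap_eq_smul_one, smul_one_mul]
    exact (h1.pow_left m).smul_left c

theorem commute_fderiv_aeval (f : ℝ[X]) : Commute (fderiv ℝ q y) (aeval (shape u w q y) f) := by
  induction f using Polynomial.induction_on' with
  | add f g hf hg => rw [map_add]; exact hf.add_right hg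
  | monomial m c =>
    rw [aeval_monomial, Algebra.algebraMap_eq_smul_one, smul_one_mul]
    exact ((commute_fderiv_shape hinv).pow_right m).smul_right c

theorem aeval_symm (f : ℝ[X]) (a b : E) :
    ⟪aeval (shape u w q y) f a, b⟫ = ⟪a, aeval (shape u w q y) f b⟫ := by
  have hpow : ∀ m : ℕ, ∀ a b, ⟪(shape u w q y ^ m) a, b⟫ = ⟪a, (shape u w q y ^ m) b⟫ := by
    intro m
    induction m with
    | zero => simp
    | succ m ih =>
      intro a b
      rw [pow_succ, mul_apply_eq_comp, ih, h.shape_symm hy hinv, ← mul_apply_eq_comp, ← pow_succ',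
        pow_succ]
  induction f using Polynomial.induction_on' with
  | add f g hf hg => simp [inner_add_left, inner_add_right, hf, hg]
  | monomial m c =>
    rw [aeval_monomial, Algebra.algebraMap_eq_smul_one, smul_one_mul]
    simp only [smul_apply, real_inner_smul_left, real_inner_smul_right, hpow]

theorem aeval_tproj_symm (f : ℝ[X]) (a b : E) :
    ⟪(aeval (shape u w q y) f * tproj p q y) a, b⟫ =
      ⟪a, (aeval (shape u w q y) f * tproj p q y) b⟫ := by
  rw [mul_apply_eq_comp, h.aeval_symm hy hinv, h.tproj_symm hy, ← mul_apply_eq_comp,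
    (h.commute_aeval_tproj hy hinv f).eq]

theorem aeval_tproj_mul (f g : ℝ[X]) :
    (aeval (shape u w q y) f * tproj p q y) * (aeval (shape u w q y) g * tproj p q y) =
      aeval (shape u w q y) (f * g) * tproj p q y := by
  rw [mul_assoc, ← mul_assoc (tproj p q y), ← (h.commute_aeval_tproj hy hinv g).eq, mul_assoc,
    h.tproj_mul_tproj hy, ← mul_assoc, map_mul]

theorem aeval_shape_apply {v : E} (hv : shape u w q y v = 0) (f : ℝ[X]) :
    aeval (shape u w q y) f v = f.eval 0 • v := by
  induction f using Polynomial.induction_on' with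
  | add f g hf hg => simp [hf, hg, add_smul]
  | monomial m c =>
    rcases m with _ | m
    · simp [Algebra.algebraMap_eq_smul_one]
    · simp [aeval_monomial, Algebra.algebraMap_eq_smul_one, pow_succ, hv]

/-- $A$ kills $p$ and $q$, so $f(A)$ acts on each of them as $f(0)$. The correction is the same at
every point, and constancy of the traces survives the restriction to the tangential part. -/
theorem trace_aeval_tproj (f : ℝ[X]) : traceCLM E (aeval (shape u w q y) f * tproj p q y) =
    traceCLM E (aeval (shape u w q y) f) - 2 * f.eval 0 := by
  have h1 : aeval (shape u w q y) f * tproj p q y = aeval (shape u w q y) f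
      - (innerSL ℝ (p y)).smulRight (f.eval 0 • p y)
      - (innerSL ℝ (q y)).smulRight (f.eval 0 • q y) := by
    ext a
    rw [mul_apply_eq_comp, tproj_apply, map_sub, map_sub, map_smul, map_smul,
      h.aeval_shape_apply hy hinv (h.shape_p hy hinv), h.aeval_shape_apply hy hinv
      (h.shape_q hy hinv)]
    simp
  rw [h1, map_sub, map_sub, traceCLM_smulRight, traceCLM_smulRight]
  simp [real_inner_smul_right, h.norm_p hy, h.norm_q hy]
  ring

end Pointwise

section Global

variable (h : EikonalPair N Ω u w p q) (hΩ : Convex ℝ Ω)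
  (hinv : ∀ y ∈ Ω, IsUnit (1 - u y • fderiv ℝ q y))
include h hΩ hinv

theorem trace_aeval_eq {y z : E} (hy : y ∈ Ω) (hz : z ∈ Ω) (f : ℝ[X]) :
    traceCLM E (aeval (shape u w q y) f * tproj p q y) =
      traceCLM E (aeval (shape u w q z) f * tproj p q z) := by
  rw [h.trace_aeval_tproj hy (hinv y hy), h.trace_aeval_tproj hz (hinv z hz)]
  congr 1
  induction f using Polynomial.induction_on' with
  | add f g hf hg => simp [hf, hg]
  | monomial m c =>
    simp [aeval_monomial, Algebra.algebraMap_eq_smul_one, h.trace_shape_pow_eq hΩ hinv hy hz m]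

/-- A polynomial equation of the shape operator propagates from one point to all of `Ω`. -/
theorem aeval_tproj_eq_zero {y z : E} (hy : y ∈ Ω) (hz : z ∈ Ω) {f : ℝ[X]}
    (hf : aeval (shape u w q z) f * tproj p q z = 0) :
    aeval (shape u w q y) f * tproj p q y = 0 := by
  refine eq_zero_of_trace_mul_self (h.aeval_tproj_symm hy (hinv y hy) f) ?_
  rw [h.aeval_tproj_mul hy (hinv y hy), h.trace_aeval_eq hΩ hinv hy hz,
    ← h.aeval_tproj_mul hz (hinv z hz), hf, mul_zero, map_zero]

end Global

end EikonalPair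

/-! ### Focal maps and the symmetry of the focal spectra -/

namespace EikonalPair

open Polynomial

variable {E : Type*} [NormedAddCommGroup E] [InnerProductSpace ℝ E] [FiniteDimensional ℝ E]
  {N Ω : Set E} {u w : E → ℝ} {p q : E → E} {ι : Type*} [Fintype ι] [DecidableEq ι] {κ : ι → ℝ}

section Pointwise

variable (h : EikonalPair N Ω u w p q) {y : E} (hy : y ∈ Ω)
  (hinv : IsUnit (1 - u y • fderiv ℝ q y)) (hκ : Function.Injective κ)
  (hQ : aeval (shape u w q y) (∏ j, (X - C (κ j))) * tproj p q y = 0)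

theorem eval_interpolate (hκ : Function.Injective κ) (r : ι → ℝ) (j : ι) :
    (Lagrange.interpolate Finset.univ κ r).eval (κ j) = r j :=
  Lagrange.eval_interpolate_at_node r hκ.injOn (Finset.mem_univ j)

include h hy hinv hκ hQ

/-- Polynomials agreeing at all $\kappa_j$ differ by a multiple of $\prod_j(X-\kappa_j)$, which
annihilates the tangential part. Hence `fcalc` is multiplicative in the values. -/
theorem aeval_tproj_congr {f g : ℝ[X]} (hfg : ∀ j, f.eval (κ j) = g.eval (κ j)) :
    aeval (shape u w q y) f * tproj p q y = aeval (shape u w q y) g * tproj p q y := by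
  have hdvd : (∏ j, (X - C (κ j))) ∣ f - g := by
    refine Finset.prod_dvd_of_coprime
      (fun i _ j _ hij => pairwise_coprime_X_sub_C hκ hij) fun j _ => ?_
    rw [dvd_iff_isRoot, IsRoot, eval_sub, hfg, sub_self]
  obtain ⟨t, ht⟩ := hdvd
  rw [← sub_eq_zero, ← sub_mul, ← map_sub, ht, mul_comm, map_mul, mul_assoc, hQ, mul_zero]

theorem fcalc_eq {f : ℝ[X]} {r : ι → ℝ} (hf : ∀ j, f.eval (κ j) = r j) :
    fcalc u w p q κ r y = aeval (shape u w q y) f * tproj p q y :=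
  h.aeval_tproj_congr hy hinv hκ hQ fun j => by rw [eval_interpolate hκ, hf]

theorem fcalc_mul (r s : ι → ℝ) :
    fcalc u w p q κ r y * fcalc u w p q κ s y = fcalc u w p q κ (r * s) y := by
  rw [fcalc, fcalc, h.aeval_tproj_mul hy hinv]
  refine (h.fcalc_eq hy hinv hκ hQ fun j => ?_).symm
  rw [eval_mul, eval_interpolate hκ, eval_interpolate hκ, Pi.mul_apply]

theorem fcalc_one : fcalc u w p q κ 1 y = tproj p q y := by
  rw [h.fcalc_eq hy hinv hκ hQ (f := 1) (by simp)]
  simp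

theorem fcalc_id : fcalc u w p q κ κ y = shape u w q y := by
  rw [h.fcalc_eq hy hinv hκ hQ (f := X) (by simp), aeval_X, h.shape_mul_tproj hy hinv]

omit h hy hinv hκ hQ in
theorem fcalc_add (r s : ι → ℝ) :
    fcalc u w p q κ (r + s) y = fcalc u w p q κ r y + fcalc u w p q κ s y := by
  rw [fcalc, map_add, map_add, add_mul]; rfl

omit h hy hinv hκ hQ in
theorem fcalc_smul (c : ℝ) (r : ι → ℝ) :
    fcalc u w p q κ (c • r) y = c • fcalc u w p q κ r y := by
  simp only [fcalc, map_smul, smul_mul_assoc]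

omit h hy hinv hκ hQ in
theorem fcalc_sub (r s : ι → ℝ) :
    fcalc u w p q κ (r - s) y = fcalc u w p q κ r y - fcalc u w p q κ s y := by
  rw [fcalc, map_sub, map_sub, sub_mul]; rfl

theorem fcalc_pow (r : ι → ℝ) {l : ℕ} (hl : l ≠ 0) :
    fcalc u w p q κ r y ^ l = fcalc u w p q κ (r ^ l) y := by
  induction l with
  | zero => exact absurd rfl hl
  | succ l ih =>
    rcases l with _ | l
    · simp
    · rw [pow_succ, ih (by simp), h.fcalc_mul hy hinv hκ hQ, ← pow_succ]

omit hκ hQ in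
theorem fcalc_symm (r : ι → ℝ) (a b : E) :
    ⟪fcalc u w p q κ r y a, b⟫ = ⟪a, fcalc u w p q κ r y b⟫ :=
  h.aeval_tproj_symm hy hinv _ a b

omit hκ hQ in
theorem commute_fderiv_fcalc (r : ι → ℝ) : Commute (fderiv ℝ q y) (fcalc u w p q κ r y) :=
  (h.commute_fderiv_aeval hy hinv _).mul_right (h.commute_fderiv_tproj hy)

omit hκ hQ in
theorem contDiffAt_fcalc (r : ι → ℝ) : ContDiffAt ℝ ∞ (fcalc u w p q κ r) y := by
  have h1 : ∀ f : ℝ[X], ContDiffAt ℝ ∞ (fun z => aeval (shape u w q z) f) y := by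
    intro f
    induction f using Polynomial.induction_on' with
    | add f g hf hg => simpa using hf.add hg
    | monomial m c =>
      simp only [aeval_monomial, Algebra.algebraMap_eq_smul_one, smul_one_mul]
      exact ((h.contDiffAt_shape hy hinv).pow m).const_smul c
  exact (h1 _).mul (h.contDiffAt_tproj hy)

/-- The derivative of `λ p + q` in terms of the shape operator. -/
theorem w_smul_fderiv_focal (i : ι) :
    w y • fderiv ℝ (fun z => κ i • p z + q z) y =
      fcalc u w p q κ (fun j => κ i - κ j) y * (1 - u y • fderiv ℝ q y) := by
  have h1 : fcalc u w p q κ (fun j => κ i - κ j) y = κ i • tproj p q y - shape u w q y := by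
    rw [show (fun j => κ i - κ j) = κ i • (1 : ι → ℝ) - κ from by ext j; simp, fcalc_sub,
      fcalc_smul, h.fcalc_one hy hinv hκ hQ, h.fcalc_id hy hinv hκ hQ]
  have h2 : shape u w q y * (1 - u y • fderiv ℝ q y) = -(w y • fderiv ℝ q y) := by
    rw [shape, neg_mul, smul_mul_assoc, mul_assoc, resolv_mul hinv, mul_one]
  have h3 : HasFDerivAt (fun z => κ i • p z + q z) (κ i • fderiv ℝ p y + fderiv ℝ q y) y :=
    ((h.hasFDerivAt_p hy).const_smul (κ i)).add (h.hasFDerivAt_q hy)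
  rw [h3.fderiv, h1, sub_mul, h2, sub_neg_eq_add, smul_mul_assoc, mul_sub, mul_one, mul_smul_comm,
    h.tproj_mul_fderiv hy, smul_add, smul_comm]
  congr 2
  ext a
  simpa using h.w_smul_fderiv_p hy a

end Pointwise

/-- The convention $0^{-1}=0$ turns $(\kappa_i-\kappa_j)^{-1}$ into a pseudo-inverse: the index with
$\kappa_j=\kappa_i$ is simply switched off. -/
theorem sub_mul_inv_mul (κ : ι → ℝ) (i : ι) :
    (fun j => κ i - κ j) * (fun j => (κ i - κ j) * (κ i - κ j)⁻¹) = fun j => κ i - κ j := by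
  ext j
  rcases eq_or_ne (κ i - κ j) 0 with h | h
  · simp [h]
  · simp [h]

/-- The indicator of the principal curvatures different from `κ i`. -/
noncomputable def indNe (κ : ι → ℝ) (i : ι) : ι → ℝ := fun j => (κ i - κ j) * (κ i - κ j)⁻¹

theorem indNe_mul_self (κ : ι → ℝ) (i : ι) : indNe κ i * indNe κ i = indNe κ i := by
  ext j
  rcases eq_or_ne (κ i - κ j) 0 with h | h <;> simp [indNe, h]

theorem sub_mul_indNe (κ : ι → ℝ) (i : ι) :
    (fun j => κ i - κ j) * indNe κ i = fun j => κ i - κ j := sub_mul_inv_mul κ i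

theorem inv_mul_indNe (κ : ι → ℝ) (i : ι) :
    (fun j => (κ i - κ j)⁻¹) * indNe κ i = fun j => (κ i - κ j)⁻¹ := by
  ext j
  rcases eq_or_ne (κ i - κ j) 0 with h | h <;> simp [indNe, h]

/-- The pseudo-inverse of the derivative of `κ i • p + q`. -/
noncomputable def focalInv (u w : E → ℝ) (p q : E → E) (κ : ι → ℝ) (i : ι) (y : E) : E →L[ℝ] E :=
  w y • fcalc u w p q κ (fun j => (κ i - κ j)⁻¹) y -
    u y • fcalc u w p q κ (κ * fun j => (κ i - κ j)⁻¹) y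

section Global

variable (h : EikonalPair N Ω u w p q) (hΩ : Convex ℝ Ω)
  (hinv : ∀ y ∈ Ω, IsUnit (1 - u y • fderiv ℝ q y)) (hκ : Function.Injective κ)
  (hQ : ∀ y ∈ Ω, aeval (shape u w q y) (∏ j, (X - C (κ j))) * tproj p q y = 0)
include h hΩ hinv hκ hQ

theorem trace_fcalc_eq (r : ι → ℝ) {y z : E} (hy : y ∈ Ω) (hz : z ∈ Ω) :
    traceCLM E (fcalc u w p q κ r y) = traceCLM E (fcalc u w p q κ r z) :=
  h.trace_aeval_eq hΩ hinv hy hz _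

/-- The focal map of the principal curvature `κ i` has a derivative of constant rank. -/
theorem constantRankGradient_focal (i : ι) : ConstantRankGradient Ω
    (fun z => κ i • p z + q z) (fun z => 1 - fcalc u w p q κ (indNe κ i) z)
    (focalInv u w p q κ i) := by
  have hw : ∀ y ∈ Ω, w y ≠ 0 := fun y hy => (h.w_pos y hy).ne'
  have hsymm : ∀ y ∈ Ω, ∀ a b, ⟪fderiv ℝ (fun z => κ i • p z + q z) y a, b⟫ =
      ⟪a, fderiv ℝ (fun z => κ i • p z + q z) y b⟫ := by
    intro y hy a b
    have h3 : HasFDerivAt (fun z => κ i • p z + q z) (κ i • fderiv ℝ p y + fderiv ℝ q y) y :=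
      ((h.hasFDerivAt_p hy).const_smul (κ i)).add (h.hasFDerivAt_q hy)
    rw [h3.fderiv]
    simp [inner_add_left, inner_add_right, real_inner_smul_left, real_inner_smul_right,
      h.symm_p hy, h.symm_q hy]
  have hsymmP : ∀ y ∈ Ω, ∀ a b, ⟪(1 - fcalc u w p q κ (indNe κ i) y) a, b⟫ =
      ⟪a, (1 - fcalc u w p q κ (indNe κ i) y) b⟫ := by
    intro y hy a b
    simp [inner_sub_left, inner_sub_right, h.fcalc_symm hy (hinv y hy)]
  have hsymmZ : ∀ y ∈ Ω, ∀ a b, ⟪focalInv u w p q κ i y a, b⟫ =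
      ⟪a, focalInv u w p q κ i y b⟫ := by
    intro y hy a b
    simp [focalInv, inner_sub_left, inner_sub_right, real_inner_smul_left, real_inner_smul_right,
      h.fcalc_symm hy (hinv y hy)]
  have hHZ : ∀ y ∈ Ω, fderiv ℝ (fun z => κ i • p z + q z) y * focalInv u w p q κ i y =
      1 - (1 - fcalc u w p q κ (indNe κ i) y) := by
    intro y hy
    have hi := hinv y hy
    -- Since $w-uA=wR$ with $R=(1-uS)^{-1}$, this is $wR$ times the pseudo-inverse of $\kappa_i-A$.
    -- It inverts $w^{-1}(\kappa_i-A)(1-uS)$, the derivative of the focal map, off the kernel.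
    have hZ : focalInv u w p q κ i y = (w y • resolv u q y) *
        fcalc u w p q κ (fun j => (κ i - κ j)⁻¹) y := by
      rw [← w_sub_u_smul_shape hi, sub_mul, smul_one_mul, smul_mul_assoc,
        ← h.fcalc_id hy hi hκ (hQ y hy), h.fcalc_mul hy hi hκ (hQ y hy), focalInv]
    rw [sub_sub_cancel]
    refine (smul_right_injective _ (hw y hy)) ?_
    simp only
    rw [← smul_mul_assoc, h.w_smul_fderiv_focal hy hi hκ (hQ y hy), hZ, smul_mul_assoc,
      mul_smul_comm, mul_assoc, ← mul_assoc _ (resolv u q y), mul_resolv hi, one_mul,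
      h.fcalc_mul hy hi hκ (hQ y hy)]
    rfl
  refine
    { isOpen := h.isOpen
      convex := hΩ
      contDiffOn := (contDiffOn_const.smul h.contDiffOn_p).add h.contDiffOn_q
      contDiffOn_P := fun y hy => (contDiffAt_const.sub
        (h.contDiffAt_fcalc hy (hinv y hy) _)).contDiffWithinAt
      continuousOn_Z := fun y hy => ?_
      symm := hsymm
      symm_P := hsymmP
      fderiv_mul_P := fun y hy => ?_
      Z_mul_fderiv := fun y hy => ?_
      fderiv_mul_Z := hHZ
      Z_mul_P := fun y hy => ?_
      P_mul_P := fun y hy => ?_ }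
  · have hi := hinv y hy
    exact (((h.contDiffAt_w hy).smul (h.contDiffAt_fcalc hy hi _)).sub
      ((h.contDiffAt_u hy).smul (h.contDiffAt_fcalc hy hi _))).continuousAt.continuousWithinAt
  · have hi := hinv y hy
    refine (smul_right_injective _ (hw y hy)) ?_
    simp only
    have hc : Commute (1 - u y • fderiv ℝ q y) (fcalc u w p q κ (indNe κ i) y) :=
      (Commute.one_left _).sub_left ((h.commute_fderiv_fcalc hy hi _).smul_left _)
    rw [← smul_mul_assoc, h.w_smul_fderiv_focal hy hi hκ (hQ y hy), mul_sub, mul_one, mul_assoc,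
      hc.eq, ← mul_assoc, h.fcalc_mul hy hi hκ (hQ y hy), sub_mul_indNe, sub_self, smul_zero]
  -- Transpose of the previous identity: both factors and the projection are symmetric.
  · ext a
    refine ext_inner_right ℝ fun b => ?_
    rw [mul_apply_eq_comp, hsymmZ y hy, hsymm y hy, ← mul_apply_eq_comp, hHZ y hy]
    simp [inner_sub_left, inner_sub_right, h.fcalc_symm hy (hinv y hy)]
  · have hi := hinv y hy
    rw [focalInv, mul_sub, mul_one, sub_mul, smul_mul_assoc, smul_mul_assoc,
      h.fcalc_mul hy hi hκ (hQ y hy), h.fcalc_mul hy hi hκ (hQ y hy), mul_assoc, inv_mul_indNe,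
      sub_self]
  · have hi := hinv y hy
    rw [mul_sub, sub_mul, sub_mul, h.fcalc_mul hy hi hκ (hQ y hy), indNe_mul_self]
    simp

/-- The values of `cot (θ_j - θ_i)`, where `κ j = cot θ_j`. -/
noncomputable def cotSub (κ : ι → ℝ) (i j : ι) : ℝ := (1 + κ i * κ j) / (κ i - κ j)

/-- The spectrum of the shape operators of the focal submanifold of `κ i` is symmetric: the traces
of their odd powers vanish. -/
theorem trace_fcalc_cotSub_pow {y e : E} (hy : y ∈ Ω) (hyN : y ∈ N) (i : ι) (he0 : e ≠ 0)
    (he : e ∈ tang N y) (hei : shape u w q y e = κ i • e) {l : ℕ} (hl : Odd l) :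
    traceCLM E (fcalc u w p q κ (fun j => cotSub κ i j ^ l) y) = 0 := by
  have hR := h.constantRankGradient_focal hΩ hinv hκ hQ i
  have hi := hinv y hy
  obtain ⟨δ, hδ, hball⟩ : ∃ δ : ℝ, δ > 0 ∧ y + δ • e ∈ Ω := by
    have hc : Tendsto (fun δ : ℝ => y + δ • e) (𝓝[>] 0) (𝓝 y) := by
      have : Continuous fun δ : ℝ => y + δ • e := by fun_prop
      simpa using (this.tendsto 0).mono_left nhdsWithin_le_nhds
    obtain ⟨δ, hδ, hδ0⟩ := ((hc.eventually (h.eventually_mem hy)).and self_mem_nhdsWithin).exists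
    exact ⟨δ, hδ0, hδ⟩
  set v := δ • e with hv
  have hv0 : v ≠ 0 := smul_ne_zero hδ.ne' he0
  have hvt : v ∈ tang N y := Submodule.smul_mem _ _ he
  obtain ⟨hpv, hqv⟩ := (h.mem_tang_iff hy hyN v).1 hvt
  have hvi : shape u w q y v = κ i • v := by rw [hv, map_smul, hei, smul_comm]
  have hPv : (1 - fcalc u w p q κ (indNe κ i) y) v = v := by
    have h1 : ∀ f : ℝ[X], aeval (shape u w q y) f v = f.eval (κ i) • v := by
      intro f
      induction f using Polynomial.induction_on' with
      | add f g hf hg => simp [hf, hg, add_smul]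
      | monomial m c =>
        have h2 : ∀ m : ℕ, (shape u w q y ^ m) v = κ i ^ m • v := by
          intro m
          induction m with
          | zero => simp
          | succ m ih => rw [pow_succ, mul_apply_eq_comp, hvi, map_smul, ih, smul_smul, pow_succ']
        rw [aeval_monomial, Algebra.algebraMap_eq_smul_one, smul_one_mul, smul_apply, h2,
          eval_monomial, smul_smul]
    have h2 : fcalc u w p q κ (indNe κ i) y v = 0 := by
      rw [fcalc, mul_apply_eq_comp, h.tproj_of_mem_tang hy hyN hvt, h1, eval_interpolate hκ]
      simp [indNe]
    simp [h2]
  obtain ⟨Z₁, hZ₁⟩ := hR.exists_Z_affine hy hball hPv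
  set c := traceCLM E (fcalc u w p q κ (fun j => cotSub κ i j ^ l) y) with hc
  -- The affine family $\kappa_i(1-P)-(1+\kappa_i^2)Z(t)$, chosen so that on the segment it becomes
  -- a scalar multiple of the operator with eigenvalues $\cot(\theta_j-\theta_i)$.
  obtain ⟨R, hRt⟩ := exists_trace_affine_pow
    (κ i • fcalc u w p q κ (indNe κ i) y - (1 + κ i ^ 2) • focalInv u w p q κ i y)
    (-((1 + κ i ^ 2) • Z₁)) l 1
  have hl0 : l ≠ 0 := by rintro rfl; simp at hl
  have key : ∀ t ∈ Set.Icc (0 : ℝ) 1,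
      (κ i * u (y + t • v) - w (y + t • v)) ^ 2 = 1 + (1 + κ i ^ 2) * ‖v‖ ^ 2 * t ^ 2 ∧
      R.eval t = (κ i * u (y + t • v) - w (y + t • v)) ^ l * c := by
    intro t ht
    have hmem := hR.add_smul_mem hy hball ht
    set z := y + t • v with hz
    have hiz := hinv z hmem
    obtain ⟨hZ, hP⟩ := hZ₁ t ht
    have hΦ : κ i • p z + q z = κ i • p y + q y :=
      hR.apply_add hy hmem (by rw [map_smul, hPv])
    have hyy := h.p_eq_self hy hyN
    -- The height $\langle\Phi,z\rangle$ is constant: $\Phi$ does not change along the segment and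
    -- is orthogonal to $v$. With $w^2+u^2=1+t^2|v|^2$ this determines $(\kappa_iu-w)^2$.
    have hheight : κ i * w z + u z = κ i := by
      have h1 : ⟪κ i • p z + q z, z⟫ = κ i * w z + u z := by
        have h2 : ⟪κ i • p z + q z, z⟫ = ⟪κ i • p z + q z, w z • p z + u z • q z⟫ := by
          rw [← h.decomp z hmem]
        rw [h2]
        simp [inner_add_left, inner_add_right, real_inner_smul_left, real_inner_smul_right,
          h.norm_p hmem, h.norm_q hmem, h.inner_pq z hmem, real_inner_comm (p z) (q z)]
        ring
      have hqy : ⟪q y, y⟫ = 0 := by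
        rw [← hyy, hyy, real_inner_comm]
        nth_rewrite 1 [← hyy]
        exact h.inner_pq y hy
      have hpy : ⟪p y, y⟫ = 1 := by
        nth_rewrite 2 [← hyy]
        exact h.inner_pp y hy
      rw [← h1, hΦ, hz]
      simp [inner_add_left, inner_add_right, real_inner_smul_left, real_inner_smul_right,
        hpv, hqv, hqy, hpy]
    have hnorm : w z ^ 2 + u z ^ 2 = 1 + t ^ 2 * ‖v‖ ^ 2 := by
      rw [← h.norm_sq_eq hmem, hz]
      have h3 : ⟪y, t • v⟫ = 0 := by
        rw [real_inner_smul_right]; nth_rewrite 1 [← hyy]; rw [hpv, mul_zero]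
      rw [norm_add_sq_real, h3, ((h.mem_iff y hy).1 hyN).1, norm_smul]
      simp [mul_pow]
    refine ⟨?_, ?_⟩
    · have : κ i * u z - w z = κ i * u z - w z := rfl
      have h4 : (κ i * u z - w z) ^ 2 + (κ i * w z + u z) ^ 2 =
          (1 + κ i ^ 2) * (w z ^ 2 + u z ^ 2) := by ring
      rw [hheight, hnorm] at h4
      linarith
    · rw [← hRt t, one_mul]
      -- Replacing the scalar $\kappa_i$ by $\kappa_iw+u$, the eigenvalue for $\kappa_j\ne\kappa_i$
      -- is
      -- $\bigl[(\kappa_iw+u)(\kappa_i-\kappa_j)-(1+\kappa_i^2)(w-u\kappa_j)\bigr]/(\kappa_i-\kappa_j)$,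
      -- whose numerator equals $(\kappa_iu-w)(1+\kappa_i\kappa_j)$.
      have hY : κ i • fcalc u w p q κ (indNe κ i) y - (1 + κ i ^ 2) • focalInv u w p q κ i y +
          t • -((1 + κ i ^ 2) • Z₁) =
          (κ i * u z - w z) • fcalc u w p q κ (fun j => cotSub κ i j) z := by
        have h5 : κ i • fcalc u w p q κ (indNe κ i) y - (1 + κ i ^ 2) • focalInv u w p q κ i y +
          t • -((1 + κ i ^ 2) • Z₁) =
          κ i • fcalc u w p q κ (indNe κ i) z - (1 + κ i ^ 2) • focalInv u w p q κ i z := by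
          rw [hZ, sub_right_inj.1 hP, smul_add, smul_neg, smul_comm t]
          abel
        rw [h5, focalInv]
        simp only [← fcalc_smul, ← fcalc_sub]
        congr 1
        ext j
        simp only [Pi.sub_apply, Pi.smul_apply, Pi.mul_apply, smul_eq_mul, indNe, cotSub]
        rw [div_eq_mul_inv]
        have : κ i * ((κ i - κ j) * (κ i - κ j)⁻¹) =
            (κ i * w z + u z) * ((κ i - κ j) * (κ i - κ j)⁻¹) := by rw [hheight]
        rw [this]
        ring
      rw [hY, _root_.smul_pow, h.fcalc_pow hmem hiz hκ (hQ z hmem) _ hl0, map_smul, smul_eq_mul, hc,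
        h.trace_fcalc_eq hΩ hinv hκ hQ _ hy hmem]
      rfl
  exact eq_zero_of_eval_eq_mul_odd_pow (μ := (1 + κ i ^ 2) * ‖v‖ ^ 2) (by positivity) hl
    (fun t ht => (key t ht).1) fun t ht => (key t ht).2

end Global

end EikonalPair

/-! ### Gradient and Laplacian on the sphere through radial extension -/

section Sphere

variable {E : Type*} [NormedAddCommGroup E] [InnerProductSpace ℝ E] [FiniteDimensional ℝ E]

theorem traceCLM_mul_starProjection {ι : Type*} [Fintype ι] {V : Submodule ℝ E}
    (b : OrthonormalBasis ι ℝ V) (L : E →L[ℝ] E) :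
    ∑ i, ⟪L (b i), (b i : E)⟫ = traceCLM E (L * V.starProjection) := by
  classical
  have h1 : traceCLM E (L * V.starProjection) = LinearMap.trace ℝ V
      ((V.orthogonalProjectionOnto.toLinearMap) ∘ₗ (L.toLinearMap ∘ₗ V.subtype)) := by
    rw [LinearMap.trace_comp_comm', traceCLM_apply]
    rfl
  rw [h1, LinearMap.trace_eq_sum_inner _ b]
  refine Finset.sum_congr rfl fun i _ => ?_
  simp only [LinearMap.comp_apply, Submodule.subtype_apply, ContinuousLinearMap.coe_coe]
  rw [real_inner_comm, ← Submodule.inner_orthogonalProjectionOnto_eq_of_mem_left]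

theorem mem_tang_sphere_iff {x : E} (hx : x ∈ Metric.sphere (0 : E) 1) (a : E) :
    a ∈ tang (Metric.sphere (0 : E) 1) x ↔ ⟪x, a⟫ = 0 := by
  have hx1 : ‖x‖ = 1 := by simpa using hx
  have hd : HasStrictFDerivAt (fun z : E => ‖z‖ ^ 2 - 1) ((2 : ℕ) • innerSL ℝ x) x :=
    (hasStrictFDerivAt_norm_sq x).sub_const 1
  have hsurj : Function.Surjective ((2 : ℕ) • innerSL ℝ x) := by
    intro s
    refine ⟨(s / 2) • x, ?_⟩
    simp [real_inner_smul_right, hx1]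
  rw [tang_eq_ker hx hd hsurj]
  · simp
  · refine Eventually.of_forall fun z => ?_
    simp only [mem_sphere_iff_norm, sub_zero, sub_eq_zero]
    have := norm_nonneg z
    constructor
    · intro hh; rw [hh]; norm_num
    · intro hh; nlinarith

theorem proj_sphere {x : E} (hx : x ∈ Metric.sphere (0 : E) 1) (a : E) :
    proj (Metric.sphere (0 : E) 1) x a = a - ⟪x, a⟫ • x := by
  have hx1 : ‖x‖ = 1 := by simpa using hx
  refine Submodule.eq_starProjection_of_mem_of_inner_eq_zero
    (K := tang (Metric.sphere (0 : E) 1) x) ?_ ?_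
  · rw [mem_tang_sphere_iff hx]
    simp [inner_sub_right, real_inner_smul_right, hx1]
  · intro b hb
    rw [mem_tang_sphere_iff hx] at hb
    simp [real_inner_smul_left, hb]

/-- The extension of a function on the unit sphere that is constant along rays. -/
noncomputable def radialExt (f : E → ℝ) (y : E) : ℝ := f (‖y‖⁻¹ • y)

theorem radialExt_of_mem {f : E → ℝ} {x : E} (hx : x ∈ Metric.sphere (0 : E) 1) :
    radialExt f x = f x := by
  have hx1 : ‖x‖ = 1 := by simpa using hx
  simp [radialExt, hx1]

theorem radialExt_smul (f : E → ℝ) {t : ℝ} (ht : 0 < t) (y : E) :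
    radialExt f (t • y) = radialExt f y := by
  rw [radialExt, radialExt, norm_smul, Real.norm_of_nonneg ht.le, smul_smul, mul_inv, mul_comm t⁻¹,
    mul_assoc, inv_mul_cancel₀ ht.ne', mul_one]

theorem contDiffAt_inv_norm_smul {y : E} (hy : y ≠ 0) :
    ContDiffAt ℝ ∞ (fun z : E => ‖z‖⁻¹ • z) y :=
  ((contDiffAt_norm ℝ hy).inv (norm_ne_zero_iff.2 hy)).smul contDiffAt_id

variable {f : E → ℝ} (hf : ContDiff ℝ ∞ f)
include hf

theorem contDiffAt_radialExt {y : E} (hy : y ≠ 0) : ContDiffAt ℝ ∞ (radialExt f) y :=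
  hf.contDiffAt.comp y (contDiffAt_inv_norm_smul hy)

theorem hasFDerivAt_radialExt {y : E} (hy : y ≠ 0) :
    HasFDerivAt (radialExt f) (fderiv ℝ (radialExt f) y) y :=
  ((contDiffAt_radialExt hf hy).differentiableAt (by simp)).hasFDerivAt

theorem contDiffAt_gradient_radialExt {y : E} (hy : y ≠ 0) :
    ContDiffAt ℝ ∞ (gradient (radialExt f)) y :=
  ((InnerProductSpace.toDual ℝ E).symm.toContinuousLinearEquiv.toContinuousLinearMap :
    (E →L[ℝ] ℝ) →L[ℝ] E).contDiff.contDiffAt.comp y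
    ((contDiffAt_radialExt hf hy).fderiv_right (m := ∞) (by simp))

theorem hasFDerivAt_gradient_radialExt {y : E} (hy : y ≠ 0) :
    HasFDerivAt (gradient (radialExt f)) (fderiv ℝ (gradient (radialExt f)) y) y :=
  ((contDiffAt_gradient_radialExt hf hy).differentiableAt (by simp)).hasFDerivAt

theorem fderiv_radialExt_self {y : E} (hy : y ≠ 0) : fderiv ℝ (radialExt f) y y = 0 := by
  have h1 : HasDerivAt (fun t : ℝ => t • y) y 1 := by
    simpa using (hasDerivAt_id (1 : ℝ)).smul_const y
  have h2 : HasFDerivAt (radialExt f) (fderiv ℝ (radialExt f) y) ((1 : ℝ) • y) := by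
    simpa using hasFDerivAt_radialExt hf hy
  have h3 : HasDerivAt (fun t : ℝ => radialExt f (t • y)) (fderiv ℝ (radialExt f) y y) 1 :=
    HasFDerivAt.comp_hasDerivAt (l := radialExt f) (1 : ℝ) h2 h1
  have h4 : (fun t : ℝ => radialExt f (t • y)) =ᶠ[𝓝 1] fun _ => radialExt f y := by
    filter_upwards [lt_mem_nhds (zero_lt_one (α := ℝ))] with t ht using radialExt_smul f ht y
  exact h3.unique ((hasDerivAt_const (1 : ℝ) _).congr_of_eventuallyEq h4)

theorem inner_gradient_radialExt_self {y : E} (hy : y ≠ 0) :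
    ⟪gradient (radialExt f) y, y⟫ = 0 := by
  rw [inner_gradient_left, fderiv_radialExt_self hf hy]

theorem gradient_radialExt_smul {t : ℝ} (ht : 0 < t) {y : E} (hy : y ≠ 0) :
    gradient (radialExt f) y = t • gradient (radialExt f) (t • y) := by
  have hty : t • y ≠ 0 := smul_ne_zero ht.ne' hy
  have h1 : HasFDerivAt (fun z : E => t • z) (t • ContinuousLinearMap.id ℝ E) y :=
    (hasFDerivAt_id y).const_smul t
  have h2 : HasFDerivAt (fun z => radialExt f (t • z)) _ y :=
    (hasFDerivAt_radialExt hf hty).comp y h1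
  have h3 : (fun z => radialExt f (t • z)) = radialExt f := by
    ext z; exact radialExt_smul f ht z
  rw [h3] at h2
  refine ext_inner_right ℝ fun a => ?_
  rw [inner_gradient_left, real_inner_smul_left, inner_gradient_left, h2.fderiv]
  simp

theorem fderiv_gradient_radialExt_smul {t : ℝ} (ht : 0 < t) {y : E} (hy : y ≠ 0) :
    fderiv ℝ (gradient (radialExt f)) y =
      t ^ 2 • fderiv ℝ (gradient (radialExt f)) (t • y) := by
  have hty : t • y ≠ 0 := smul_ne_zero ht.ne' hy
  have h1 : HasFDerivAt (fun z : E => t • z) (t • ContinuousLinearMap.id ℝ E) y :=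
    (hasFDerivAt_id y).const_smul t
  have h2 : HasFDerivAt (fun z => t • gradient (radialExt f) (t • z)) _ y :=
    ((hasFDerivAt_gradient_radialExt hf hty).comp y h1).const_smul t
  have h3 : gradient (radialExt f) =ᶠ[𝓝 y] fun z => t • gradient (radialExt f) (t • z) := by
    filter_upwards [isOpen_ne.mem_nhds hy] with z hz using gradient_radialExt_smul hf ht hz
  rw [(h2.congr_of_eventuallyEq h3).fderiv]
  ext a
  simp [smul_smul, sq]

theorem grad_sphere_eq {x : E} (hx : x ∈ Metric.sphere (0 : E) 1) :
    grad (Metric.sphere (0 : E) 1) f x = gradient (radialExt f) x := by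
  have hx1 : ‖x‖ = 1 := by simpa using hx
  have hx0 : x ≠ 0 := by rintro rfl; simp at hx1
  refine ext_inner_right ℝ fun a => ?_
  have h1 : proj (Metric.sphere (0 : E) 1) x a ∈ tang (Metric.sphere (0 : E) 1) x :=
    Submodule.starProjection_apply_mem _ _
  have h2 := fderivWithin_apply_of_mem_tang (V := f) hx (hasFDerivAt_radialExt hf hx0)
    (Eventually.of_forall fun z hz => (radialExt_of_mem hz).symm) h1
  rw [grad, proj, Submodule.inner_starProjection_left_eq_right, ← proj,
    InnerProductSpace.toDual_symm_apply, h2, proj_sphere hx, map_sub, map_smul,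
    fderiv_radialExt_self hf hx0, inner_gradient_left]
  simp

/-- The tangential trace equals the full one because the Hessian of the radial extension vanishes on
$(x,x)$: differentiate $\langle\nabla g(z),z\rangle=0$ in the direction $x$. -/
theorem laplacian_sphere_eq {x : E} (hx : x ∈ Metric.sphere (0 : E) 1) :
    laplacian (Metric.sphere (0 : E) 1) f x =
      traceCLM E (fderiv ℝ (gradient (radialExt f)) x) := by
  have hx1 : ‖x‖ = 1 := by simpa using hx
  have hx0 : x ≠ 0 := by rintro rfl; simp at hx1
  have h1 : ∀ i, fderivWithin ℝ (grad (Metric.sphere (0 : E) 1) f) (Metric.sphere (0 : E) 1) x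
      (stdOrthonormalBasis ℝ (tang (Metric.sphere (0 : E) 1) x) i) =
      fderiv ℝ (gradient (radialExt f)) x
        (stdOrthonormalBasis ℝ (tang (Metric.sphere (0 : E) 1) x) i) := fun i =>
    fderivWithin_apply_of_mem_tang hx (hasFDerivAt_gradient_radialExt hf hx0)
      (Eventually.of_forall fun z hz => grad_sphere_eq hf hz) (Subtype.coe_prop _)
  have h2 : ⟪fderiv ℝ (gradient (radialExt f)) x x, x⟫ = 0 := by
    have h3 := (hasFDerivAt_gradient_radialExt hf hx0).inner ℝ (hasFDerivAt_id (𝕜 := ℝ) x)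
    have h4 : HasFDerivAt (fun z => ⟪gradient (radialExt f) z, z⟫) (0 : E →L[ℝ] ℝ) x := by
      refine (hasFDerivAt_const (0 : ℝ) x).congr_of_eventuallyEq ?_
      filter_upwards [isOpen_ne.mem_nhds hx0] with z hz using inner_gradient_radialExt_self hf hz
    have h5 := congrArg (fun L : E →L[ℝ] ℝ => L x) (h3.unique h4)
    simpa [fderivInnerCLM_apply, inner_gradient_radialExt_self hf hx0] using h5
  have h6 : (tang (Metric.sphere (0 : E) 1) x).starProjection =
      1 - (innerSL ℝ x).smulRight x := by
    ext a
    exact (proj_sphere hx a).trans (by simp)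
  rw [laplacian]
  simp only [h1]
  rw [traceCLM_mul_starProjection, h6, mul_sub, mul_one, map_sub, traceCLM_mul_comm]
  have h7 : (innerSL ℝ x).smulRight x * fderiv ℝ (gradient (radialExt f)) x =
      ((innerSL ℝ x).comp (fderiv ℝ (gradient (radialExt f)) x)).smulRight x := by
    ext a; simp
  rw [h7, traceCLM_smulRight]
  rw [real_inner_comm] at h2
  simp [h2]

theorem norm_gradient_radialExt_sq {b : ℝ → ℝ}
    (hb : ∀ x ∈ Metric.sphere (0 : E) 1, ‖grad (Metric.sphere (0 : E) 1) f x‖ ^ 2 = b (f x))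
    {y : E} (hy : y ≠ 0) :
    ‖y‖ ^ 2 * ‖gradient (radialExt f) y‖ ^ 2 = b (radialExt f y) := by
  have hy0 : 0 < ‖y‖ := norm_pos_iff.2 hy
  have hmem : ‖y‖⁻¹ • y ∈ Metric.sphere (0 : E) 1 := by simp [norm_smul, hy0.ne']
  have h1 := hb _ hmem
  rw [grad_sphere_eq hf hmem] at h1
  rw [radialExt, ← h1, gradient_radialExt_smul hf (inv_pos.2 hy0) hy, norm_smul, mul_pow]
  simp
  field_simp

theorem trace_gradient_radialExt {a : ℝ → ℝ}
    (ha : ∀ x ∈ Metric.sphere (0 : E) 1, laplacian (Metric.sphere (0 : E) 1) f x = a (f x))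
    {y : E} (hy : y ≠ 0) :
    ‖y‖ ^ 2 * traceCLM E (fderiv ℝ (gradient (radialExt f)) y) = a (radialExt f y) := by
  have hy0 : 0 < ‖y‖ := norm_pos_iff.2 hy
  have hmem : ‖y‖⁻¹ • y ∈ Metric.sphere (0 : E) 1 := by simp [norm_smul, hy0.ne']
  have h1 := ha _ hmem
  rw [laplacian_sphere_eq hf hmem] at h1
  rw [radialExt, ← h1, fderiv_gradient_radialExt_smul hf (inv_pos.2 hy0) hy, map_smul]
  simp
  field_simp

end Sphere

/-! ### Construction of the eikonal pair from an isoparametric function -/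

/-- A local primitive of `1 / √b` near a point where `b` is positive. -/
theorem exists_arclength {b : ℝ → ℝ} (hb : ContDiff ℝ ∞ b) {c : ℝ} (hc : 0 < b c) :
    ∃ (δ : ℝ) (r : ℝ → ℝ), 0 < δ ∧ r c = 0 ∧ ContDiffOn ℝ ∞ r (Set.Ioo (c - δ) (c + δ)) ∧
      ∀ t ∈ Set.Ioo (c - δ) (c + δ), 0 < b t ∧ HasDerivAt r (√(b t))⁻¹ t := by
  obtain ⟨δ, hδ, hball⟩ := Metric.eventually_nhds_iff.1
    (hb.continuous.continuousAt.eventually (lt_mem_nhds hc))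
  have hpos : ∀ t ∈ Set.Ioo (c - δ) (c + δ), 0 < b t := fun t ht => hball (by
    rw [Real.dist_eq, abs_lt]; constructor <;> linarith [ht.1, ht.2])
  have hsm : ContDiffOn ℝ ∞ (fun t => (√(b t))⁻¹) (Set.Ioo (c - δ) (c + δ)) := fun t ht =>
    ((hb.contDiffAt.sqrt (hpos t ht).ne').inv
      (Real.sqrt_ne_zero'.2 (hpos t ht))).contDiffWithinAt
  have hcm : c ∈ Set.Ioo (c - δ) (c + δ) := ⟨by linarith, by linarith⟩
  have hder : ∀ t ∈ Set.Ioo (c - δ) (c + δ),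
      HasDerivAt (fun t => ∫ s in c..t, (√(b s))⁻¹) (√(b t))⁻¹ t := by
    intro t ht
    have hcont : ContinuousOn (fun t => (√(b t))⁻¹) (Set.Ioo (c - δ) (c + δ)) := hsm.continuousOn
    refine intervalIntegral.integral_hasDerivAt_right ?_ ?_
      (hcont.continuousAt (isOpen_Ioo.mem_nhds ht))
    · exact (hcont.mono (Set.ordConnected_Ioo.uIcc_subset hcm ht)).intervalIntegrable
    · exact hcont.stronglyMeasurableAtFilter isOpen_Ioo t ht
  refine ⟨δ, fun t => ∫ s in c..t, (√(b s))⁻¹, hδ, by simp, ?_, fun t ht =>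
    ⟨hpos t ht, hder t ht⟩⟩
  rw [contDiffOn_infty_iff_deriv_of_isOpen isOpen_Ioo]
  exact ⟨fun t ht => (hder t ht).differentiableAt.differentiableWithinAt,
    hsm.congr fun t ht => (hder t ht).deriv⟩

section Pair

variable {E : Type*} [NormedAddCommGroup E] [InnerProductSpace ℝ E] [FiniteDimensional ℝ E]

/-- The gradient of `y ↦ φ (g y) ‖y‖`, where `g` is the radial extension of `f` and `φ₁` is the
derivative of `φ`. -/
noncomputable def coneGrad (f : E → ℝ) (φ φ₁ : ℝ → ℝ) (y : E) : E :=
  (φ₁ (radialExt f y) * ‖y‖) • gradient (radialExt f) y + (φ (radialExt f y) * ‖y‖⁻¹) • y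

variable {f : E → ℝ} (hf : ContDiff ℝ ∞ f) {y : E} (hy : y ≠ 0)
include hf hy

theorem hasFDerivAt_radialExt' :
    HasFDerivAt (radialExt f) (innerSL ℝ (gradient (radialExt f) y)) y := by
  convert hasFDerivAt_radialExt hf hy using 1
  ext v
  simp [inner_gradient_left]

theorem hasFDerivAt_comp_radialExt {φ : ℝ → ℝ} {d : ℝ} (hφ : HasDerivAt φ d (radialExt f y)) :
    HasFDerivAt (fun z => φ (radialExt f z)) (d • innerSL ℝ (gradient (radialExt f) y)) y :=
  hφ.comp_hasFDerivAt y (hasFDerivAt_radialExt' hf hy)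

omit hf [FiniteDimensional ℝ E] in
theorem hasFDerivAt_norm_of_ne : HasFDerivAt (fun z : E => ‖z‖) (innerSL ℝ (‖y‖⁻¹ • y)) y := by
  have h1 : HasFDerivAt (fun z : E => √(‖z‖ ^ 2)) _ y :=
    (hasStrictFDerivAt_norm_sq y).hasFDerivAt.sqrt (pow_ne_zero 2 (norm_ne_zero_iff.2 hy))
  have h2 : (fun z : E => √(‖z‖ ^ 2)) = fun z => ‖z‖ := by
    ext z; exact Real.sqrt_sq (norm_nonneg z)
  rw [h2] at h1
  convert h1 using 1
  ext v
  have h3 := norm_ne_zero_iff.2 hy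
  simp [Real.sqrt_sq (norm_nonneg y), real_inner_smul_left]
  field_simp

theorem hasFDerivAt_cone {φ : ℝ → ℝ} {d : ℝ} (hφ : HasDerivAt φ d (radialExt f y)) :
    HasFDerivAt (fun z => φ (radialExt f z) * ‖z‖)
      (innerSL ℝ ((d * ‖y‖) • gradient (radialExt f) y + (φ (radialExt f y) * ‖y‖⁻¹) • y)) y := by
  have h1 : HasFDerivAt (fun z => φ (radialExt f z) * ‖z‖) _ y :=
    (hasFDerivAt_comp_radialExt hf hy hφ).mul (hasFDerivAt_norm_of_ne hy)
  refine h1.congr_fderiv ?_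
  ext v
  simp [inner_add_left, real_inner_smul_left]
  ring

theorem hasFDerivAt_div_norm {φ : ℝ → ℝ} {d : ℝ} (hφ : HasDerivAt φ d (radialExt f y)) :
    HasFDerivAt (fun z => φ (radialExt f z) * ‖z‖⁻¹)
      (innerSL ℝ ((d * ‖y‖⁻¹) • gradient (radialExt f) y -
        (φ (radialExt f y) * (‖y‖⁻¹) ^ 3) • y)) y := by
  have h0 := norm_ne_zero_iff.2 hy
  have h1 : HasFDerivAt (fun z => φ (radialExt f z) * ‖z‖⁻¹) _ y :=
    (hasFDerivAt_comp_radialExt hf hy hφ).mul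
      ((hasDerivAt_inv h0).comp_hasFDerivAt y (hasFDerivAt_norm_of_ne hy))
  refine h1.congr_fderiv ?_
  ext v
  simp [inner_sub_left, real_inner_smul_left]
  ring

theorem contDiffAt_coneGrad {φ φ₁ : ℝ → ℝ} (hφ : ContDiffAt ℝ ∞ φ (radialExt f y))
    (hφ₁ : ContDiffAt ℝ ∞ φ₁ (radialExt f y)) : ContDiffAt ℝ ∞ (coneGrad f φ φ₁) y := by
  have hg := contDiffAt_radialExt hf hy
  have hn := contDiffAt_norm ℝ hy (n := ∞)
  have h1 : ContDiffAt ℝ ∞ (fun z => φ (radialExt f z)) y := hφ.comp y hg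
  have h2 : ContDiffAt ℝ ∞ (fun z => φ₁ (radialExt f z)) y := hφ₁.comp y hg
  exact ((h2.mul hn).smul (contDiffAt_gradient_radialExt hf hy)).add
    ((h1.mul (hn.inv (norm_ne_zero_iff.2 hy))).smul contDiffAt_id)

theorem inner_coneGrad {b : ℝ → ℝ}
    (hb : ∀ x ∈ Metric.sphere (0 : E) 1, ‖grad (Metric.sphere (0 : E) 1) f x‖ ^ 2 = b (f x))
    (φ φ₁ ψ ψ₁ : ℝ → ℝ) : ⟪coneGrad f φ φ₁ y, coneGrad f ψ ψ₁ y⟫ =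
      φ₁ (radialExt f y) * ψ₁ (radialExt f y) * b (radialExt f y) +
        φ (radialExt f y) * ψ (radialExt f y) := by
  have h0 := norm_ne_zero_iff.2 hy
  rw [← norm_gradient_radialExt_sq hf hb hy]
  have h1 := inner_gradient_radialExt_self hf hy
  have h2 := h1
  rw [real_inner_comm] at h2
  simp only [coneGrad, inner_add_left, inner_add_right, real_inner_smul_left,
    real_inner_smul_right, h1, h2, real_inner_self_eq_norm_sq]
  field_simp
  ring

theorem trace_fderiv_coneGrad {a b φ φ₁ : ℝ → ℝ} {φ₂ : ℝ}
    (hb : ∀ x ∈ Metric.sphere (0 : E) 1, ‖grad (Metric.sphere (0 : E) 1) f x‖ ^ 2 = b (f x))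
    (ha : ∀ x ∈ Metric.sphere (0 : E) 1, laplacian (Metric.sphere (0 : E) 1) f x = a (f x))
    (hφ : HasDerivAt φ (φ₁ (radialExt f y)) (radialExt f y))
    (hφ₁ : HasDerivAt φ₁ φ₂ (radialExt f y)) :
    traceCLM E (fderiv ℝ (coneGrad f φ φ₁) y) =
      (φ₂ * b (radialExt f y) + φ₁ (radialExt f y) * a (radialExt f y) +
        (finrank ℝ E - 1) * φ (radialExt f y)) * ‖y‖⁻¹ := by
  have h0 := norm_ne_zero_iff.2 hy
  have h1 : HasFDerivAt (coneGrad f φ φ₁) _ y :=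
    ((hasFDerivAt_cone hf hy hφ₁).smul (hasFDerivAt_gradient_radialExt hf hy)).add
      ((hasFDerivAt_div_norm hf hy hφ).smul (hasFDerivAt_id y))
  have h2 := inner_gradient_radialExt_self hf hy
  have h3 := h2
  rw [real_inner_comm] at h3
  rw [h1.fderiv, ← norm_gradient_radialExt_sq hf hb hy, ← trace_gradient_radialExt hf ha hy]
  simp only [map_add, map_smul, traceCLM_smulRight]
  have h4 : traceCLM E (ContinuousLinearMap.id ℝ E) = finrank ℝ E := traceCLM_one
  simp only [innerSL_apply_apply, inner_add_left, inner_sub_left, real_inner_smul_left, h2, h3,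
    real_inner_self_eq_norm_sq, h4, smul_eq_mul]
  field_simp
  simp [h4, fderiv_radialExt_self hf hy]
  ring

end Pair

namespace EikonalPair

variable {E : Type*} [NormedAddCommGroup E] [InnerProductSpace ℝ E] [FiniteDimensional ℝ E]

/-- Reversing the normal; needed because the prescribed unit normal may be $q$ or $-q$. -/
theorem neg {N Ω : Set E} {u w : E → ℝ} {p q : E → E} (h : EikonalPair N Ω u w p q) :
    EikonalPair N Ω (-u) w p (-q) where
  isOpen := h.isOpen
  contDiffOn_p := h.contDiffOn_p
  contDiffOn_q := h.contDiffOn_q.neg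
  hasFDerivAt_u y hy := by
    have := (h.hasFDerivAt_u y hy).neg
    simpa using this
  hasFDerivAt_w := h.hasFDerivAt_w
  inner_pp := h.inner_pp
  inner_qq y hy := by simpa using h.inner_qq y hy
  inner_pq y hy := by simpa using h.inner_pq y hy
  decomp y hy := by simpa using h.decomp y hy
  w_pos := h.w_pos
  mem_iff y hy := by simpa using h.mem_iff y hy
  trace_const y hy v hp hq := by
    have h1 := h.trace_const y hy v hp (by simpa using hq)
    have h2 : (fun z => LinearMap.trace ℝ E (fderiv ℝ (-q) z : E →ₗ[ℝ] E)) =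
        -fun z => LinearMap.trace ℝ E (fderiv ℝ q z : E →ₗ[ℝ] E) := by
      ext z
      rw [fderiv_neg]
      simp
    rw [h2, fderiv_neg]
    simp [h1]

/-- With $r'=1/\sqrt b$ the composite $r\circ f$ has unit gradient on the sphere, so $|y|\sin r$ and
$|y|\cos r$ have orthonormal gradients. The equation for $\Delta f$ is used only for the constancy
of the trace along the leaves. -/
theorem exists_of_isoparametric {f : E → ℝ} {a b : ℝ → ℝ} {c : ℝ} {y₀ : E}
    (hf : ContDiff ℝ ∞ f) (ha : ContDiff ℝ ∞ a) (hb : ContDiff ℝ ∞ b)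
    (hgrad : ∀ x ∈ Metric.sphere (0 : E) 1,
      ‖grad (Metric.sphere (0 : E) 1) f x‖ ^ 2 = b (f x))
    (hlap : ∀ x ∈ Metric.sphere (0 : E) 1, laplacian (Metric.sphere (0 : E) 1) f x = a (f x))
    (hy₀ : y₀ ∈ Metric.sphere (0 : E) 1) (hc : f y₀ = c)
    (hreg : grad (Metric.sphere (0 : E) 1) f y₀ ≠ 0) :
    ∃ (Ω : Set E) (u w : E → ℝ) (p q : E → E),
      EikonalPair {x ∈ Metric.sphere (0 : E) 1 | f x = c} Ω u w p q ∧ y₀ ∈ Ω := by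
  have hy1 : ‖y₀‖ = 1 := by simpa using hy₀
  have hy0 : y₀ ≠ 0 := by rintro rfl; simp at hy1
  have hbc : 0 < b c := by
    rw [← hc, ← hgrad _ hy₀]
    have := norm_pos_iff.2 hreg
    positivity
  obtain ⟨δ, r, hδ, hrc, hr, hrd⟩ := exists_arclength hb hbc
  set I := Set.Ioo (c - δ) (c + δ) with hI
  set β : ℝ → ℝ := fun t => (√(b t))⁻¹ with hβ
  have hIn : ∀ t ∈ I, I ∈ 𝓝 t := fun t ht => isOpen_Ioo.mem_nhds ht
  have hβs : ∀ t ∈ I, ContDiffAt ℝ ∞ β t := fun t ht =>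
    (hb.contDiffAt.sqrt (hrd t ht).1.ne').inv (Real.sqrt_ne_zero'.2 (hrd t ht).1)
  have hrs : ∀ t ∈ I, ContDiffAt ℝ ∞ r t := fun t ht => hr.contDiffAt (hIn t ht)
  have hβb : ∀ t ∈ I, β t ^ 2 * b t = 1 := fun t ht => by
    have h1 := (hrd t ht).1
    rw [hβ]
    simp only [inv_pow, Real.sq_sqrt h1.le]
    exact inv_mul_cancel₀ h1.ne'
  have hβpos : ∀ t ∈ I, 0 < β t := fun t ht => inv_pos.2 (Real.sqrt_pos.2 (hrd t ht).1)
  have hmono : StrictMonoOn r I := by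
    refine strictMonoOn_of_deriv_pos (convex_Ioo _ _) hr.continuousOn fun t ht => ?_
    rw [interior_Ioo] at ht
    rw [(hrd t ht).2.deriv]
    exact hβpos t ht
  have hcI : c ∈ I := ⟨by linarith, by linarith⟩
  have hgc : radialExt f y₀ = c := by rw [radialExt_of_mem hy₀, hc]
  have hgcont : ContinuousAt (radialExt f) y₀ := (contDiffAt_radialExt hf hy0).continuousAt
  -- The bound $|r|<1$ keeps $\cos r$ positive and makes $r=0$ the only zero of $\sin r$.
  have hev : ∀ᶠ y in 𝓝 y₀, y ≠ 0 ∧ radialExt f y ∈ I ∧ |r (radialExt f y)| < 1 := by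
    refine (isOpen_ne.eventually_mem hy0).and ((hgcont.eventually_mem (by rw [hgc]; exact hIn c hcI)).and
      ?_)
    have h1 : ContinuousAt (fun y => |r (radialExt f y)|) y₀ :=
      (ContinuousAt.comp (by rw [hgc]; exact (hrs c hcI).continuousAt) hgcont).abs
    exact h1.eventually_lt continuousAt_const (by simp [hgc, hrc])
  obtain ⟨Ω, hΩ, hΩo, hyΩ⟩ := eventually_nhds_iff.1 hev
  have hsin : ∀ t ∈ I, HasDerivAt (fun t => Real.sin (r t)) (Real.cos (r t) * β t) t :=
    fun t ht => (hrd t ht).2.sin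
  have hcos : ∀ t ∈ I, HasDerivAt (fun t => Real.cos (r t)) (-Real.sin (r t) * β t) t :=
    fun t ht => (hrd t ht).2.cos
  have hsins : ∀ t ∈ I, ContDiffAt ℝ ∞ (fun t => Real.sin (r t)) t := fun t ht => (hrs t ht).sin
  have hcoss : ∀ t ∈ I, ContDiffAt ℝ ∞ (fun t => Real.cos (r t)) t := fun t ht => (hrs t ht).cos
  have hcos1 : ∀ t ∈ I, ContDiffAt ℝ ∞ (fun t => Real.cos (r t) * β t) t :=
    fun t ht => (hcoss t ht).mul (hβs t ht)
  have hsin1 : ∀ t ∈ I, ContDiffAt ℝ ∞ (fun t => -Real.sin (r t) * β t) t :=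
    fun t ht => (hsins t ht).neg.mul (hβs t ht)
  refine ⟨Ω, fun y => Real.sin (r (radialExt f y)) * ‖y‖,
    fun y => Real.cos (r (radialExt f y)) * ‖y‖,
    coneGrad f (fun t => Real.cos (r t)) (fun t => -Real.sin (r t) * β t),
    coneGrad f (fun t => Real.sin (r t)) (fun t => Real.cos (r t) * β t), ?_, hyΩ⟩
  have hdec : ∀ y ∈ Ω, y = (Real.cos (r (radialExt f y)) * ‖y‖) •
      coneGrad f (fun t => Real.cos (r t)) (fun t => -Real.sin (r t) * β t) y +
      (Real.sin (r (radialExt f y)) * ‖y‖) •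
      coneGrad f (fun t => Real.sin (r t)) (fun t => Real.cos (r t) * β t) y := by
    intro y hy
    have h0 := norm_ne_zero_iff.2 (hΩ y hy).1
    have h1 := Real.sin_sq_add_cos_sq (r (radialExt f y))
    simp only [coneGrad]
    match_scalars
    · field_simp
      linarith
    · ring
  have hsub : ∀ y ∈ Ω, ∀ v,
      ⟪coneGrad f (fun t => Real.cos (r t)) (fun t => -Real.sin (r t) * β t) y, v⟫ = 0 →
      ⟪coneGrad f (fun t => Real.sin (r t)) (fun t => Real.cos (r t) * β t) y, v⟫ = 0 →
      ⟪gradient (radialExt f) y, v⟫ = 0 ∧ ⟪y, v⟫ = 0 := by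
    intro y hy v hp hq
    have h0 := norm_ne_zero_iff.2 (hΩ y hy).1
    have h1 : ⟪y, v⟫ = 0 := by
      rw [hdec y hy, inner_add_left, real_inner_smul_left, real_inner_smul_left, hp, hq]
      simp
    refine ⟨?_, h1⟩
    have h2 := (hβpos _ (hΩ y hy).2.1).ne'
    simp only [coneGrad, inner_add_left, real_inner_smul_left, h1, mul_zero, add_zero] at hp hq
    have h3 := Real.sin_sq_add_cos_sq (r (radialExt f y))
    have h4 : β (radialExt f y) * ‖y‖ * ⟪gradient (radialExt f) y, v⟫ = 0 := by
      linear_combination Real.cos (r (radialExt f y)) * hq - Real.sin (r (radialExt f y)) * hp -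
        (β (radialExt f y) * ‖y‖ * ⟪gradient (radialExt f) y, v⟫) * h3
    simpa [h2, h0] using h4
  refine
  { isOpen := hΩo
    contDiffOn_p := fun y hy => (contDiffAt_coneGrad hf (hΩ y hy).1 (hcoss _ (hΩ y hy).2.1)
      (hsin1 _ (hΩ y hy).2.1)).contDiffWithinAt
    contDiffOn_q := fun y hy => (contDiffAt_coneGrad hf (hΩ y hy).1 (hsins _ (hΩ y hy).2.1)
      (hcos1 _ (hΩ y hy).2.1)).contDiffWithinAt
    hasFDerivAt_u := fun y hy => hasFDerivAt_cone hf (hΩ y hy).1 (hsin _ (hΩ y hy).2.1)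
    hasFDerivAt_w := fun y hy => hasFDerivAt_cone hf (hΩ y hy).1 (hcos _ (hΩ y hy).2.1)
    inner_pp := fun y hy => ?_
    inner_qq := fun y hy => ?_
    inner_pq := fun y hy => ?_
    decomp := hdec
    w_pos := fun y hy => ?_
    mem_iff := fun y hy => ?_
    trace_const := fun y hy v hp hq => ?_ }
  · rw [inner_coneGrad hf (hΩ y hy).1 hgrad]
    linear_combination Real.sin (r (radialExt f y)) ^ 2 * hβb _ (hΩ y hy).2.1 +
      Real.sin_sq_add_cos_sq (r (radialExt f y))
  · rw [inner_coneGrad hf (hΩ y hy).1 hgrad]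
    linear_combination Real.cos (r (radialExt f y)) ^ 2 * hβb _ (hΩ y hy).2.1 +
      Real.sin_sq_add_cos_sq (r (radialExt f y))
  · rw [inner_coneGrad hf (hΩ y hy).1 hgrad]
    linear_combination -Real.sin (r (radialExt f y)) * Real.cos (r (radialExt f y)) *
      hβb _ (hΩ y hy).2.1
  · have h1 := abs_lt.1 (hΩ y hy).2.2
    have h2 := Real.pi_gt_three
    exact mul_pos (Real.cos_pos_of_mem_Ioo ⟨by linarith, by linarith⟩)
      (norm_pos_iff.2 (hΩ y hy).1)
  · have h0 := norm_ne_zero_iff.2 (hΩ y hy).1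
    have h1 := abs_lt.1 (hΩ y hy).2.2
    have h2 := Real.pi_gt_three
    have h3 : Real.sin (r (radialExt f y)) = 0 ↔ radialExt f y = c := by
      rw [Real.sin_eq_zero_iff_of_lt_of_lt (by linarith) (by linarith), ← hrc]
      exact hmono.injOn.eq_iff (hΩ y hy).2.1 hcI
    simp only [mul_eq_zero, h0, or_false, h3]
    constructor
    · rintro ⟨hs, hfy⟩
      exact ⟨by simpa using hs, by rw [radialExt_of_mem hs, hfy]⟩
    · rintro ⟨hs, hfy⟩
      have hs' : y ∈ Metric.sphere (0 : E) 1 := by simpa using hs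
      exact ⟨hs', by rw [← radialExt_of_mem (f := f) hs', hfy]⟩
  · obtain ⟨hG, hyv⟩ := hsub y hy v hp hq
    -- The Laplacian of $u$ is $\Psi(g)/|y|$. Its gradient is a combination of $\nabla g$ and $y$,
    -- hence of $p$ and $q$, and so is orthogonal to $v$.
    set Ψ : ℝ → ℝ := fun t => deriv (fun t => Real.cos (r t) * β t) t * b t +
      Real.cos (r t) * β t * a t + (finrank ℝ E - 1) * Real.sin (r t) with hΨ
    have h1 : ∀ z ∈ Ω, LinearMap.trace ℝ E (fderiv ℝ (coneGrad f (fun t => Real.sin (r t))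
        (fun t => Real.cos (r t) * β t)) z : E →ₗ[ℝ] E) = Ψ (radialExt f z) * ‖z‖⁻¹ := by
      intro z hz
      rw [← traceCLM_apply, trace_fderiv_coneGrad hf (hΩ z hz).1 hgrad hlap
        (hsin _ (hΩ z hz).2.1)
        ((hcos1 _ (hΩ z hz).2.1).differentiableAt (by simp)).hasDerivAt]
    have h2 : DifferentiableAt ℝ Ψ (radialExt f y) := by
      have h3 := (hΩ y hy).2.1
      have h4 : DifferentiableAt ℝ (deriv (fun t => Real.cos (r t) * β t)) (radialExt f y) := by
        have h5 : ContDiffAt ℝ ∞ (fun t => fderiv ℝ (fun t => Real.cos (r t) * β t) t 1)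
            (radialExt f y) :=
          ((hcos1 _ h3).fderiv_right (m := ∞) (by simp)).clm_apply contDiffAt_const
        exact h5.differentiableAt (by simp)
      exact ((h4.mul (hb.differentiable (by simp) _)).add
        (((hcos1 _ h3).differentiableAt (by simp)).mul (ha.differentiable (by simp) _))).add
        (((hsins _ h3).differentiableAt (by simp)).const_mul _)
    have h3 := hasFDerivAt_div_norm hf (hΩ y hy).1 h2.hasDerivAt
    have h4 := h3.congr_of_eventuallyEq (f₁ := fun z => LinearMap.trace ℝ E
      (fderiv ℝ (coneGrad f (fun t => Real.sin (r t)) (fun t => Real.cos (r t) * β t)) z :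
        E →ₗ[ℝ] E)) (by filter_upwards [hΩo.mem_nhds hy] with z hz using h1 z hz)
    rw [h4.fderiv]
    simp [inner_sub_left, real_inner_smul_left, hG, hyv]

/-- The orthogonal complement of the tangent space within that of the sphere is a line, so
$q=\pm\eta_0$. As $u=0$ on $N$, the operator $1-uS$ is invertible nearby, and a small ball supplies
convexity. -/
theorem exists_of_isIsoparametric {n : ℕ} {N : Set (EuclideanSpace ℝ (Fin (n + 3)))}
    (hN : IsIsoparametric N) {y₀ η₀ : EuclideanSpace ℝ (Fin (n + 3))} (hy₀ : y₀ ∈ N)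
    (hη₀ : IsUnitNormalAt N (unitSphere n) y₀ η₀) :
    ∃ (Ω : Set (EuclideanSpace ℝ (Fin (n + 3)))) (u w : EuclideanSpace ℝ (Fin (n + 3)) → ℝ)
      (p q : EuclideanSpace ℝ (Fin (n + 3)) → EuclideanSpace ℝ (Fin (n + 3))),
      EikonalPair N Ω u w p q ∧ y₀ ∈ Ω ∧ q y₀ = η₀ ∧ Convex ℝ Ω ∧
        ∀ y ∈ Ω, IsUnit (1 - u y • fderiv ℝ q y) := by
  obtain ⟨f, a, b, c, hf, ha, hb, -, hgrad, hlap, hNeq, hreg⟩ := hN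
  have hm : y₀ ∈ {x ∈ unitSphere n | f x = c} := hNeq ▸ hy₀
  obtain ⟨Ω, u, w, p, q, h, hΩ⟩ :=
    exists_of_isoparametric hf ha hb hgrad hlap hm.1 hm.2 (hreg y₀ hy₀)
  rw [← show N = {x ∈ Metric.sphere 0 1 | f x = c} from hNeq] at h
  have key : ∀ {u q}, EikonalPair N Ω u w p q → q y₀ = η₀ → ∃ (Ω : Set (EuclideanSpace ℝ (Fin (n + 3))))
      (u w : EuclideanSpace ℝ (Fin (n + 3)) → ℝ)
      (p q : EuclideanSpace ℝ (Fin (n + 3)) → EuclideanSpace ℝ (Fin (n + 3))),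
      EikonalPair N Ω u w p q ∧ y₀ ∈ Ω ∧ q y₀ = η₀ ∧ Convex ℝ Ω ∧
        ∀ y ∈ Ω, IsUnit (1 - u y • fderiv ℝ q y) := by
    intro u q h hq
    have h1 : ContinuousAt (fun y => 1 - u y • fderiv ℝ q y) y₀ :=
      continuousAt_const.sub ((h.contDiffAt_u hΩ).continuousAt.smul
        (h.contDiffAt_fderiv_q hΩ).continuousAt)
    have h2 : ∀ᶠ y in 𝓝 y₀, IsUnit (1 - u y • fderiv ℝ q y) := by
      refine h1.eventually (Units.isOpen.mem_nhds ?_)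
      have h3 : 1 - u y₀ • fderiv ℝ q y₀ = 1 := by
        ext1 v
        simp [h.u_eq_zero hΩ hy₀]
      change IsUnit (1 - u y₀ • fderiv ℝ q y₀)
      rw [h3]
      exact isUnit_one
    obtain ⟨ε, hε, hball⟩ := Metric.eventually_nhds_iff_ball.1 (h2.and (h.eventually_mem hΩ))
    exact ⟨Metric.ball y₀ ε, u, w, p, q, h.mono Metric.isOpen_ball fun z hz => (hball z hz).2,
      Metric.mem_ball_self hε, hq, convex_ball _ _, fun z hz => (hball z hz).1⟩
  have hηt := (mem_tang_sphere_iff hm.1 η₀).1 hη₀.1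
  have hort : ⟪η₀, η₀ - ⟪q y₀, η₀⟫ • q y₀⟫ = 0 := by
    refine hη₀.2.2 _ ((h.mem_tang_iff hΩ hy₀ _).2 ⟨?_, ?_⟩)
    · rw [inner_sub_right, real_inner_smul_right, h.inner_pq _ hΩ, h.p_eq_self hΩ hy₀, hηt]
      simp
    · rw [inner_sub_right, real_inner_smul_right, h.inner_qq _ hΩ, mul_one, sub_self]
  have hsq : ⟪q y₀, η₀⟫ ^ 2 = 1 := by
    rw [inner_sub_right, real_inner_smul_right, real_inner_self_eq_norm_sq, hη₀.2.1,
      real_inner_comm (q y₀) η₀] at hort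
    linarith
  have hdiff : η₀ = ⟪q y₀, η₀⟫ • q y₀ := by
    rw [← sub_eq_zero, ← inner_self_eq_zero (𝕜 := ℝ), inner_sub_left, hort,
      real_inner_smul_left, inner_sub_right, real_inner_smul_right, h.inner_qq _ hΩ, mul_one,
      sub_self, mul_zero, sub_zero]
  rcases mul_self_eq_one_iff.1 ((sq _).symm.trans hsq) with h1 | h1
  · exact key h (by rw [hdiff, h1, one_smul])
  · exact key h.neg (by rw [hdiff, h1, neg_one_smul]; rfl)

end EikonalPair

/-! ### Arithmetic of the four principal curvatures -/

/-- A positive weighting of three distinct numbers with vanishing odd moments is symmetric. -/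
theorem odd_moments_three {x y z a b c : ℝ} (hxy : y < x) (hyz : z < y) (ha : 0 < a) (hb : 0 < b)
    (hc : 0 < c) (h1 : a * x + b * y + c * z = 0) (h3 : a * x ^ 3 + b * y ^ 3 + c * z ^ 3 = 0)
    (h5 : a * x ^ 5 + b * y ^ 5 + c * z ^ 5 = 0) : y = 0 ∧ x = -z ∧ a = c ∧ 0 < x := by
  -- The combination of the moments of order $5,3,1$ with coefficients of $(t^2-y^2)(t^2-z^2)$
  -- isolates the term of $x$.
  have e1 : a * (x * ((x - y) * (x - z)) * ((x + y) * (x + z))) = 0 := by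
    linear_combination h5 - (y ^ 2 + z ^ 2) * h3 + y ^ 2 * z ^ 2 * h1
  have e2 : b * (y * ((y - x) * (y - z)) * ((y + x) * (y + z))) = 0 := by
    linear_combination h5 - (x ^ 2 + z ^ 2) * h3 + x ^ 2 * z ^ 2 * h1
  have e3 : c * (z * ((z - x) * (z - y)) * ((z + x) * (z + y))) = 0 := by
    linear_combination h5 - (x ^ 2 + y ^ 2) * h3 + x ^ 2 * y ^ 2 * h1
  have n1 : x - y ≠ 0 := ne_of_gt (by linarith)
  have n2 : x - z ≠ 0 := ne_of_gt (by linarith)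
  have n3 : y - z ≠ 0 := ne_of_gt (by linarith)
  have n4 : y - x ≠ 0 := ne_of_lt (by linarith)
  have n5 : z - x ≠ 0 := ne_of_lt (by linarith)
  have n6 : z - y ≠ 0 := ne_of_lt (by linarith)
  simp only [mul_eq_zero, ha.ne', hb.ne', hc.ne', n1, n2, n3, n4, n5, n6, or_false, false_or]
    at e1 e2 e3
  have hy : y = 0 ∧ x + z = 0 := by
    rcases e2 with h | h | h
    · refine ⟨h, ?_⟩
      rcases e1 with h' | h' | h' <;> linarith
    · rcases e3 with h' | h' | h' <;> exfalso <;> linarith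
    · rcases e1 with h' | h' | h' <;> exfalso <;> linarith
  obtain ⟨hy, hxz⟩ := hy
  have hx : 0 < x := by linarith
  refine ⟨hy, by linarith, ?_, hx⟩
  have : (a - c) * x = 0 := by linear_combination h1 - b * hy - c * hxz
  rcases mul_eq_zero.1 this with h | h <;> linarith

/-- The focal spectra at $i=0$ and $i=1$ suffice. In each, three cotangents remain: the middle one
is zero, which gives $\kappa_0\kappa_2=\kappa_1\kappa_3=-1$, and the outer two are opposite with
equal weights. The last relation says $\cot(\theta_1-\theta_0)=1$. -/
theorem principalCurvatures_relations {κ m : Fin 4 → ℝ} (hκ : StrictAnti κ) (hm : ∀ j, 0 < m j)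
    (h : ∀ i, ∀ l : ℕ, Odd l → ∑ j, m j * EikonalPair.cotSub κ i j ^ l = 0) :
    κ 0 * κ 2 = -1 ∧ κ 1 * κ 3 = -1 ∧ m 0 = m 2 ∧ m 1 = m 3 ∧
      κ 0 * κ 1 + 1 = κ 0 - κ 1 := by
  have h01 : κ 1 < κ 0 := hκ (by decide)
  have h12 : κ 2 < κ 1 := hκ (by decide)
  have h23 : κ 3 < κ 2 := hκ (by decide)
  have p01 : 0 < κ 0 - κ 1 := by linarith
  have p02 : 0 < κ 0 - κ 2 := by linarith
  have p03 : 0 < κ 0 - κ 3 := by linarith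
  have p12 : 0 < κ 1 - κ 2 := by linarith
  have p13 : 0 < κ 1 - κ 3 := by linarith
  have key : ∀ i, ∀ l : ℕ, Odd l → m 0 * EikonalPair.cotSub κ i 0 ^ l +
      m 1 * EikonalPair.cotSub κ i 1 ^ l + m 2 * EikonalPair.cotSub κ i 2 ^ l +
      m 3 * EikonalPair.cotSub κ i 3 ^ l = 0 := fun i l hl => by
    have := h i l hl
    rwa [Fin.sum_univ_four] at this
  have o3 : Odd 3 := by decide
  have o5 : Odd 5 := by decide
  -- Division by zero gives $0$, so the index $j=i$ does not contribute to the odd moments.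
  have z0 : EikonalPair.cotSub κ 0 0 = 0 := by simp [EikonalPair.cotSub]
  have z1 : EikonalPair.cotSub κ 1 1 = 0 := by simp [EikonalPair.cotSub]
  obtain ⟨a1, -, a3, -⟩ := odd_moments_three (x := EikonalPair.cotSub κ 0 1)
    (y := EikonalPair.cotSub κ 0 2) (z := EikonalPair.cotSub κ 0 3) (a := m 1) (b := m 2)
    (c := m 3) (by
      rw [EikonalPair.cotSub, EikonalPair.cotSub, div_lt_div_iff₀ p02 p01]
      nlinarith [mul_pos p12 (by positivity : 0 < 1 + κ 0 ^ 2)]) (by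
      rw [EikonalPair.cotSub, EikonalPair.cotSub, div_lt_div_iff₀ p03 p02]
      nlinarith [mul_pos (sub_pos.2 h23) (by positivity : 0 < 1 + κ 0 ^ 2)])
    (hm 1) (hm 2) (hm 3) (by simpa [z0] using key 0 1 odd_one)
    (by simpa [z0] using key 0 3 o3) (by simpa [z0] using key 0 5 o5)
  obtain ⟨b1, b2, b3, b4⟩ := odd_moments_three (x := EikonalPair.cotSub κ 1 2)
    (y := EikonalPair.cotSub κ 1 3) (z := EikonalPair.cotSub κ 1 0) (a := m 2) (b := m 3)
    (c := m 0) (by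
      rw [EikonalPair.cotSub, EikonalPair.cotSub, div_lt_div_iff₀ p13 p12]
      nlinarith [mul_pos (sub_pos.2 h23) (by positivity : 0 < 1 + κ 1 ^ 2)]) (by
      rw [EikonalPair.cotSub, EikonalPair.cotSub, ← neg_sub (κ 0) (κ 1), div_neg, ← neg_div,
        div_lt_div_iff₀ p01 p13]
      nlinarith [mul_pos p03 (by positivity : 0 < 1 + κ 1 ^ 2)])
    (hm 2) (hm 3) (hm 0)
    (by simpa [z1, add_comm, add_assoc, add_left_comm] using key 1 1 odd_one)
    (by simpa [z1, add_comm, add_assoc, add_left_comm] using key 1 3 o3)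
    (by simpa [z1, add_comm, add_assoc, add_left_comm] using key 1 5 o5)
  have r02 : κ 0 * κ 2 = -1 := by
    rw [EikonalPair.cotSub, div_eq_zero_iff] at a1
    rcases a1 with h' | h' <;> linarith
  have r13 : κ 1 * κ 3 = -1 := by
    rw [EikonalPair.cotSub, div_eq_zero_iff] at b1
    rcases b1 with h' | h' <;> linarith
  refine ⟨r02, r13, b3.symm, a3, ?_⟩
  have k0 : 0 < κ 0 := by nlinarith
  rw [EikonalPair.cotSub] at b4
  have c1 : 0 < 1 + κ 1 * κ 2 := by
    by_contra hcon
    exact absurd b4 (not_lt.2 (div_nonpos_of_nonpos_of_nonneg (not_lt.1 hcon) p12.le))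
  rw [EikonalPair.cotSub, EikonalPair.cotSub, ← neg_sub (κ 0) (κ 1), div_neg, neg_neg,
    div_eq_div_iff p12.ne' p01.ne'] at b2
  have c2 : κ 0 * (1 + κ 1 * κ 2) = κ 0 - κ 1 := by linear_combination κ 1 * r02
  have c3 : κ 0 * (κ 1 - κ 2) = κ 0 * κ 1 + 1 := by linear_combination -r02
  -- Multiply the equality of the outer cotangents by $\kappa_0$ and eliminate $\kappa_2$ by
  -- $\kappa_0\kappa_2=-1$; both squared numbers are positive.
  have c4 : (κ 0 - κ 1) ^ 2 = (κ 0 * κ 1 + 1) ^ 2 := by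
    linear_combination κ 0 * b2 - (κ 0 - κ 1) * c2 + (1 + κ 1 * κ 0) * c3
  have c5 : 0 < κ 0 * κ 1 + 1 := by rw [← c3]; positivity
  nlinarith

/-- `a ^ 2` is the larger solution of `z + 1 / z = s - 2`. -/
theorem sq_add_one_of_eq {s a : ℝ} (hs : 4 < s)
    (ha : a ^ 2 = (1 + √(1 - 4 / s)) / (1 - √(1 - 4 / s))) :
    1 < a ^ 2 ∧ (a ^ 2) ^ 2 + 1 = (s - 2) * a ^ 2 := by
  have h1 : 4 / s < 1 := by rw [div_lt_one (by linarith)]; exact hs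
  have h2 : 0 < 4 / s := by positivity
  set t := √(1 - 4 / s) with ht
  have ht2 : t ^ 2 = 1 - 4 / s := Real.sq_sqrt (by linarith)
  have ht0 : 0 < t := Real.sqrt_pos.2 (by linarith)
  have ht1 : t < 1 := by nlinarith
  have h3 : 0 < 1 - t := by linarith
  have h4 : s * (1 - t ^ 2) = 4 := by
    rw [ht2]; field_simp; ring
  rw [ha]
  refine ⟨by rw [lt_div_iff₀ h3]; linarith, ?_⟩
  field_simp
  linear_combination -h4

/-- Expressed through $x_0$, the trace is $m_0(x_0^2-1)/x_0-4m_1x_0/(x_0^2-1)$. The relation for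
$x_3$ is the same one with the roles of the multiplicities exchanged. -/
theorem trace_relations {x₀ x₁ x₂ x₃ m₀ m₁ : ℝ} (hx : 1 < x₀) (e2 : x₂ * x₀ = -1)
    (e1 : x₁ * (x₀ + 1) = x₀ - 1) (e3 : x₃ * (x₀ - 1) = -(x₀ + 1))
    (htr : m₀ * x₀ + m₁ * x₁ + m₀ * x₂ + m₁ * x₃ = 0) :
    m₀ * (x₀ ^ 2 - 1) ^ 2 = m₁ * (4 * x₀ ^ 2) ∧ m₁ * (x₃ ^ 2 - 1) ^ 2 = m₀ * (4 * x₃ ^ 2) := by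
  have t1 : m₀ * (x₀ ^ 2 - 1) ^ 2 = m₁ * (4 * x₀ ^ 2) := by
    linear_combination x₀ * (x₀ ^ 2 - 1) * htr - m₀ * (x₀ ^ 2 - 1) * e2 -
      m₁ * x₀ * (x₀ - 1) * e1 - m₁ * x₀ * (x₀ + 1) * e3
  refine ⟨t1, ?_⟩
  have h0 : x₀ - 1 ≠ 0 := by linarith
  obtain rfl : x₃ = -(x₀ + 1) / (x₀ - 1) := by rw [eq_div_iff h0, e3]
  field_simp
  linear_combination -4 * t1

/-- Both squares are roots of $z^2-(s-2)z+1$. The product of its roots is $1$, so only one exceeds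
$1$. -/
theorem eq_of_sq_sub_one_sq {s α x : ℝ} (hα : 1 < α) (ha2 : (α ^ 2) ^ 2 + 1 = (s - 2) * α ^ 2)
    (hx : 1 < x) (hx2 : (x ^ 2 - 1) ^ 2 = (s - 4) * x ^ 2) : x = α := by
  have h1 : (x ^ 2 - α ^ 2) * (x ^ 2 * α ^ 2 - 1) = 0 := by
    linear_combination α ^ 2 * hx2 - x ^ 2 * ha2
  have h2 : 1 < x ^ 2 := one_lt_pow₀ hx two_ne_zero
  have h3 : 1 < α ^ 2 := one_lt_pow₀ hα two_ne_zero
  rcases mul_eq_zero.1 h1 with h4 | h4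
  · exact (pow_left_inj₀ (by linarith) (by linarith) two_ne_zero).1 (sub_eq_zero.1 h4)
  · nlinarith

/-- The claim amounts to $\alpha^2-3\alpha-2\ge0$, i.e. $\alpha\ge(3+\sqrt{17})/2\approx3.562$. -/
theorem two_mul_le_of_mul_sub_one {α β : ℝ} (hα : 3.59 ≤ α) (h : β * (α - 1) = α + 1) :
    2 * β ≤ α := by
  have h1 : 0 < α - 1 := by linarith
  refine le_of_mul_le_mul_right ?_ h1
  nlinarith

/-- The shape of the four principal curvatures of the minimal leaf when the smaller multiplicity
is `4`: up to orientation they lie in `[-(α + 1) / (α - 1), α]`, where `α` is the largest one. -/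
theorem principalCurvatures_bounds {κ m : Fin 4 → ℝ} {s a : ℝ} (hκ : StrictAnti κ)
    (hm : ∀ j, 0 < m j)
    (h : ∀ i, ∀ l : ℕ, Odd l → ∑ j, m j * EikonalPair.cotSub κ i j ^ l = 0)
    (htr : ∑ j, m j * κ j = 0) (hmin : min (m 0) (m 1) = 4) (hs : s = m 0 + m 1) (hs15 : 15 ≤ s)
    (ha : a ^ 2 = (1 + √(1 - 4 / s)) / (1 - √(1 - 4 / s))) :
    ∃ (ε β : ℝ) (i : Fin 4), ε ^ 2 = 1 ∧ 0 < β ∧ 2 * β ≤ |a| ∧ κ i = ε * |a| ∧ m i = 4 ∧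
      ∀ j, -β ≤ ε * κ j ∧ ε * κ j ≤ |a| := by
  obtain ⟨r02, r13, m02, m13, r01⟩ := principalCurvatures_relations hκ hm h
  obtain ⟨ha1, ha2⟩ := sq_add_one_of_eq (by linarith) ha
  rw [← sq_abs a] at ha1 ha2
  set α := |a| with hα
  have hα0 : 0 ≤ α := abs_nonneg a
  have hα1 : 1 < α := by nlinarith
  -- From $z+1/z=s-2\ge13$ with $z=\alpha^2>1$; the larger root for $s=15$ is about $12.92$.
  have hα2 : 12.9 ≤ α ^ 2 := by
    by_contra hcon
    push Not at hcon
    nlinarith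
  have hα3 : 3.59 ≤ α := by nlinarith
  have huniq : ∀ x : ℝ, 1 < x → (x ^ 2 - 1) ^ 2 = (s - 4) * x ^ 2 → x = α := fun x hx hx2 =>
    eq_of_sq_sub_one_sq hα1 ha2 hx hx2
  have h01 : κ 1 < κ 0 := hκ (by decide)
  have h12 : κ 2 < κ 1 := hκ (by decide)
  have h23 : κ 3 < κ 2 := hκ (by decide)
  have k0 : 0 < κ 0 := by nlinarith
  have k2 : κ 2 < 0 := by nlinarith
  have k1 : 0 < κ 1 := by nlinarith
  have k3 : κ 3 < 0 := by nlinarith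
  have k01 : 1 < κ 0 := by nlinarith
  have k31 : κ 3 * (κ 0 - 1) = -(κ 0 + 1) := by
    have h1 : κ 1 * (κ 3 * (κ 0 - 1) + (κ 0 + 1)) = 0 := by
      linear_combination (κ 0 - 1) * r13 + r01
    rcases mul_eq_zero.1 h1 with h2 | h2 <;> linarith
  have k33 : κ 3 < -1 := by nlinarith
  rw [Fin.sum_univ_four, ← m02, ← m13] at htr
  obtain ⟨t1, t2⟩ := trace_relations (m₀ := m 0) (m₁ := m 1) k01 (by linarith) (by linarith) k31 htr
  rcases min_choice (m 0) (m 1) with hc | hc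
  · have hm0 : m 0 = 4 := by rw [← hc, hmin]
    have hx : κ 0 = α := huniq _ k01 (by rw [hm0] at t1 hs; rw [hs]; linear_combination t1 / 4)
    refine ⟨1, -κ 3, 0, by norm_num, by linarith, ?_, by rw [hx, one_mul], hm0, fun j => ?_⟩
    · rw [hx] at k31
      exact two_mul_le_of_mul_sub_one hα3 (by linarith)
    · have hj0 : κ 3 ≤ κ j := hκ.antitone (Fin.le_last j)
      have hj1 : κ j ≤ κ 0 := hκ.antitone (Fin.zero_le j)
      constructor <;> linarith
  -- Here the curvature of largest modulus is the lowest one, $\kappa_3=-\alpha$, and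
  -- $\varepsilon=-1$ reverses the orientation.
  · have hm1 : m 1 = 4 := by rw [← hc, hmin]
    have hx : -κ 3 = α := huniq _ (by linarith)
      (by rw [hm1] at t2 hs; rw [hs]; linear_combination t2 / 4)
    refine ⟨-1, κ 0, 3, by norm_num, by linarith, ?_, by linarith, by rw [← m13, hm1],
      fun j => ?_⟩
    · have hx' : κ 3 = -α := by linarith
      rw [hx'] at k31
      exact two_mul_le_of_mul_sub_one hα3 (by linarith)
    · have hj0 : κ 3 ≤ κ j := hκ.antitone (Fin.le_last j)
      have hj1 : κ j ≤ κ 0 := hκ.antitone (Fin.zero_le j)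
      constructor <;> linarith

/-! ### Spectral data at a point of the minimal hypersurface -/

open Polynomial in
theorem ContinuousLinearMap.aeval_apply_of_eigen {E : Type*} [NormedAddCommGroup E]
    [NormedSpace ℝ E] {A : E →L[ℝ] E} {μ : ℝ} {v : E} (hv : A v = μ • v) (f : ℝ[X]) :
    aeval A f v = f.eval μ • v := by
  induction f using Polynomial.induction_on' with
  | add f g hf hg => simp [hf, hg, add_smul]
  | monomial m c =>
    have : ∀ k : ℕ, (A ^ k) v = μ ^ k • v := by
      intro k
      induction k with
      | zero => simp
      | succ k ih => rw [pow_succ', mul_apply_eq_comp, ih, map_smul, hv, smul_smul, pow_succ]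
    simp [aeval_monomial, Algebra.algebraMap_eq_smul_one, this, smul_smul]

/-- Two operators agree if they agree on the eigenvectors of a symmetric one. -/
theorem ContinuousLinearMap.ext_of_symmetric_eigen {E F : Type*} [NormedAddCommGroup E]
    [InnerProductSpace ℝ E] [FiniteDimensional ℝ E] [NormedAddCommGroup F] [NormedSpace ℝ F]
    {A : E →L[ℝ] E} (hA : ∀ a b, ⟪A a, b⟫ = ⟪a, A b⟫) {B C : E →L[ℝ] F}
    (h : ∀ (μ : ℝ) (v : E), A v = μ • v → B v = C v) : B = C := by
  have hs : (A : E →ₗ[ℝ] E).IsSymmetric := hA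
  have key : (B : E →ₗ[ℝ] F) = C := by
    refine (hs.eigenvectorBasis rfl).toBasis.ext fun i => ?_
    refine h (hs.eigenvalues rfl i) _ ?_
    have := hs.apply_eigenvectorBasis rfl i
    exact this
  ext v
  exact congrArg (fun L : E →ₗ[ℝ] F => L v) key

theorem norm_coe_orthonormalBasis {E ι : Type*} [NormedAddCommGroup E] [InnerProductSpace ℝ E]
    [Fintype ι] {V : Submodule ℝ E} (b : OrthonormalBasis ι ℝ V) (i : ι) : ‖(b i : E)‖ = 1 :=
  b.norm_eq_one i

namespace EikonalPair

open Polynomial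

variable {E : Type*} [NormedAddCommGroup E] [InnerProductSpace ℝ E] [FiniteDimensional ℝ E]
  {N Ω : Set E} {u w : E → ℝ} {p q : E → E}

section Leaf

variable (h : EikonalPair N Ω u w p q) {x : E} (hx : x ∈ Ω) (hxN : x ∈ N)
include h hx hxN

theorem isUnit_of_mem : IsUnit (1 - u x • fderiv ℝ q x) := by
  have h3 : 1 - u x • fderiv ℝ q x = 1 := by
    ext1 v
    simp [h.u_eq_zero hx hxN]
  rw [h3]
  exact isUnit_one

theorem mem_curvSpace_iff {μ : ℝ} {v : E} :
    v ∈ curvSpace N x (q x) μ ↔ v ∈ tang N x ∧ shape u w q x v = μ • v := by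
  rw [h.shape_of_mem hx hxN]
  refine and_congr_right fun hv => ?_
  constructor
  · intro hb
    have hm : -fderiv ℝ q x v - μ • v ∈ tang N x :=
      sub_mem (neg_mem (h.fderiv_q_mem_tang hx hxN v)) (Submodule.smul_mem _ _ hv)
    have h1 := hb _ hm
    rw [h.inner_sff_q hx hxN hv hm] at h1
    rw [neg_apply, ← sub_eq_zero, ← inner_self_eq_zero (𝕜 := ℝ)]
    nth_rewrite 1 [inner_sub_left]
    rw [inner_neg_left, real_inner_smul_left, h1]
    ring
  · intro hb b hbt
    rw [h.inner_sff_q hx hxN hv hbt, ← inner_neg_left, ← neg_apply, hb, real_inner_smul_left]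

theorem starProjection_tang : (tang N x).starProjection = tproj p q x :=
  h.proj_eq_tproj hx hxN

theorem traceCLM_tproj : traceCLM E (tproj p q x) = finrank ℝ E - 2 := by
  have h1 : tproj p q x = 1 - (innerSL ℝ (p x)).smulRight (p x) -
      (innerSL ℝ (q x)).smulRight (q x) := by
    ext a
    simp [tproj_apply]
  rw [h1, map_sub, map_sub, traceCLM_smulRight, traceCLM_smulRight, traceCLM_one]
  simp [h.norm_p hx, h.norm_q hx]
  ring

theorem finrank_tang : (finrank ℝ (tang N x) : ℝ) = finrank ℝ E - 2 := by
  rw [← h.traceCLM_tproj hx hxN, ← h.starProjection_tang hx hxN]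
  have h1 := traceCLM_mul_starProjection (stdOrthonormalBasis ℝ (tang N x)) 1
  rw [one_mul] at h1
  rw [← h1]
  simp [norm_coe_orthonormalBasis]

theorem meanCurv_eq : meanCurv N x =
    -(finrank ℝ (tang N x) : ℝ) • p x - traceCLM E (fderiv ℝ q x) • q x := by
  have h1 : ∀ i, sff N x (stdOrthonormalBasis ℝ (tang N x) i)
      (stdOrthonormalBasis ℝ (tang N x) i) = -((1 : ℝ) • p x) -
      ⟪fderiv ℝ q x (stdOrthonormalBasis ℝ (tang N x) i),
        (stdOrthonormalBasis ℝ (tang N x) i : E)⟫ • q x := fun i => by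
    rw [h.sff_eq hx hxN (Subtype.coe_prop _) (Subtype.coe_prop _)]
    have h2 : ⟪(stdOrthonormalBasis ℝ (tang N x) i : E), (stdOrthonormalBasis ℝ (tang N x) i : E)⟫
        = 1 := by
      rw [real_inner_self_eq_norm_sq, norm_coe_orthonormalBasis]
      norm_num
    rw [h2]
  rw [meanCurv]
  simp only [h1]
  rw [Finset.sum_sub_distrib, ← Finset.sum_smul, traceCLM_mul_starProjection,
    h.starProjection_tang hx hxN, h.fderiv_mul_tproj hx]
  simp [Nat.cast_smul_eq_nsmul]

theorem trace_fderiv_q_eq_zero (hmin : IsMinimalIn N (Metric.sphere 0 1)) :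
    traceCLM E (fderiv ℝ q x) = 0 := by
  have h1 := hmin.2 x hxN
  rw [proj_sphere (hmin.1 hxN), h.meanCurv_eq hx hxN, ← h.p_eq_self hx hxN] at h1
  have h2 := congrArg (fun v => ⟪q x, v⟫) h1
  have h3 := h.inner_pq x hx
  rw [real_inner_comm] at h3
  rw [h.p_eq_self hx hxN] at h2
  rw [h.p_eq_self hx hxN] at h3
  simpa [inner_sub_right, real_inner_smul_right, h.norm_q hx, h.p_eq_self hx hxN, h3] using h2

variable {ι : Type*} [Fintype ι] [DecidableEq ι] {κ : ι → ℝ}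

/-- Checked on eigenvectors of the symmetric shape operator: the tangential part of one is zero or a
principal vector, whose eigenvalue is some $\kappa_j$. -/
theorem aeval_prod_eq_zero (hκ : principalCurvatures N x (q x) = Set.range κ) :
    aeval (shape u w q x) (∏ j, (X - C (κ j))) * tproj p q x = 0 := by
  have hi := h.isUnit_of_mem hx hxN
  refine ContinuousLinearMap.ext_of_symmetric_eigen (h.shape_symm hx hi) fun μ v hv => ?_
  have h1 : shape u w q x (tproj p q x v) = μ • tproj p q x v := by
    rw [← mul_apply_eq_comp, h.shape_mul_tproj hx hi, ← map_smul, ← hv, ← mul_apply_eq_comp,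
      h.tproj_mul_shape hx hi]
  rw [mul_apply_eq_comp, ContinuousLinearMap.aeval_apply_of_eigen h1, zero_apply]
  by_cases h0 : tproj p q x v = 0
  · rw [h0, smul_zero]
  · have h2 : μ ∈ principalCurvatures N x (q x) := by
      refine (Submodule.ne_bot_iff _).2 ⟨_, (h.mem_curvSpace_iff hx hxN).2 ⟨?_, h1⟩, h0⟩
      exact (h.mem_tang_iff hx hxN _).2 ⟨h.inner_p_tproj hx v, h.inner_q_tproj hx v⟩
    rw [hκ] at h2
    obtain ⟨j, rfl⟩ := h2
    rw [eval_prod, Finset.prod_eq_zero (Finset.mem_univ j) (by simp), zero_smul]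

variable (hinj : Function.Injective κ)
  (hQ : aeval (shape u w q x) (∏ j, (X - C (κ j))) * tproj p q x = 0)
include hinj hQ

theorem fcalc_apply_of_mem_curvSpace {j : ι} {v : E} (hv : v ∈ curvSpace N x (q x) (κ j))
    (r : ι → ℝ) : fcalc u w p q κ r x v = r j • v := by
  rw [h.mem_curvSpace_iff hx hxN] at hv
  rw [fcalc, mul_apply_eq_comp, h.tproj_of_mem_tang hx hxN hv.1,
    ContinuousLinearMap.aeval_apply_of_eigen hv.2, eval_interpolate hinj]

/-- The operator is a projection onto the eigenspace of $\kappa_j$, and the trace of a projection is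
its rank. -/
theorem traceCLM_fcalc_single (j : ι) :
    traceCLM E (fcalc u w p q κ (Pi.single j 1) x) = finrank ℝ (curvSpace N x (q x) (κ j)) := by
  have hi := h.isUnit_of_mem hx hxN
  rw [traceCLM_apply]
  refine LinearMap.IsProj.trace ⟨fun v => ?_, fun v hv => ?_⟩
  · refine (h.mem_curvSpace_iff hx hxN).2 ⟨(h.mem_tang_iff hx hxN _).2 ?_, ?_⟩
    · have h1 : fcalc u w p q κ (Pi.single j 1) x =
          tproj p q x * fcalc u w p q κ (Pi.single j 1) x := by
        rw [← h.fcalc_one hx hi hinj hQ, h.fcalc_mul hx hi hinj hQ, one_mul]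
      rw [ContinuousLinearMap.coe_coe, h1, mul_apply_eq_comp]
      exact ⟨h.inner_p_tproj hx _, h.inner_q_tproj hx _⟩
    · rw [ContinuousLinearMap.coe_coe, ← h.fcalc_id hx hi hinj hQ, ← mul_apply_eq_comp,
        h.fcalc_mul hx hi hinj hQ, ← smul_apply, ← fcalc_smul]
      congr 2
      ext i
      by_cases hij : i = j
      · subst hij; simp
      · simp [hij]
  · rw [ContinuousLinearMap.coe_coe, h.fcalc_apply_of_mem_curvSpace hx hxN hinj hQ hv]
    simp

theorem traceCLM_fcalc (r : ι → ℝ) : traceCLM E (fcalc u w p q κ r x) =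
    ∑ j, finrank ℝ (curvSpace N x (q x) (κ j)) * r j := by
  let L : (ι → ℝ) →ₗ[ℝ] ℝ :=
    { toFun := fun r => traceCLM E (fcalc u w p q κ r x)
      map_add' := fun r s => by rw [fcalc_add, map_add]
      map_smul' := fun c r => by rw [fcalc_smul, map_smul]; rfl }
  have h1 := L.pi_apply_eq_sum_univ r
  refine h1.trans (Finset.sum_congr rfl fun j _ => ?_)
  have h2 : (fun i => if j = i then (1 : ℝ) else 0) = Pi.single j 1 := by
    ext i
    simp [Pi.single_apply, eq_comm]
  rw [h2, smul_eq_mul, mul_comm]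
  congr 1
  exact h.traceCLM_fcalc_single hx hxN hinj hQ j

/-- The operator is the square of the symmetric operator with values $\sqrt{r_j}$. -/
theorem inner_fcalc_nonneg {r : ι → ℝ} (hr : ∀ j, 0 ≤ r j) (v : E) :
    0 ≤ ⟪fcalc u w p q κ r x v, v⟫ := by
  have hi := h.isUnit_of_mem hx hxN
  have h1 : fcalc u w p q κ r x = fcalc u w p q κ (fun j => √(r j)) x *
      fcalc u w p q κ (fun j => √(r j)) x := by
    rw [h.fcalc_mul hx hi hinj hQ]
    congr 1
    ext j
    simp [Real.mul_self_sqrt (hr j)]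
  rw [h1, mul_apply_eq_comp, h.fcalc_symm hx hi, real_inner_self_eq_norm_sq]
  positivity

/-- A spectral bound for the shape operator, in the form of a quadratic inequality. -/
theorem norm_fderiv_q_sq_le {ε α β : ℝ} (hε : ε ^ 2 = 1)
    (hb : ∀ j, -β ≤ ε * κ j ∧ ε * κ j ≤ α) {v : E} (hv : v ∈ tang N x) :
    ‖fderiv ℝ q x v‖ ^ 2 ≤ (α - β) * (-ε * ⟪fderiv ℝ q x v, v⟫) + α * β * ‖v‖ ^ 2 := by
  have hi := h.isUnit_of_mem hx hxN
  -- The values are $(\alpha-\varepsilon\kappa_j)(\varepsilon\kappa_j+\beta)\ge0$, expanded with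
  -- $\varepsilon^2=1$.
  have h1 := h.inner_fcalc_nonneg hx hxN hinj hQ
    (r := (α * β) • 1 + (ε * (α - β)) • κ - κ * κ) (fun j => by
      have := mul_nonneg (sub_nonneg.2 (hb j).2) (neg_le_iff_add_nonneg.1 (hb j).1)
      simp only [Pi.sub_apply, Pi.add_apply, Pi.smul_apply, Pi.mul_apply, Pi.one_apply, smul_eq_mul]
      nlinarith [this, hε, congrArg (· * κ j ^ 2) hε]) v
  rw [fcalc_sub, fcalc_add, fcalc_smul, fcalc_smul, ← h.fcalc_mul hx hi hinj hQ,
    h.fcalc_one hx hi hinj hQ, h.fcalc_id hx hi hinj hQ, h.shape_of_mem hx hxN] at h1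
  simp only [sub_apply, add_apply, smul_apply, mul_apply_eq_comp, neg_apply, map_neg, neg_neg,
    h.tproj_of_mem_tang hx hxN hv, inner_sub_left, inner_add_left, real_inner_smul_left,
    inner_neg_left, h.symm_q hx (fderiv ℝ q x v) v, real_inner_self_eq_norm_sq] at h1
  linarith

end Leaf

end EikonalPair

/-! ### Orthonormal frames and the quadratic form of $\Delta$ -/

section FrameBasis

variable {E : Type*} [NormedAddCommGroup E] [InnerProductSpace ℝ E] [FiniteDimensional ℝ E]

theorem exists_orthonormalBasis_cons {n : ℕ} {V : Submodule ℝ E} (hV : finrank ℝ V = n + 1)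
    {e : Fin n → E} {ν : E} (he : Orthonormal ℝ e) (heV : ∀ k, e k ∈ V) (hν : ν ∈ V)
    (hν1 : ‖ν‖ = 1) (hort : ∀ k, ⟪e k, ν⟫ = 0) :
    ∃ b : OrthonormalBasis (Fin (n + 1)) ℝ V, (b 0 : E) = ν ∧ ∀ k : Fin n, (b k.succ : E) = e k := by
  let v : Fin (n + 1) → V := Fin.cons ⟨ν, hν⟩ fun k => ⟨e k, heV k⟩
  have hv : Orthonormal ℝ v := by
    refine ⟨fun i => ?_, fun i j hij => ?_⟩
    · refine Fin.cases ?_ (fun k => ?_) i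
      · exact hν1
      · exact he.1 k
    · change ⟪(v i : E), (v j : E)⟫ = 0
      induction i using Fin.cases with
      | zero =>
        induction j using Fin.cases with
        | zero => exact absurd rfl hij
        | succ l =>
          simp only [v, Fin.cons_zero, Fin.cons_succ]
          rw [real_inner_comm, hort]
      | succ k =>
        induction j using Fin.cases with
        | zero =>
          simp only [v, Fin.cons_zero, Fin.cons_succ]
          rw [hort]
        | succ l =>
          simp only [v, Fin.cons_succ]
          exact he.2 fun hkl => hij (by rw [hkl])
  have hcard : Fintype.card (Fin (n + 1)) = finrank ℝ V := by simp [hV]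
  refine ⟨(basisOfOrthonormalOfCardEqFinrank hv hcard).toOrthonormalBasis (by simpa using hv),
    ?_, fun k => ?_⟩
  · simp [v]
  · simp [v]

theorem OrthonormalBasis.sum_inner_mul_inner_coe {ι : Type*} [Fintype ι] {V : Submodule ℝ E}
    (b : OrthonormalBasis ι ℝ V) {x y : E} (hx : x ∈ V) (hy : y ∈ V) :
    ∑ i, ⟪(b i : E), x⟫ * ⟪(b i : E), y⟫ = ⟪x, y⟫ := by
  have h1 := b.sum_inner_mul_inner ⟨x, hx⟩ ⟨y, hy⟩
  simp only [Submodule.coe_inner] at h1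
  rw [← h1]
  exact Finset.sum_congr rfl fun i _ => by rw [real_inner_comm (b i : E) x]

end FrameBasis

/-- `Δ(X, ν)` in terms of the shape operator `S` of a minimal hypersurface of dimension `n + 1`. -/
def deltaForm {E : Type*} [NormedAddCommGroup E] [InnerProductSpace ℝ E] (n : ℕ) (S : E →L[ℝ] E)
    (X ν : E) : ℝ :=
  (2 * n - 2 - 2 * ‖S ν‖ ^ 2 + ⟪S ν, ν⟫ ^ 2) * ‖X‖ ^ 2 - 2 * ‖S X‖ ^ 2 + 2 * ⟪S X, ν⟫ ^ 2 -
    ⟪S X, X⟫ * ⟪S ν, ν⟫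

/-- The coefficient $2(\alpha-\beta)+y$ of $x$ is nonnegative, so $x=\alpha$ is the worst case.
There the defect factors as $(\alpha-y)(2\alpha-2\beta-y)$, and $2\beta\le\alpha$ makes the second
factor nonnegative. -/
theorem quadratic_bound {α β x y : ℝ} (hβ : 0 < β) (hαβ : 2 * β ≤ α) (hx : x ≤ α)
    (hy : -β ≤ y) (hy' : y ≤ α) :
    2 * (α - β) * (x + y) + 4 * (α * β) + x * y - y ^ 2 ≤ 4 * α ^ 2 := by
  have h1 : 0 ≤ (α - x) * (2 * (α - β) + y) := mul_nonneg (by linarith) (by linarith)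
  have h2 : 0 ≤ (α - y) * (2 * α - 2 * β - y) := mul_nonneg (by linarith) (by linarith)
  linarith

/-- For unit $X$ the hypothesis bounds $|SX|^2$ and $|S\nu|^2$ by Rayleigh quotients, the square
$\langle SX,\nu\rangle^2$ is dropped, and `quadratic_bound` applies. Orthogonality of $X$ and $\nu$
plays no role. General $X$ follows by homogeneity. -/
theorem deltaForm_ge {E : Type*} [NormedAddCommGroup E] [InnerProductSpace ℝ E] {n : ℕ}
    {S : E →L[ℝ] E} {V : Submodule ℝ E} {ε α β : ℝ} (hε : ε ^ 2 = 1) (hβ : 0 < β)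
    (hαβ : 2 * β ≤ α)
    (hS : ∀ v ∈ V, ‖S v‖ ^ 2 ≤ (α - β) * (-ε * ⟪S v, v⟫) + α * β * ‖v‖ ^ 2)
    {X ν : E} (hX : X ∈ V) (hν : ν ∈ V) (hν1 : ‖ν‖ = 1) :
    (2 * n - 2 - 4 * α ^ 2) * ‖X‖ ^ 2 ≤ deltaForm n S X ν := by
  -- By Cauchy–Schwarz the Rayleigh quotient $x$ satisfies
  -- $x^2\le|Sv|^2\le(\alpha-\beta)x+\alpha\beta$, i.e. $(\alpha-x)(x+\beta)\ge0$.
  have key : ∀ v ∈ V, ‖v‖ = 1 → -β ≤ -ε * ⟪S v, v⟫ ∧ -ε * ⟪S v, v⟫ ≤ α := by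
    intro v hv hv1
    have h1 := hS v hv
    have h2 := abs_real_inner_le_norm (S v) v
    rw [hv1, mul_one] at h2
    have h3 : (-ε * ⟪S v, v⟫) ^ 2 ≤ ‖S v‖ ^ 2 := by
      rw [mul_pow, neg_sq, hε, one_mul, ← sq_abs]
      exact pow_le_pow_left₀ (abs_nonneg _) h2 2
    rw [hv1] at h1
    have h4 : 0 ≤ (α - -ε * ⟪S v, v⟫) * (-ε * ⟪S v, v⟫ + β) := by nlinarith
    constructor <;> by_contra hcon <;> push Not at hcon <;> nlinarith
  have unit : ∀ X ∈ V, ‖X‖ = 1 → 2 * n - 2 - 4 * α ^ 2 ≤ deltaForm n S X ν := by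
    intro X hX hX1
    have h1 := quadratic_bound hβ hαβ (key X hX hX1).2 (key ν hν hν1).1 (key ν hν hν1).2
    have h2 := hS X hX
    have h3 := hS ν hν
    rw [hX1] at h2
    rw [hν1] at h3
    have h4 : (-ε * ⟪S X, X⟫) * (-ε * ⟪S ν, ν⟫) = ⟪S X, X⟫ * ⟪S ν, ν⟫ := by
      linear_combination ⟪S X, X⟫ * ⟪S ν, ν⟫ * hε
    have h5 : (-ε * ⟪S ν, ν⟫) ^ 2 = ⟪S ν, ν⟫ ^ 2 := by
      linear_combination ⟪S ν, ν⟫ ^ 2 * hε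
    rw [h4, h5] at h1
    rw [deltaForm, hX1]
    nlinarith [sq_nonneg ⟪S X, ν⟫]
  rcases eq_or_ne X 0 with rfl | hX0
  · simp [deltaForm]
  · have hn : ‖X‖ ≠ 0 := norm_ne_zero_iff.2 hX0
    have h1 := unit (‖X‖⁻¹ • X) (V.smul_mem _ hX) (norm_smul_inv_norm (𝕜 := ℝ) hX0)
    have h2 : deltaForm n S X ν = deltaForm n S (‖X‖⁻¹ • X) ν * ‖X‖ ^ 2 := by
      simp only [deltaForm, map_smul, real_inner_smul_left, real_inner_smul_right, norm_smul,
        norm_inv, norm_norm]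
      field_simp
    rw [h2]
    exact mul_le_mul_of_nonneg_right h1 (by positivity)

theorem deltaForm_of_eigen {E : Type*} [NormedAddCommGroup E] [InnerProductSpace ℝ E] {n : ℕ}
    {S : E →L[ℝ] E} {μ : ℝ} {X ν : E} (hX : S X = μ • X) (hν : S ν = μ • ν) (hX1 : ‖X‖ = 1)
    (hν1 : ‖ν‖ = 1) (hXν : ⟪X, ν⟫ = 0) : deltaForm n S X ν = 2 * n - 2 - 4 * μ ^ 2 := by
  simp only [deltaForm, hX, hν, real_inner_smul_left, norm_smul, hX1, hν1, hXν,
    real_inner_self_eq_norm_sq, mul_one, mul_pow, Real.norm_eq_abs, sq_abs]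
  ring

/-! ### $\Delta$ through the Gauss equation -/

namespace EikonalPair

variable {E : Type*} [NormedAddCommGroup E] [InnerProductSpace ℝ E] [FiniteDimensional ℝ E]
  {N Ω : Set E} {u w : E → ℝ} {p q : E → E} (h : EikonalPair N Ω u w p q) {x : E} (hx : x ∈ Ω)
  (hxN : x ∈ N)
include h hx hxN

/-- The Gauss equation traced over a full tangent basis; minimality removes the mean curvature term.
-/
theorem sum_curv4 {ι : Type*} [Fintype ι] (b : OrthonormalBasis ι ℝ (tang N x)) {v : E}
    (hv : v ∈ tang N x) (htr : traceCLM E (fderiv ℝ q x) = 0) :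
    ∑ i, curv4 N x (b i) v (b i) v =
      (finrank ℝ (tang N x) - 1) * ‖v‖ ^ 2 - ‖fderiv ℝ q x v‖ ^ 2 := by
  have h1 : ∑ i, ⟪fderiv ℝ q x (b i), (b i : E)⟫ = 0 := by
    rw [traceCLM_mul_starProjection, h.starProjection_tang hx hxN, h.fderiv_mul_tproj hx, htr]
  have h2 := b.sum_inner_mul_inner_coe hv hv
  have h3 := b.sum_inner_mul_inner_coe (h.fderiv_q_mem_tang hx hxN v)
    (h.fderiv_q_mem_tang hx hxN v)
  have h4 : ∀ i, curv4 N x (b i) v (b i) v = ‖v‖ ^ 2 +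
      ⟪fderiv ℝ q x (b i), (b i : E)⟫ * ⟪fderiv ℝ q x v, v⟫ -
      ⟪(b i : E), v⟫ * ⟪(b i : E), v⟫ -
      ⟪(b i : E), fderiv ℝ q x v⟫ * ⟪(b i : E), fderiv ℝ q x v⟫ := fun i => by
    rw [h.curv4_eq hx hxN (Subtype.coe_prop _) hv, real_inner_self_eq_norm_sq (b i : E),
      norm_coe_orthonormalBasis, real_inner_self_eq_norm_sq, h.symm_q hx (b i : E) v]
    ring
  simp only [h4]
  rw [Finset.sum_sub_distrib, Finset.sum_sub_distrib, Finset.sum_add_distrib, h2, h3,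
    ← Finset.sum_mul, h1, real_inner_self_eq_norm_sq, real_inner_self_eq_norm_sq,
    finrank_eq_card_basis b.toBasis]
  simp
  ring

theorem sum_norm_sff_sq {ι : Type*} [Fintype ι] (b : OrthonormalBasis ι ℝ (tang N x)) {v : E}
    (hv : v ∈ tang N x) :
    ∑ i, ‖sff N x (b i) v‖ ^ 2 = ‖v‖ ^ 2 + ‖fderiv ℝ q x v‖ ^ 2 := by
  have h2 := b.sum_inner_mul_inner_coe hv hv
  have h3 := b.sum_inner_mul_inner_coe (h.fderiv_q_mem_tang hx hxN v)
    (h.fderiv_q_mem_tang hx hxN v)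
  rw [real_inner_self_eq_norm_sq] at h2 h3
  rw [← h2, ← h3, ← Finset.sum_add_distrib]
  refine Finset.sum_congr rfl fun i _ => ?_
  rw [h.norm_sff_sq hx hxN (Subtype.coe_prop _) hv, h.symm_q hx (b i : E) v]
  ring

theorem ric_eq {v : E} (hv : v ∈ tang N x) (htr : traceCLM E (fderiv ℝ q x) = 0) :
    ric N x v = (finrank ℝ (tang N x) - 1) * ‖v‖ ^ 2 - ‖fderiv ℝ q x v‖ ^ 2 :=
  h.sum_curv4 hx hxN _ hv htr

variable {n : ℕ} (hn : finrank ℝ (tang N x) = n + 1) (htr : traceCLM E (fderiv ℝ q x) = 0)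
  {e : Fin n → E} {ν X : E} (he : IsFrame N x ν e) (hν : ν ∈ tang N x) (hν1 : ‖ν‖ = 1)
  (hX : X ∈ tang N x) (hXν : ⟪X, ν⟫ = 0)
include hn he hν hν1 hX hXν

include htr in
-- Adding $\nu$ to the frame gives an orthonormal basis of the tangent space of $N$. The sum over
-- the frame is the full trace minus the sectional term of $X$ and $\nu$.
theorem acsCurv_eq : acsCurv N x e X ν = (2 * n - 1 - ‖fderiv ℝ q x ν‖ ^ 2) * ‖X‖ ^ 2 -
    ‖fderiv ℝ q x X‖ ^ 2 + ⟪fderiv ℝ q x X, ν⟫ ^ 2 -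
    ⟪fderiv ℝ q x X, X⟫ * ⟪fderiv ℝ q x ν, ν⟫ := by
  obtain ⟨b, hb0, hbs⟩ := exists_orthonormalBasis_cons hn he.1 (fun k => (he.2 k).1) hν hν1
    fun k => (he.2 k).2
  have h1 := h.sum_curv4 hx hxN b hX htr
  rw [Fin.sum_univ_succ, hb0, h.curv4_eq hx hxN hν hX, hn, h.symm_q hx ν X,
    real_inner_comm (fderiv ℝ q x X) ν, real_inner_self_eq_norm_sq, real_inner_self_eq_norm_sq,
    hν1, real_inner_comm X ν, hXν] at h1
  simp only [hbs] at h1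
  push_cast at h1
  rw [acsCurv, h.ric_eq hx hxN hν htr, hn, hν1]
  push_cast
  linear_combination h1

theorem acsSff_eq : acsSff N x e X ν =
    (1 + ‖fderiv ℝ q x ν‖ ^ 2 - ⟪fderiv ℝ q x ν, ν⟫ ^ 2) * ‖X‖ ^ 2 +
      ‖fderiv ℝ q x X‖ ^ 2 - ⟪fderiv ℝ q x X, ν⟫ ^ 2 := by
  obtain ⟨b, hb0, hbs⟩ := exists_orthonormalBasis_cons hn he.1 (fun k => (he.2 k).1) hν hν1
    fun k => (he.2 k).2
  have h1 := h.sum_norm_sff_sq hx hxN b hX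
  have h2 := h.sum_norm_sff_sq hx hxN b hν
  rw [Fin.sum_univ_succ, hb0, h.norm_sff_sq hx hxN hν hX, h.symm_q hx ν X,
    real_inner_comm (fderiv ℝ q x X) ν, real_inner_comm X ν, hXν] at h1
  rw [Fin.sum_univ_succ, hb0, h.norm_sff_sq hx hxN hν hν, real_inner_self_eq_norm_sq, hν1] at h2
  simp only [hbs] at h1 h2
  rw [acsSff]
  linear_combination h1 + ‖X‖ ^ 2 * h2

include htr in
theorem delta_eq : Delta N x e X ν = deltaForm n (fderiv ℝ q x) X ν := by
  rw [Delta, h.acsCurv_eq hx hxN hn htr he hν hν1 hX hXν,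
    h.acsSff_eq hx hxN hn he hν hν1 hX hXν, deltaForm]
  ring

end EikonalPair

/-- The pointwise data of `N` entering the estimates: `-fderiv ℝ q x` is the shape operator with
respect to the unit normal `η₀`, and up to the sign `ε` its spectrum lies in `[-β, |a|]`. -/
theorem exists_local_data {n m₁ m₂ s : ℕ} {N : Set (EuclideanSpace ℝ (Fin (n + 3)))}
    (hN : IsIsoparametric N) (hmin : IsMinimalIn N (unitSphere n))
    {η₀ x : EuclideanSpace ℝ (Fin (n + 3))} (hxN : x ∈ N)
    (hη : IsUnitNormalAt N (unitSphere n) x η₀) {κ : Fin 4 → ℝ} (hκ : StrictAnti κ)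
    (hpc : principalCurvatures N x η₀ = Set.range κ)
    (hm₁ : finrank ℝ (curvSpace N x η₀ (κ 0)) = m₁)
    (hm₂ : finrank ℝ (curvSpace N x η₀ (κ 1)) = m₂)
    (hq : min m₁ m₂ = 4) (hs : s = m₁ + m₂) (hs15 : 15 ≤ s) {a : ℝ}
    (ha : a ^ 2 = (1 + √(1 - 4 / (s : ℝ))) / (1 - √(1 - 4 / (s : ℝ)))) :
    ∃ (Ω : Set (EuclideanSpace ℝ (Fin (n + 3)))) (u w : EuclideanSpace ℝ (Fin (n + 3)) → ℝ)
      (p q : EuclideanSpace ℝ (Fin (n + 3)) → EuclideanSpace ℝ (Fin (n + 3))) (ε β : ℝ)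
      (i : Fin 4),
      EikonalPair N Ω u w p q ∧ x ∈ Ω ∧ q x = η₀ ∧ finrank ℝ (tang N x) = n + 1 ∧
      n + 1 = 2 * s ∧ traceCLM _ (fderiv ℝ q x) = 0 ∧ ε ^ 2 = 1 ∧ 0 < β ∧ 2 * β ≤ |a| ∧
      κ i = ε * |a| ∧ finrank ℝ (curvSpace N x η₀ (κ i)) = 4 ∧ (∀ j, |κ j| ≤ |κ i|) ∧
      ∀ v ∈ tang N x, ‖fderiv ℝ q x v‖ ^ 2 ≤
        (|a| - β) * (-ε * ⟪fderiv ℝ q x v, v⟫) + |a| * β * ‖v‖ ^ 2 := by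
  obtain ⟨Ω, u, w, p, q, h, hx, rfl, hΩ, hinv⟩ :=
    EikonalPair.exists_of_isIsoparametric hN hxN hη
  have hi := hinv x hx
  have hQx := h.aeval_prod_eq_zero hx hxN hpc
  have hQ : ∀ y ∈ Ω, Polynomial.aeval (EikonalPair.shape u w q y)
      (∏ j, (Polynomial.X - Polynomial.C (κ j))) * EikonalPair.tproj p q y = 0 := fun y hy =>
    h.aeval_tproj_eq_zero hΩ hinv hy hx hQx
  set m : Fin 4 → ℝ := fun j => finrank ℝ (curvSpace N x (q x) (κ j)) with hm
  have hne : ∀ j, curvSpace N x (q x) (κ j) ≠ ⊥ := fun j => by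
    have : κ j ∈ principalCurvatures N x (q x) := hpc ▸ Set.mem_range_self j
    exact this
  have hmpos : ∀ j, 0 < m j := fun j => by
    simp only [hm]
    exact_mod_cast Submodule.one_le_finrank_iff.2 (hne j)
  have hodd : ∀ i, ∀ l : ℕ, Odd l → ∑ j, m j * EikonalPair.cotSub κ i j ^ l = 0 := by
    intro i l hl
    obtain ⟨e, he, he0⟩ := (Submodule.ne_bot_iff _).1 (hne i)
    obtain ⟨het, hei⟩ := (h.mem_curvSpace_iff hx hxN).1 he
    rw [← h.traceCLM_fcalc hx hxN hκ.injective hQx]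
    exact h.trace_fcalc_cotSub_pow hΩ hinv hκ.injective hQ hx hxN i he0 het hei hl
  have htrq := h.trace_fderiv_q_eq_zero hx hxN hmin
  have htr : ∑ j, m j * κ j = 0 := by
    rw [← h.traceCLM_fcalc hx hxN hκ.injective hQx, h.fcalc_id hx hi hκ.injective hQx,
      h.shape_of_mem hx hxN, map_neg, htrq, neg_zero]
  have hm0 : m 0 = m₁ := by simp [hm, hm₁]
  have hm1 : m 1 = m₂ := by simp [hm, hm₂]
  have hsr : (s : ℝ) = m 0 + m 1 := by rw [hm0, hm1, hs]; push_cast; ring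
  obtain ⟨ε, β, i, hε, hβ, hαβ, hκi, hmi, hb⟩ := principalCurvatures_bounds hκ hmpos hodd htr
    (by rw [hm0, hm1]; exact_mod_cast hq) hsr (by exact_mod_cast hs15) ha
  obtain ⟨-, -, m02, m13, -⟩ := principalCurvatures_relations hκ hmpos hodd
  have hdim := h.finrank_tang hx hxN
  rw [finrank_euclideanSpace_fin] at hdim
  have hdim' : finrank ℝ (tang N x) = n + 1 := by
    have : (finrank ℝ (tang N x) : ℝ) = ((n + 1 : ℕ) : ℝ) := by rw [hdim]; push_cast; ring
    exact_mod_cast this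
  -- The multiplicities add up to $\dim N$; as they alternate, this is $2(m_1+m_2)=n+1$.
  have hsum : ∑ j, m j * (1 : Fin 4 → ℝ) j = n + 1 := by
    rw [← h.traceCLM_fcalc hx hxN hκ.injective hQx, h.fcalc_one hx hi hκ.injective hQx,
      h.traceCLM_tproj hx hxN, finrank_euclideanSpace_fin]
    push_cast
    ring
  rw [Fin.sum_univ_four, ← m02, ← m13] at hsum
  refine ⟨Ω, u, w, p, q, ε, β, i, h, hx, rfl, hdim', ?_, htrq, hε, hβ, hαβ, hκi, ?_, fun j => ?_,
    fun v hv => h.norm_fderiv_q_sq_le hx hxN hκ.injective hQx hε hb hv⟩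
  · have : ((n + 1 : ℕ) : ℝ) = ((2 * s : ℕ) : ℝ) := by
      push_cast
      rw [hsr, ← hsum]
      simp
      ring
    exact_mod_cast this
  · simp only [hm] at hmi
    exact_mod_cast hmi
  · have hε1 : |ε| = 1 := by
      rw [← sq_eq_sq₀ (abs_nonneg _) zero_le_one, sq_abs, hε, one_pow]
    have h1 : |κ j| = |ε * κ j| := by rw [abs_mul, hε1, one_mul]
    rw [hκi, abs_mul, hε1, one_mul, abs_abs, h1]
    exact abs_le.2 ⟨by linarith [(hb j).1], (hb j).2⟩

/-! ### Hausdorff measure of embedded submanifolds -/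

section HausdorffMeasure

theorem LipschitzOnWith.euclideanHausdorffMeasure_image_le {X Y : Type*} [EMetricSpace X]
    [EMetricSpace Y] [MeasurableSpace X] [MeasurableSpace Y] [BorelSpace X] [BorelSpace Y]
    {K : NNReal} {f : X → Y} {s : Set X} (hf : LipschitzOnWith K f s) (d : ℕ) :
    μHE[d] (f '' s) ≤ (K : ENNReal) ^ d * μHE[d] s := by
  rw [Measure.euclideanHausdorffMeasure_def, Measure.euclideanHausdorffMeasure_def,
    Measure.smul_apply, Measure.smul_apply, ENNReal.smul_def, ENNReal.smul_def, smul_eq_mul,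
    smul_eq_mul, mul_left_comm]
  gcongr
  simpa using hf.hausdorffMeasure_image_le (d := d) (Nat.cast_nonneg d)

variable {E F : Type*} [NormedAddCommGroup E] [InnerProductSpace ℝ E] [FiniteDimensional ℝ E]
  [MeasurableSpace E] [BorelSpace E]
  [NormedAddCommGroup F] [NormedSpace ℝ F] [FiniteDimensional ℝ F]

/-- Near $p$ the set is contained in the Lipschitz image of a ball in the kernel, by strict
differentiability of the parametrisation. -/
theorem exists_nhds_euclideanHausdorffMeasure_lt_top {S : Set E} {p : E} {h : E → F}
    {L : E →L[ℝ] F} (hp : p ∈ S) (hh : HasStrictFDerivAt h L p) (hL : Function.Surjective L)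
    (hS : ∀ᶠ x in 𝓝 p, x ∈ S ↔ h x = 0) {d : ℕ} (hd : finrank ℝ L.ker = d) :
    ∃ W ∈ 𝓝 p, μHE[d] (S ∩ W) < ⊤ := by
  subst hd
  obtain ⟨ψ, hψ0, hψd, -, -, hψ⟩ := exists_local_param hp hh hL hS
  obtain ⟨K, s, hs, hlip⟩ := hψd.exists_lipschitzOnWith
  obtain ⟨r, hr, hball⟩ := Metric.mem_nhds_iff.1 hs
  have hc : Continuous fun x : E => L.ker.orthogonalProjectionOnto (x - p) := by fun_prop
  have hev : ∀ᶠ x in 𝓝 p, L.ker.orthogonalProjectionOnto (x - p) ∈ Metric.ball (0 : L.ker) r := by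
    refine hc.continuousAt.eventually_mem (Metric.isOpen_ball.mem_nhds ?_)
    simpa using hr
  refine ⟨_, hψ.and hev, ?_⟩
  have hsub : S ∩ {x | (x ∈ S → ψ (L.ker.orthogonalProjectionOnto (x - p)) = x) ∧
      L.ker.orthogonalProjectionOnto (x - p) ∈ Metric.ball (0 : L.ker) r} ⊆
      ψ '' Metric.ball 0 r := fun x hx => ⟨_, hx.2.2, hx.2.1 hx.1⟩
  refine (measure_mono hsub).trans_lt
    (((hlip.mono hball).euclideanHausdorffMeasure_image_le _).trans_lt ?_)
  exact ENNReal.mul_lt_top (by finiteness) Metric.isBounded_ball.measure_lt_top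

/-- The orthogonal projection to the tangent space is $1$-Lipschitz and maps the piece of $S$ onto a
neighbourhood of the origin. -/
theorem euclideanHausdorffMeasure_pos {S : Set E} {p : E} {h : E → F}
    {L : E →L[ℝ] F} (hp : p ∈ S) (hh : HasStrictFDerivAt h L p) (hL : Function.Surjective L)
    (hS : ∀ᶠ x in 𝓝 p, x ∈ S ↔ h x = 0) {d : ℕ} (hd : finrank ℝ L.ker = d) {W : Set E}
    (hW : W ∈ 𝓝 p) : 0 < μHE[d] (S ∩ W) := by
  subst hd
  obtain ⟨ψ, hψ0, hψd, hψS, hψr, -⟩ := exists_local_param hp hh hL hS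
  have hlip : LipschitzWith 1 fun x : E => L.ker.orthogonalProjectionOnto (x - p) := by
    refine LipschitzWith.of_dist_le_mul fun x y => ?_
    rw [dist_eq_norm, dist_eq_norm, ← map_sub, sub_sub_sub_cancel_right, NNReal.coe_one, one_mul]
    exact Submodule.norm_orthogonalProjectionOnto_apply_le _ _
  have hψW : ∀ᶠ v in 𝓝 (0 : L.ker), ψ v ∈ W :=
    hψd.continuousAt.eventually_mem (by rwa [hψ0])
  have hmem : (fun x : E => L.ker.orthogonalProjectionOnto (x - p)) '' (S ∩ W) ∈
      𝓝 (0 : L.ker) := by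
    filter_upwards [hψS, hψr, hψW] with v h1 h2 h3 using ⟨ψ v, ⟨h1, h3⟩, h2⟩
  have h1 := (hlip.lipschitzOnWith (s := S ∩ W)).euclideanHausdorffMeasure_image_le
    (finrank ℝ L.ker)
  rw [ENNReal.coe_one, one_pow, one_mul] at h1
  exact (Measure.measure_pos_of_mem_nhds _ hmem).trans_le h1

end HausdorffMeasure

/-! ### Continuity of the tangent projections -/

section Embedded

variable {E F : Type*} [NormedAddCommGroup E] [InnerProductSpace ℝ E] [FiniteDimensional ℝ E]
  [NormedAddCommGroup F] [InnerProductSpace ℝ F] [FiniteDimensional ℝ F]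

theorem ContinuousLinearMap.isUnit_comp_adjoint {A : E →L[ℝ] F} (hA : Function.Surjective A) :
    IsUnit (A.comp A.adjoint) := by
  rw [ContinuousLinearMap.isUnit_iff_bijective]
  have hinj : Function.Injective (A.comp A.adjoint) := by
    rw [injective_iff_map_eq_zero]
    intro z hz
    obtain ⟨x, rfl⟩ := hA z
    have h1 : ⟪A.adjoint (A x), A.adjoint (A x)⟫ = 0 := by
      rw [ContinuousLinearMap.adjoint_inner_left, ← ContinuousLinearMap.comp_apply, hz,
        inner_zero_right]
    rw [inner_self_eq_zero] at h1
    rw [← inner_self_eq_zero (𝕜 := ℝ), ← ContinuousLinearMap.adjoint_inner_left, h1,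
      inner_zero_left]
  exact ⟨hinj, (LinearMap.injective_iff_surjective (f := (A.comp A.adjoint : F →ₗ[ℝ] F))).1 hinj⟩

theorem ContinuousLinearMap.starProjection_ker {A : E →L[ℝ] F} (hA : IsUnit (A.comp A.adjoint)) :
    A.ker.starProjection = ContinuousLinearMap.id ℝ E -
      A.adjoint.comp ((Ring.inverse (A.comp A.adjoint)).comp A) := by
  ext v
  refine Submodule.eq_starProjection_of_mem_of_inner_eq_zero (K := A.ker) ?_ ?_
  · have h1 := congrArg (fun B : F →L[ℝ] F => B (A v)) (Ring.mul_inverse_cancel _ hA)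
    simp only [mul_apply_eq_comp, ContinuousLinearMap.comp_apply, one_apply] at h1
    simp only [LinearMap.mem_ker, ContinuousLinearMap.coe_coe, sub_apply, map_sub,
      ContinuousLinearMap.comp_apply, ContinuousLinearMap.id_apply]
    rw [h1]
    exact sub_self (A v)
  · intro b hb
    have hb' : A b = 0 := hb
    simp [ContinuousLinearMap.adjoint_inner_left, hb']

/-- With $A=dh_y$ surjective, the projection to $\ker A$ is $1-A^*(AA^*)^{-1}A$, which is continuous
in $A$. -/
theorem continuousWithinAt_starProjection_tang {k : ℕ} {M : Set E} (hM : IsEmbedded k M) {p : E}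
    (hp : p ∈ M) : ContinuousWithinAt (fun y => (tang M y).starProjection) M p := by
  obtain ⟨U, h, hU, hpU, hh, hiff, hsurj⟩ := hM p hp
  have hc : ContinuousAt (fderiv ℝ h) p :=
    ((hh.contDiffAt (hU.mem_nhds hpU)).fderiv_right (m := 0) (by simp)).continuousAt
  have hadj : Continuous fun A : E →L[ℝ] EuclideanSpace ℝ (Fin k) => A.adjoint :=
    (ContinuousLinearMap.adjoint (𝕜 := ℝ) (E := E) (F := EuclideanSpace ℝ (Fin k))).continuous
  have hc2 : ContinuousAt (fun y => (fderiv ℝ h y).comp (fderiv ℝ h y).adjoint) p :=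
    hc.clm_comp (hadj.continuousAt.comp hc)
  have hu := ContinuousLinearMap.isUnit_comp_adjoint hsurj
  have hev : ∀ᶠ y in 𝓝 p, IsUnit ((fderiv ℝ h y).comp (fderiv ℝ h y).adjoint) :=
    hc2.eventually (Units.isOpen.mem_nhds hu)
  have hinv : ContinuousAt
      (fun y => Ring.inverse ((fderiv ℝ h y).comp (fderiv ℝ h y).adjoint)) p := by
    obtain ⟨w, hw⟩ := hu
    refine ContinuousAt.comp (g := Ring.inverse) ?_ hc2
    rw [← hw]
    exact NormedRing.inverse_continuousAt w
  have hform : ContinuousAt (fun y => ContinuousLinearMap.id ℝ E - (fderiv ℝ h y).adjoint.comp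
      ((Ring.inverse ((fderiv ℝ h y).comp (fderiv ℝ h y).adjoint)).comp (fderiv ℝ h y))) p :=
    continuousAt_const.sub ((hadj.continuousAt.comp hc).clm_comp (hinv.clm_comp hc))
  have heq : ∀ᶠ y in 𝓝 p, y ∈ M → (tang M y).starProjection = ContinuousLinearMap.id ℝ E -
      (fderiv ℝ h y).adjoint.comp
      ((Ring.inverse ((fderiv ℝ h y).comp (fderiv ℝ h y).adjoint)).comp (fderiv ℝ h y)) := by
    filter_upwards [hev, hU.mem_nhds hpU] with y hy hyU hyM
    have hs : Function.Surjective (fderiv ℝ h y) := fun z => by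
      obtain ⟨x, hx⟩ := ((ContinuousLinearMap.isUnit_iff_bijective).1 hy).2 z
      exact ⟨_, hx⟩
    have hstrict : HasStrictFDerivAt h (fderiv ℝ h y) y :=
      (hh.contDiffAt (hU.mem_nhds hyU)).hasStrictFDerivAt (by simp)
    have ht : tang M y = (fderiv ℝ h y).ker := tang_eq_ker hyM hstrict hs
      (by filter_upwards [hU.mem_nhds hyU] with x hx using hiff x hx)
    rw [← ContinuousLinearMap.starProjection_ker hy]
    simp only [ht]
  refine hform.continuousWithinAt.congr_of_eventuallyEq ?_ (heq.self_of_nhds hp)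
  filter_upwards [mem_nhdsWithin_of_mem_nhds heq, self_mem_nhdsWithin] with y h1 h2 using h1 h2

end Embedded

section EmbeddedMeasure

variable {n : ℕ} {M : Set (EuclideanSpace ℝ (Fin (n + 3)))}

theorem Submfd.IsEmbedded.exists_submersion (hM : IsEmbedded 3 M)
    {p : EuclideanSpace ℝ (Fin (n + 3))} (hp : p ∈ M) :
    ∃ (h : EuclideanSpace ℝ (Fin (n + 3)) → EuclideanSpace ℝ (Fin 3))
      (L : EuclideanSpace ℝ (Fin (n + 3)) →L[ℝ] EuclideanSpace ℝ (Fin 3)),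
      HasStrictFDerivAt h L p ∧ Function.Surjective L ∧ (∀ᶠ x in 𝓝 p, x ∈ M ↔ h x = 0) ∧
        finrank ℝ L.ker = n := by
  obtain ⟨U, h, hU, hpU, hh, hiff, hsurj⟩ := hM p hp
  refine ⟨h, fderiv ℝ h p, (hh.contDiffAt (hU.mem_nhds hpU)).hasStrictFDerivAt (by simp), hsurj,
    by filter_upwards [hU.mem_nhds hpU] with x hx using hiff x hx, ?_⟩
  have h1 := LinearMap.finrank_range_add_finrank_ker
    (fderiv ℝ h p : EuclideanSpace ℝ (Fin (n + 3)) →ₗ[ℝ] EuclideanSpace ℝ (Fin 3))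
  rw [LinearMap.range_eq_top.2 hsurj, finrank_top, finrank_euclideanSpace_fin,
    finrank_euclideanSpace_fin] at h1
  change finrank ℝ (fderiv ℝ h p : EuclideanSpace ℝ (Fin (n + 3)) →ₗ[ℝ]
    EuclideanSpace ℝ (Fin 3)).ker = n
  omega

theorem Submfd.IsEmbedded.measure_lt_top (hM : IsEmbedded 3 M) (hc : IsCompact M) :
    μHE[n] M < ⊤ := by
  refine hc.measure_lt_top_of_nhdsWithin fun p hp => ?_
  obtain ⟨h, L, hh, hL, hS, hd⟩ := hM.exists_submersion hp
  obtain ⟨W, hW, hlt⟩ := exists_nhds_euclideanHausdorffMeasure_lt_top hp hh hL hS hd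
  exact ⟨M ∩ W, inter_mem self_mem_nhdsWithin (mem_nhdsWithin_of_mem_nhds hW), hlt⟩

theorem Submfd.IsEmbedded.measure_inter_pos (hM : IsEmbedded 3 M)
    {p : EuclideanSpace ℝ (Fin (n + 3))} (hp : p ∈ M) {W : Set (EuclideanSpace ℝ (Fin (n + 3)))}
    (hW : W ∈ 𝓝 p) : 0 < μHE[n] (M ∩ W) := by
  obtain ⟨h, L, hh, hL, hS, hd⟩ := hM.exists_submersion hp
  exact euclideanHausdorffMeasure_pos hp hh hL hS hd hW

end EmbeddedMeasure

/-! ### From the pointwise bound to the integral condition -/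

namespace EikonalPair

section

variable {E : Type*} [NormedAddCommGroup E] [InnerProductSpace ℝ E] [FiniteDimensional ℝ E]
  {N Ω : Set E} {u w : E → ℝ} {p q : E → E} (h : EikonalPair N Ω u w p q) {x : E} (hx : x ∈ Ω)
  (hxN : x ∈ N)
include h hx hxN

/-- The projection to the normal line of `M` in `N`. -/
theorem tproj_sub_starProjection_tang {M : Set E} (hMN : M ⊆ N) {n : ℕ}
    (hn : finrank ℝ (tang N x) = n + 1) {e : Fin n → E} {ν : E} (he : Orthonormal ℝ e)
    (heM : ∀ k, e k ∈ tang M x) (hν : ν ∈ tang N x) (hν1 : ‖ν‖ = 1)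
    (hort : ∀ a ∈ tang M x, ⟪ν, a⟫ = 0) :
    tproj p q x - (tang M x).starProjection = (innerSL ℝ ν).smulRight ν := by
  have hle := tang_mono hMN x
  obtain ⟨b, hb0, hbs⟩ := exists_orthonormalBasis_cons hn he (fun k => hle (heM k)) hν hν1
    fun k => by rw [real_inner_comm, hort _ (heM k)]
  rw [sub_eq_iff_eq_add, ← sub_eq_iff_eq_add']
  ext v
  refine (Submodule.eq_starProjection_of_mem_of_inner_eq_zero (K := tang M x) ?_ ?_).symm
  · have ht : tproj p q x v ∈ tang N x :=
      (h.mem_tang_iff hx hxN _).2 ⟨h.inner_p_tproj hx v, h.inner_q_tproj hx v⟩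
    have h1 := congrArg (Subtype.val) (b.sum_repr' ⟨_, ht⟩)
    rw [Fin.sum_univ_succ] at h1
    simp only [Submodule.coe_add, Submodule.coe_smul, Submodule.coe_inner, hb0, hbs,
      Submodule.coe_sum] at h1
    rw [sub_apply, ContinuousLinearMap.smulRight_apply, innerSL_apply_apply, ← h1,
      ← h.tproj_symm hx, h.tproj_of_mem_tang hx hxN hν, add_sub_cancel_left]
    exact Submodule.sum_mem _ fun k _ => Submodule.smul_mem _ _ (heM k)
  · intro a ha
    rw [sub_apply, ContinuousLinearMap.smulRight_apply, innerSL_apply_apply, inner_sub_left,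
      inner_sub_left, real_inner_smul_left, hort a ha, h.tproj_symm hx,
      h.tproj_of_mem_tang hx hxN (hle ha)]
    simp

end

end EikonalPair

section ACS

variable {n : ℕ} {N : Set (EuclideanSpace ℝ (Fin (n + 3)))}

theorem EikonalPair.finrank_tang_eq {Ω : Set (EuclideanSpace ℝ (Fin (n + 3)))}
    {u w : EuclideanSpace ℝ (Fin (n + 3)) → ℝ}
    {p q : EuclideanSpace ℝ (Fin (n + 3)) → EuclideanSpace ℝ (Fin (n + 3))}
    (h : EikonalPair N Ω u w p q) {x : EuclideanSpace ℝ (Fin (n + 3))} (hx : x ∈ Ω)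
    (hxN : x ∈ N) : finrank ℝ (tang N x) = n + 1 := by
  have hdim := h.finrank_tang hx hxN
  rw [finrank_euclideanSpace_fin] at hdim
  have : (finrank ℝ (tang N x) : ℝ) = ((n + 1 : ℕ) : ℝ) := by rw [hdim]; push_cast; ring
  exact_mod_cast this

variable (hpair : ∀ x ∈ N, ∃ Ω u w p q, EikonalPair N Ω u w p q ∧ x ∈ Ω)
  (hmin : IsMinimalIn N (unitSphere n)) {M : Set (EuclideanSpace ℝ (Fin (n + 3)))}
  (hM : IsEmbedded 3 M) (hMN : M ⊆ N)
  {X ν : EuclideanSpace ℝ (Fin (n + 3)) → EuclideanSpace ℝ (Fin (n + 3))}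
  {e : EuclideanSpace ℝ (Fin (n + 3)) → Fin n → EuclideanSpace ℝ (Fin (n + 3))}
  (hX : Continuous X) (hXM : ∀ p ∈ M, X p ∈ tang M p)
  (hν : ∀ p ∈ M, IsUnitNormalAt M N p (ν p))
  (he : ∀ p ∈ M, Orthonormal ℝ (e p) ∧ ∀ k, e p k ∈ tang M p)

include hMN hν he in
theorem isFrame_of_hypersurface {x : EuclideanSpace ℝ (Fin (n + 3))} (hx : x ∈ M) :
    IsFrame N x (ν x) (e x) :=
  ⟨(he x hx).1, fun k => ⟨tang_mono hMN x ((he x hx).2 k), by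
    rw [real_inner_comm, (hν x hx).2.2 _ ((he x hx).2 k)]⟩⟩

include hpair hmin hM hMN hX hXM hν he

theorem continuousOn_acs :
    ContinuousOn (fun p => acsCurv N p (e p) (X p) (ν p)) M ∧
      ContinuousOn (fun p => acsSff N p (e p) (X p) (ν p)) M := by
  have key : ∀ x ∈ M, ContinuousWithinAt (fun p => acsCurv N p (e p) (X p) (ν p)) M x ∧
      ContinuousWithinAt (fun p => acsSff N p (e p) (X p) (ν p)) M x := by
    intro x hx
    obtain ⟨Ω, u, w, p, q, h, hxΩ⟩ := hpair x (hMN hx)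
    set S := fderiv ℝ q with hS
    -- The frame and $\nu$ are chosen point by point and need not be continuous. The integrands
    -- depend on $\nu$ only through $P=\nu\otimes\nu$, the difference of two continuous projections.
    set P := fun y => EikonalPair.tproj p q y - (tang M y).starProjection with hP
    have hSc : ContinuousWithinAt S M x :=
      (h.contDiffAt_fderiv_q hxΩ).continuousAt.continuousWithinAt
    have hPc : ContinuousWithinAt P M x :=
      (h.contDiffAt_tproj hxΩ).continuousAt.continuousWithinAt.sub
        (continuousWithinAt_starProjection_tang hM hx)
    have hXc : ContinuousWithinAt X M x := hX.continuousWithinAt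
    have hSX : ContinuousWithinAt (fun y => S y (X y)) M x := hSc.clm_apply hXc
    have hPSX : ContinuousWithinAt (fun y => ⟪P y (S y (X y)), S y (X y)⟫) M x :=
      (hPc.clm_apply hSX).inner hSX
    have htr1 : ContinuousWithinAt (fun y => traceCLM _ (S y * P y)) M x :=
      (traceCLM _).continuous.continuousAt.comp_continuousWithinAt (hSc.mul hPc)
    have htr2 : ContinuousWithinAt (fun y => traceCLM _ (S y * (S y * P y))) M x :=
      (traceCLM _).continuous.continuousAt.comp_continuousWithinAt (hSc.mul (hSc.mul hPc))
    have hXX : ContinuousWithinAt (fun y => ⟪S y (X y), X y⟫) M x := hSX.inner hXc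
    have hX2 : ContinuousWithinAt (fun y => ‖X y‖ ^ 2) M x := hXc.norm.pow 2
    have hSX2 : ContinuousWithinAt (fun y => ‖S y (X y)‖ ^ 2) M x := hSX.norm.pow 2
    have hform : ∀ y ∈ Ω, y ∈ M →
        acsCurv N y (e y) (X y) (ν y) = (2 * n - 1 - traceCLM _ (S y * (S y * P y))) * ‖X y‖ ^ 2 -
          ‖S y (X y)‖ ^ 2 + ⟪P y (S y (X y)), S y (X y)⟫ -
          ⟪S y (X y), X y⟫ * traceCLM _ (S y * P y) ∧
        acsSff N y (e y) (X y) (ν y) = (1 + traceCLM _ (S y * (S y * P y)) -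
          traceCLM _ (S y * P y) ^ 2) * ‖X y‖ ^ 2 + ‖S y (X y)‖ ^ 2 -
          ⟪P y (S y (X y)), S y (X y)⟫ := by
      intro y hyΩ hyM
      have hyN := hMN hyM
      have hn := h.finrank_tang_eq hyΩ hyN
      have htr := h.trace_fderiv_q_eq_zero hyΩ hyN hmin
      have hfr := isFrame_of_hypersurface hMN hν he hyM
      obtain ⟨hν1, hν2, hν3⟩ := hν y hyM
      have hXN := tang_mono hMN y (hXM y hyM)
      have hXν : ⟪X y, ν y⟫ = 0 := by rw [real_inner_comm, hν3 _ (hXM y hyM)]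
      have hPy : P y = (innerSL ℝ (ν y)).smulRight (ν y) :=
        h.tproj_sub_starProjection_tang hyΩ hyN hMN hn (he y hyM).1 (he y hyM).2 hν1 hν2 hν3
      have hcomp : ∀ (B : EuclideanSpace ℝ (Fin (n + 3)) →L[ℝ] EuclideanSpace ℝ (Fin (n + 3))) a b,
          B * (innerSL ℝ a).smulRight b = (innerSL ℝ a).smulRight (B b) := by
        intro B a b
        ext v
        simp
      have e1 : traceCLM _ (S y * P y) = ⟪S y (ν y), ν y⟫ := by
        rw [hPy, hcomp, traceCLM_smulRight, innerSL_apply_apply, real_inner_comm]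
      have e2 : traceCLM _ (S y * (S y * P y)) = ‖S y (ν y)‖ ^ 2 := by
        rw [hPy, hcomp, hcomp, traceCLM_smulRight, innerSL_apply_apply, ← h.symm_q hyΩ,
          real_inner_self_eq_norm_sq]
      have e3 : ⟪P y (S y (X y)), S y (X y)⟫ = ⟪S y (X y), ν y⟫ ^ 2 := by
        rw [hPy, ContinuousLinearMap.smulRight_apply, innerSL_apply_apply, real_inner_smul_left,
          real_inner_comm (S y (X y)) (ν y), sq]
      rw [e1, e2, e3]
      exact ⟨h.acsCurv_eq hyΩ hyN hn htr hfr hν1 hν2 hXN hXν,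
        h.acsSff_eq hyΩ hyN hn hfr hν1 hν2 hXN hXν⟩
    have hev : ∀ᶠ y in 𝓝[M] x, y ∈ Ω := mem_nhdsWithin_of_mem_nhds (h.isOpen.mem_nhds hxΩ)
    constructor
    · refine ((((continuousWithinAt_const.sub htr2).mul hX2).sub hSX2).add hPSX |>.sub
        (hXX.mul htr1)).congr_of_eventuallyEq (f := fun y =>
          (2 * n - 1 - traceCLM _ (S y * (S y * P y))) * ‖X y‖ ^ 2 -
          ‖S y (X y)‖ ^ 2 + ⟪P y (S y (X y)), S y (X y)⟫ -
          ⟪S y (X y), X y⟫ * traceCLM _ (S y * P y)) ?_ (hform x hxΩ hx).1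
      filter_upwards [hev, self_mem_nhdsWithin] with y h1 h2 using (hform y h1 h2).1
    · refine ((((continuousWithinAt_const.add htr2).sub (htr1.pow 2)).mul hX2).add hSX2 |>.sub
        hPSX).congr_of_eventuallyEq (f := fun y => (1 + traceCLM _ (S y * (S y * P y)) -
          traceCLM _ (S y * P y) ^ 2) * ‖X y‖ ^ 2 + ‖S y (X y)‖ ^ 2 -
          ⟪P y (S y (X y)), S y (X y)⟫) ?_ (hform x hxΩ hx).2
      filter_upwards [hev, self_mem_nhdsWithin] with y h1 h2 using (hform y h1 h2).2
  exact ⟨fun x hx => (key x hx).1, fun x hx => (key x hx).2⟩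

omit hpair hmin hM hMN hX hXM hν he in
theorem ContinuousOn.integrableOn_of_isCompact_measure_lt_top {α : Type*} [TopologicalSpace α]
    [T2Space α] [MeasurableSpace α] [OpensMeasurableSpace α] {μ : Measure α} {s : Set α}
    {f : α → ℝ} (hf : ContinuousOn f s) (hs : IsCompact s) (hμ : μ s < ⊤) : IntegrableOn f s μ := by
  obtain ⟨C, hC⟩ := hs.exists_bound_of_continuousOn hf
  exact IntegrableOn.of_bound hμ (hf.aestronglyMeasurable hs.measurableSet) C
    ((ae_restrict_mem hs.measurableSet).mono fun x hx => hC x hx)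

omit hM hMN hX hXM hν he in
/-- A positive pointwise lower bound of `Δ` gives the Ambrozio–Carlotto–Sharp condition. -/
theorem satisfiesACS_of_delta_ge {C : ℝ} (hC : 0 < C)
    (hΔ : ∀ p ∈ N, ∀ X ∈ tang N p, ∀ ν ∈ tang N p, ‖ν‖ = 1 → ⟪X, ν⟫ = 0 →
      ∀ e : Fin n → EuclideanSpace ℝ (Fin (n + 3)), IsFrame N p ν e →
        C * ‖X‖ ^ 2 ≤ Delta N p e X ν) : SatisfiesACS N := by
  intro M hMc hM hMmin X ν e hX hXM hX0 hν he
  have hMN := hMmin.1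
  obtain ⟨hc1, hc2⟩ := continuousOn_acs hpair hmin hM hMN hX.continuous hXM hν he
  have hμ := hM.measure_lt_top hMc
  have hi1 := hc1.integrableOn_of_isCompact_measure_lt_top hMc hμ
  have hi2 := hc2.integrableOn_of_isCompact_measure_lt_top hMc hμ
  refine ⟨hi1, hi2, ?_⟩
  rw [← sub_pos, ← integral_sub hi1 hi2]
  have hpt : ∀ y ∈ M, C * ‖X y‖ ^ 2 ≤
      acsCurv N y (e y) (X y) (ν y) - acsSff N y (e y) (X y) (ν y) := fun y hy =>
    hΔ y (hMN hy) _ (tang_mono hMN y (hXM y hy)) _ (hν y hy).1 (hν y hy).2.1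
      (by rw [real_inner_comm, (hν y hy).2.2 _ (hXM y hy)]) _
      (isFrame_of_hypersurface hMN hν he hy)
  rw [setIntegral_pos_iff_support_of_nonneg_ae
    ((ae_restrict_mem hMc.measurableSet).mono fun y hy =>
      (by positivity : 0 ≤ C * ‖X y‖ ^ 2).trans (hpt y hy)) (hi1.sub hi2)]
  obtain ⟨y, hy, hy0⟩ := hX0
  -- The difference of the integrands is nonnegative, and is positive where $X\ne0$. That set
  -- contains a relatively open piece of $M$, which has positive measure.
  have hW : {z | X z ≠ 0} ∈ 𝓝 y := hX.continuous.continuousAt.eventually_ne hy0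
  refine (hM.measure_inter_pos hy hW).trans_le (measure_mono fun z hz => ⟨?_, hz.1⟩)
  have h1 := hpt z hz.1
  have h2 : 0 < ‖X z‖ := norm_pos_iff.2 hz.2
  have h3 : 0 < C * ‖X z‖ ^ 2 := by positivity
  exact (h3.trans_le h1).ne'

end ACS

theorem Submodule.exists_orthonormal_pair {E : Type*} [NormedAddCommGroup E]
    [InnerProductSpace ℝ E] (V : Submodule ℝ E) [FiniteDimensional ℝ V] (hV : 2 ≤ finrank ℝ V) :
    ∃ X ∈ V, ∃ Y ∈ V, ‖X‖ = 1 ∧ ‖Y‖ = 1 ∧ ⟪X, Y⟫ = 0 := by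
  let b := stdOrthonormalBasis ℝ V
  let i : Fin (finrank ℝ V) := ⟨0, by omega⟩
  let j : Fin (finrank ℝ V) := ⟨1, by omega⟩
  have hij : i ≠ j := by simp [i, j]
  exact ⟨b i, (b i).2, b j, (b j).2, b.norm_eq_one i, b.norm_eq_one j,
    b.orthonormal.2 hij⟩

theorem proposition3p2 (n m₁ m₂ s : ℕ) (N : Set (EuclideanSpace ℝ (Fin (n + 3))))
    (hN : IsIsoparametric N) (hmin : IsMinimalIn N (unitSphere n))
    (η : EuclideanSpace ℝ (Fin (n + 3)) → EuclideanSpace ℝ (Fin (n + 3)))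
    (hη : ContinuousOn η N) (hη' : ∀ p ∈ N, IsUnitNormalAt N (unitSphere n) p (η p))
    -- `g = 4`, and `m₁`, `m₂` are the multiplicities of the two largest principal curvatures
    (hg : ∀ p ∈ N, ∃ κ : Fin 4 → ℝ, StrictAnti κ ∧
      principalCurvatures N p (η p) = Set.range κ ∧
      Module.finrank ℝ (curvSpace N p (η p) (κ 0)) = m₁ ∧
      Module.finrank ℝ (curvSpace N p (η p) (κ 1)) = m₂)
    (hq : min m₁ m₂ = 4) (hs : s = m₁ + m₂) (hs15 : 15 ≤ s)
    (a : ℝ) (ha : a ^ 2 = (1 + √(1 - 4 / (s : ℝ))) / (1 - √(1 - 4 / (s : ℝ)))) :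
    -- the lower bound is positive
    0 < 4 * (s : ℝ) - 4 - 4 * a ^ 2 ∧
    -- and bounds `Δ(X, ν)` for every orthonormal pair of tangent vectors
    (∀ p ∈ N, ∀ X ∈ tang N p, ∀ ν ∈ tang N p, ‖X‖ = 1 → ‖ν‖ = 1 → inner ℝ X ν = 0 →
      ∀ e : Fin n → EuclideanSpace ℝ (Fin (n + 3)), IsFrame N p ν e →
        4 * (s : ℝ) - 4 - 4 * a ^ 2 ≤ Delta N p e X ν) ∧
    -- it is attained on the eigenspace of the principal curvature of largest absolute value
    (∀ p ∈ N, ∃ κ ∈ principalCurvatures N p (η p), κ ^ 2 = a ^ 2 ∧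
      (∀ μ ∈ principalCurvatures N p (η p), |μ| ≤ |κ|) ∧
      (∃ X ∈ curvSpace N p (η p) κ, ∃ ν ∈ curvSpace N p (η p) κ,
        ‖X‖ = 1 ∧ ‖ν‖ = 1 ∧ inner ℝ X ν = 0) ∧
      (∀ X ∈ curvSpace N p (η p) κ, ∀ ν ∈ curvSpace N p (η p) κ,
        ‖X‖ = 1 → ‖ν‖ = 1 → inner ℝ X ν = 0 →
        ∀ e : Fin n → EuclideanSpace ℝ (Fin (n + 3)), IsFrame N p ν e →
          Delta N p e X ν = 4 * (s : ℝ) - 4 - 4 * a ^ 2)) ∧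
    SatisfiesACS N := by

  have hs15' : (15 : ℝ) ≤ s := by exact_mod_cast hs15
  obtain ⟨ha1, ha2⟩ := sq_add_one_of_eq (by linarith) ha
  -- From $a^2+a^{-2}=s-2$ the bound equals $4+4a^{-2}$.
  have hpos : 0 < 4 * (s : ℝ) - 4 - 4 * a ^ 2 := by nlinarith
  have hdelta : ∀ p ∈ N, ∀ X ∈ tang N p, ∀ ν ∈ tang N p, ‖ν‖ = 1 → ⟪X, ν⟫ = 0 →
      ∀ e : Fin n → EuclideanSpace ℝ (Fin (n + 3)), IsFrame N p ν e →
        (4 * (s : ℝ) - 4 - 4 * a ^ 2) * ‖X‖ ^ 2 ≤ Delta N p e X ν := by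
    intro x hx X hX ν hν hν1 hXν e he
    obtain ⟨κ, hκ, hpc, hκ0, hκ1⟩ := hg x hx
    obtain ⟨Ω, u, w, p, q, ε, β, i, h, hxΩ, -, hn, hns, htr, hε, hβ, hαβ, -, -, -, hbd⟩ :=
      exists_local_data hN hmin hx (hη' x hx) hκ hpc hκ0 hκ1 hq hs hs15 ha
    rw [h.delta_eq hxΩ hx hn htr he hν hν1 hX hXν]
    have h1 := deltaForm_ge (n := n) hε hβ hαβ hbd hX hν hν1
    have h2 : (n : ℝ) = 2 * s - 1 := by
      rw [eq_sub_iff_add_eq]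
      exact_mod_cast hns
    rw [sq_abs, h2] at h1
    linarith
  refine ⟨hpos, fun x hx X hX ν hν hX1 hν1 hXν e he => ?_, fun x hx => ?_, ?_⟩
  · simpa [hX1] using hdelta x hx X hX ν hν hν1 hXν e he
  · obtain ⟨κ, hκ, hpc, hκ0, hκ1⟩ := hg x hx
    obtain ⟨Ω, u, w, p, q, ε, β, i, h, hxΩ, hqη, hn, hns, htr, hε, hβ, hαβ, hκi, hdim, hmax, -⟩ :=
      exists_local_data hN hmin hx (hη' x hx) hκ hpc hκ0 hκ1 hq hs hs15 ha
    have hκsq : κ i ^ 2 = a ^ 2 := by rw [hκi, mul_pow, hε, one_mul, sq_abs]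
    refine ⟨κ i, hpc ▸ Set.mem_range_self i, hκsq, ?_, ?_, ?_⟩
    · rw [hpc]
      rintro _ ⟨j, rfl⟩
      exact hmax j
    · obtain ⟨X, hX, ν, hν, h1, h2, h3⟩ :=
        Submodule.exists_orthonormal_pair (curvSpace N x (η x) (κ i)) (by omega)
      exact ⟨X, hX, ν, hν, h1, h2, h3⟩
    · intro X hX ν hν hX1 hν1 hXν e he
      -- The shape operator is $-S$, so these are eigenvectors of $S$ for $-\kappa_i$; the sign
      -- disappears because only its square enters.
      rw [← hqη, h.mem_curvSpace_iff hxΩ hx, h.shape_of_mem hxΩ hx, neg_apply,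
        neg_eq_iff_eq_neg, ← neg_smul] at hX hν
      rw [h.delta_eq hxΩ hx hn htr he hν.1 hν1 hX.1 hXν,
        deltaForm_of_eigen hX.2 hν.2 hX1 hν1 hXν, neg_sq, hκsq]
      have h2 : (n : ℝ) = 2 * s - 1 := by
        rw [eq_sub_iff_add_eq]
        exact_mod_cast hns
      rw [h2]
      ring
  · refine satisfiesACS_of_delta_ge (fun x hx => ?_) hmin hpos hdelta
    obtain ⟨Ω, u, w, p, q, h, hxΩ, -⟩ :=
      EikonalPair.exists_of_isIsoparametric hN hx (hη' x hx)
    exact ⟨Ω, u, w, p, q, h, hxΩ⟩
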